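/- **Setting.** A *semi-labelled tree* is a finite tree $T=(V,E)$ with a set $W\subseteq V$ of *regular* (labelled) vertices that contains every vertex of degree $\le 2$; the other vertices are *latent*. A *general Markov model* over $T$ is a random vector $Y=(Y_v)_{v\in V}$ with values in $\{0,\dots,r-1\}^V$ whose probability mass function factorizes over the vertices and edges of $T$, $f(y)=\prod_{v\in V}\varphi_v(y_v)\prod_{uv\in E}\psi_{uv}(y_u,y_v)$ with non-negative potentials. Let $P^{uv}$ be the $r\times r$ matrix with entries $P(Y_u=a,Y_v=b)$ (so that $P^{vv}$ is diagonal, with the marginal distribution of $Y_v$ on the diagonal) and $$\tau_{uv}=\frac{\det P^{uv}}{\sqrt{\det P^{uu}\,\det P^{vv}}}.$$ Assume that the model is non-degenerate: $\det P^{uv}\neq 0$ and $|\tau_{uv}|\ne 1$ for every edge $uv\in E$. **The algorithm.** The input is the distance oracle $d(i,j)$, $i,j\in W$, and the maximal degree $\Delta$ of $T$. The algorithm handles *bags* $B$, i.e. finite sets of nodes with a representative $\rho(B)\in B$; the nodes are the regular vertices and the latent nodes which the algorithm creates. It keeps a queue of bags, at first containing only $W$ with an arbitrary $\rho(W)\in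 W$, and a set $S$ of edges (the skeleton), at first empty. While the queue is not empty, it removes the front bag $B$. * If $|B|\le\Delta$, it adds to $S$ the full skeleton of the tree induced by $B$, that is, the edges of a semi-labelled tree with set of regular vertices $B$ and new latent nodes which, for some strictly positive edge lengths, realizes the distances $d(u,v)$, $u,v\in B$. * If $|B|>\Delta$, it draws $u_1,\dots,u_\Delta$ uniformly at random without replacement from $B\setminus\{\rho(B)\}$. Starting with $\mathcal B=\{B\}$, for $i=1,\dots,\Delta$ it finds the bag $B^*\in\mathcal B$ that contains $u_i$ and, if $u_i\ne\rho(B^*)$, replaces $B^*$ in $\mathcal B$ by the bags returned by $\mathrm{basic}(B^*,u_i)$. It then replaces every bag in $\mathcal B$ by the bags returned by $\mathrm{explode}$. If the largest of these bags has at most $|B|/\sqrt{\Delta}$ nodes (if there are no bags, this holds), it adds them to the queue and the edges returned by the calls of $\mathrm{basic}$ to $S$; otherwise it discards them and repeats with a fresh independent sample. $\mathrm{basic}(B,\alpha)$, with $\rho=\rho(B)$: partition $B$ into the classes $B_1,\dots,B_k$ on which $D(v)=d(v,\alpha)-d(v,\rho)$ is constant, ordered by the value of $D$. Let $u_i\in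 B_i$ minimize $d(\cdot,\alpha)$ over $B_i$. If $d(\rho,u_i)+d(u_i,\alpha)=d(\rho,\alpha)$, put $\rho(B_i)=u_i$; otherwise add a new latent node $w_i$ to $B_i$, put $\rho(B_i)=w_i$, and extend the oracle by $d(w_i,v)=\frac12\big(d(v,\alpha)+d(v,\rho)-d(\alpha,\rho)\big)$ for the other $v\in B_i$. Return $B_1,\dots,B_k$ and the edges $\rho(B_1)\rho(B_2),\dots,\rho(B_{k-1})\rho(B_k)$. $\mathrm{explode}(B)$: while $|B|>1$, take some $u\in B\setminus\{\rho(B)\}$, return the bag $B^*=\{v\in B\setminus\{\rho(B)\}: d(u,v)<d(u,\rho(B))+d(v,\rho(B))\}\cup\{\rho(B)\}$ with $\rho(B^*)=\rho(B)$, and replace $B$ by $\{\rho(B)\}\cup(B\setminus B^*)$. **Proposition.** For every non-degenerate general Markov model over a semi-labelled tree $T$ and every choice of the initial representative $\rho(W)\in W$, the algorithm applied to $d(i,j)=-\log|\tau_{ij}|$, $i,j\in W$, stops with probability one, and whenever it stops the skeleton $S$ is $T$ up to the names of the latent vertices: there is an injective map from $V$ to the nodes of the algorithm that fixes every $i\in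 W$ and maps $E$ onto $S$. -/

import Mathlib

open Filter Topology

namespace LatentTree

/-! ### Semi-labelled trees and the distances they induce -/

/-- `G` is a tree in which every vertex of degree at most two is labelled
(`W` is the set of labelled, or regular, vertices; the other vertices are latent). -/
structure IsSemiLabelledTree {V : Type*} (G : SimpleGraph V) (W : Set V) : Prop where
  isTree : G.IsTree
  mem_of_degree_le_two : ∀ v, (G.neighborSet v).ncard ≤ 2 → v ∈ W

/-- `d` agrees on `W` with the path metric of `G` for some strictly positive edge lengths. -/
def Realizes {V : Type*} (G : SimpleGraph V) (W : Set V) (d : V → V → ℝ) : Prop :=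
  ∃ len : Sym2 V → ℝ, (∀ e ∈ G.edgeSet, 0 < len e) ∧
    ∀ i ∈ W, ∀ j ∈ W, ∀ p : G.Walk i j, p.IsPath → d i j = (p.edges.map len).sum

/-! ### General Markov models -/

/-- `f` is the probability mass function of a random vector `Y` indexed by the vertices of `T`, all
of whose coordinates have the state space `{0, …, r - 1}`, and `f` factorizes according to `T`.
The potential `edgePot e` of an edge `e` is a function of the two coordinates at the ends of `e`.
The vertex potentials can be absorbed into the edge potentials as soon as `T` has an edge; they are
there so that every distribution is allowed on a tree with one vertex. -/
structure IsGeneralMarkovModel {V : Type*} [Fintype V] [DecidableEq V] (T : SimpleGraph V)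
    [DecidableRel T.Adj] {r : ℕ} (f : (V → Fin r) → ℝ) : Prop where
  nonneg : ∀ y, 0 ≤ f y
  sum_eq_one : ∑ y, f y = 1
  factorizes : ∃ (vertexPot : V → Fin r → ℝ) (edgePot : Sym2 V → (V → Fin r) → ℝ),
    (∀ v a, 0 ≤ vertexPot v a) ∧ (∀ e y, 0 ≤ edgePot e y) ∧
    (∀ e y y', (∀ v ∈ e, y v = y' v) → edgePot e y = edgePot e y') ∧
    ∀ y, f y = (∏ v, vertexPot v (y v)) * ∏ e ∈ T.edgeFinset, edgePot e y

/-- The matrix `P^{uv}` of the joint distribution of `(Y_u, Y_v)`. For `u = v` it is the diagonal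
matrix with the marginal distribution of `Y_v` on the diagonal. -/
def jointMatrix {V : Type*} [Fintype V] [DecidableEq V] {r : ℕ} (f : (V → Fin r) → ℝ) (u v : V) :
    Matrix (Fin r) (Fin r) ℝ :=
  fun a b => ∑ y, if y u = a ∧ y v = b then f y else 0

/-- `τ_{uv} = det P^{uv} / √(det P^{uu} · det P^{vv})`. -/
noncomputable def tau {V : Type*} [Fintype V] [DecidableEq V] {r : ℕ} (f : (V → Fin r) → ℝ)
    (u v : V) : ℝ :=
  (jointMatrix f u v).det / √((jointMatrix f u u).det * (jointMatrix f v v).det)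

/-! ### The reconstruction algorithm -/

/-- The nodes the algorithm works with: the regular nodes, with labels in `L`, and the latent nodes
that it creates, which are numbered in the order of their creation. -/
abbrev Node (L : Type*) := L ⊕ ℕ

/-- A bag of nodes with its representative. -/
structure Bag (L : Type*) where
  nodes : Finset (Node L)
  rep : Node L

/-- The current distance oracle, and the first number not yet used for a latent node. -/
structure Memory (L : Type*) where
  dist : Node L → Node L → ℝ
  fresh : ℕ

section Algorithm

variable {L : Type*} [DecidableEq L]

/-- Some element of `B` at which `g` is minimal. -/
noncomputable def argmin (B : Finset (Node L)) (g : Node L → ℝ) : Node L :=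
  open Classical in
  if h : ∃ u ∈ B, ∀ v ∈ B, g u ≤ g v then h.choose else Sum.inr 0

/-- The oracle after a new node `w` has been given the distances `len v` to all `v ∈ B`. -/
def extendDist (dist : Node L → Node L → ℝ) (w : Node L) (B : Finset (Node L))
    (len : Node L → ℝ) : Node L → Node L → ℝ :=
  fun x y => if x = w ∧ y ∈ B then len y else if y = w ∧ x ∈ B then len x else dist x y

/-- The treatment of one class `C` of the partition in `basic`: either its point closest to `α` lies
on the path between `ρ` and `α` and becomes the representative, or a new latent node is added and
becomes the representative. -/
noncomputable def basicBag (ρ α : Node L) (m : Memory L) (C : Finset (Node L)) :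
    Bag L × Memory L :=
  let u := argmin C (fun v => m.dist v α)
  if m.dist ρ u + m.dist u α = m.dist ρ α then (⟨C, u⟩, m)
  else
    let w : Node L := Sum.inr m.fresh
    (⟨insert w C, w⟩,
      { dist := extendDist m.dist w C
          (fun v => (m.dist v α + m.dist v ρ - m.dist α ρ) / 2)
        fresh := m.fresh + 1 })

/-- `basicBag` applied to all classes of a partition in turn. -/
noncomputable def basicBags (ρ α : Node L) :
    Memory L → List (Finset (Node L)) → List (Bag L) × Memory L
  | m, [] => ([], m)
  | m, C :: Cs =>
    let first := basicBag ρ α m C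
    let rest := basicBags ρ α first.2 Cs
    (first.1 :: rest.1, rest.2)

/-- The edges between consecutive members of a list. -/
def pathEdges : List (Node L) → Finset (Sym2 (Node L))
  | [] => ∅
  | [_] => ∅
  | a :: b :: l => insert s(a, b) (pathEdges (b :: l))

/-- The classes of `B` on which `D(v) = d(v, α) - d(v, ρ)` is constant, by increasing value of `D`. -/
noncomputable def levelSets (dist : Node L → Node L → ℝ) (B : Finset (Node L)) (ρ α : Node L) :
    List (Finset (Node L)) :=
  ((B.image (fun v => dist v α - dist v ρ)).sort (· ≤ ·)).map
    (fun c => B.filter (fun v => dist v α - dist v ρ = c))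

/-- The current bags, skeleton and memory of a pass of `bigsplit`. -/
structure Split (L : Type*) where
  bags : List (Bag L)
  skeleton : Finset (Sym2 (Node L))
  mem : Memory L

/-- The procedure `basic (B, α)`. -/
noncomputable def basic (m : Memory L) (B : Bag L) (α : Node L) : Split L :=
  let out := basicBags B.rep α m (levelSets m.dist B.nodes B.rep α)
  { bags := out.1
    skeleton := pathEdges (out.1.map Bag.rep)
    mem := out.2 }

/-- The loop of `explode`, for a bag with representative `ρ` and remaining nodes `R` (those of the
bag other than `ρ`). The first argument bounds the number of rounds. -/
noncomputable def explodeLoop (dist : Node L → Node L → ℝ) (ρ : Node L) :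
    ℕ → Finset (Node L) → List (Bag L)
  | 0, _ => []
  | k + 1, R =>
    open Classical in
    if h : R.Nonempty then
      let u := h.choose
      let C := R.filter (fun v => dist u v < dist u ρ + dist v ρ)
      ⟨insert ρ C, ρ⟩ :: explodeLoop dist ρ k (R \ C)
    else []

/-- The procedure `explode (B)`. Every round removes at least one node from the bag, so that
`|B|` rounds suffice. -/
noncomputable def explode (dist : Node L → Node L → ℝ) (B : Bag L) : List (Bag L) :=
  explodeLoop dist B.rep B.nodes.card (B.nodes.erase B.rep)

/-- One step of the `for` loop of `bigsplit`: split the bag that contains `u` by `basic`, unless `u`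
is the representative of that bag. -/
noncomputable def splitAt (σ : Split L) (u : Node L) : Split L :=
  match σ.bags.find? (fun B => decide (u ∈ B.nodes)) with
  | none => σ
  | some B =>
    if u = B.rep then σ
    else
      let out := basic σ.mem B u
      { bags := σ.bags.eraseP (fun B => decide (u ∈ B.nodes)) ++ out.bags
        skeleton := σ.skeleton ∪ out.skeleton
        mem := out.mem }

/-- One pass through the body of the `while` loop of `bigsplit (B, u₁, …, uₖ)`: the bags in the
result are the ones after `explode`. -/
noncomputable def bigsplitPass (m : Memory L) (B : Bag L) (us : List (Node L)) : Split L :=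
  let σ := us.foldl splitAt { bags := [B], skeleton := ∅, mem := m }
  { σ with bags := σ.bags.flatMap (explode σ.mem.dist) }

/-- The size of the largest bag. -/
def maxBagSize (l : List (Bag L)) : ℕ := (l.map (fun B => B.nodes.card)).foldr max 0

/-- The vertices of the tree with edge set `S` that contains the nodes in `B`. -/
def skeletonVerts (B : Finset (Node L)) (S : Finset (Sym2 (Node L))) : Set (Node L) :=
  {x | x ∈ B ∨ ∃ e ∈ S, x ∈ e}

/-- The graph with edge set `S` on the nodes in `B` and the ends of the edges in `S`. -/
def skeletonGraph (B : Finset (Node L)) (S : Finset (Sym2 (Node L))) :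
    SimpleGraph (skeletonVerts B S) :=
  (SimpleGraph.fromEdgeSet (S : Set (Sym2 (Node L)))).induce (skeletonVerts B S)

/-- `S` is the full skeleton of the tree induced by `B`: it is the edge set of a semi-labelled tree
whose labelled vertices are the nodes in `B`, which realizes the distances between them, and whose
other vertices are new latent nodes. -/
structure IsFullSkeleton (m : Memory L) (B : Finset (Node L)) (S : Finset (Sym2 (Node L))) :
    Prop where
  not_isDiag : ∀ e ∈ S, ¬ e.IsDiag
  mem_or_new : ∀ x ∈ skeletonVerts B S, x ∈ B ∨ ∃ k, m.fresh ≤ k ∧ x = Sum.inr k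
  isSemiLabelledTree : IsSemiLabelledTree (skeletonGraph B S) {x | x.1 ∈ B}
  realizes : Realizes (skeletonGraph B S) {x | x.1 ∈ B} (fun x y => m.dist x.1 y.1)

/-- The full skeleton found from all distances between the nodes of `B`. -/
noncomputable def fullSkeleton (m : Memory L) (B : Finset (Node L)) : Finset (Sym2 (Node L)) :=
  open Classical in
  if h : ∃ S, IsFullSkeleton m B S then h.choose else ∅

/-- A number larger than those of all latent nodes in `S`. -/
def latentBound (S : Finset (Sym2 (Node L))) : ℕ :=
  S.sup (fun e => e.toFinset.sup (Sum.elim (fun _ => 0) (fun k => k + 1)))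

/-- The state of the main algorithm: the queue of bags, the skeleton found so far, the memory. -/
structure State (L : Type*) where
  queue : List (Bag L)
  skeleton : Finset (Sym2 (Node L))
  mem : Memory L

/-- The treatment of a bag `B` with at most `κ` nodes; `q` is the rest of the queue. -/
noncomputable def finish (s : State L) (B : Bag L) (q : List (Bag L)) : State L :=
  let S := fullSkeleton s.mem B.nodes
  { queue := q
    skeleton := s.skeleton ∪ S
    mem := { dist := s.mem.dist, fresh := max s.mem.fresh (latentBound S) } }

/-- One pass of `bigsplit` on the front bag `B` with the sampled nodes `us`; `q` is the rest of the
queue. If the largest bag is small enough, `bigsplit` ends and its output is used; otherwise the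
pass is discarded and the loop of `bigsplit` goes on. -/
noncomputable def attempt (Δ : ℕ) (s : State L) (B : Bag L) (q : List (Bag L))
    (us : List (Node L)) : State L :=
  let σ := bigsplitPass s.mem B us
  if (maxBagSize σ.bags : ℝ) ≤ (B.nodes.card : ℝ) / √(Δ : ℝ) then
    { queue := q ++ σ.bags
      skeleton := s.skeleton ∪ σ.skeleton
      mem := σ.mem }
  else s

theorem nonempty_samples {Δ : ℕ} {B : Bag L} (h : ¬ B.nodes.card ≤ Δ) :
    Nonempty (Fin Δ ↪ {v // v ∈ B.nodes.erase B.rep}) := by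
  apply Function.Embedding.nonempty_of_card_le
  have := Finset.pred_card_le_card_erase (s := B.nodes) (a := B.rep)
  simp only [Fintype.card_fin, Fintype.card_coe]
  omega

/-- One step of the algorithm with `κ = Δ`. A bag with more than `κ` nodes is treated by a pass of
`bigsplit` with `κ` nodes sampled uniformly, without replacement, from the nodes of the bag other
than its representative. The sample is fresh in every pass. When the queue is empty the algorithm
has stopped and its state does not change any more. -/
noncomputable def step (Δ : ℕ) (s : State L) : PMF (State L) :=
  match s.queue with
  | [] => PMF.pure s
  | B :: q =>
    if h : B.nodes.card ≤ Δ then PMF.pure (finish s B q)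
    else
      haveI := nonempty_samples h
      (PMF.uniformOfFintype (Fin Δ ↪ {v // v ∈ B.nodes.erase B.rep})).map
        (fun u => attempt Δ s B q (List.ofFn (fun i => (u i : Node L))))

/-- The oracle at the start: it knows the distances between regular nodes. -/
def initialDist (d : L → L → ℝ) : Node L → Node L → ℝ
  | Sum.inl i, Sum.inl j => d i j
  | _, _ => 0

/-- The state at the start: one bag, with all regular nodes and representative `root`. -/
def initialState [Fintype L] (d : L → L → ℝ) (root : L) : State L where
  queue := [⟨Finset.univ.image Sum.inl, Sum.inl root⟩]
  skeleton := ∅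
  mem := { dist := initialDist d, fresh := 0 }

/-- The law of the state of the algorithm after `t` steps, for the distance oracle `d`, the
parameter `Δ` and the root `root`. -/
noncomputable def run [Fintype L] (Δ : ℕ) (d : L → L → ℝ) (root : L) : ℕ → PMF (State L)
  | 0 => PMF.pure (initialState d root)
  | t + 1 => (run Δ d root t).bind (step Δ)

end Algorithm

/-- The skeleton `S` is the tree `T` with its labelling, up to the names of the latent vertices. -/
def Recovers {V : Type*} (T : SimpleGraph V) (W : Finset V) (S : Finset (Sym2 (Node W))) : Prop :=
  ∃ φ : V → Node W, Function.Injective φ ∧ (∀ i : W, φ i = Sum.inl i) ∧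
    Sym2.map φ '' T.edgeSet = (S : Set (Sym2 (Node W)))

end LatentTree

open LatentTree

namespace LatentTree

/-! ### Tree metrics -/

/-! Non-degeneracy makes -log |τ| a path metric with positive edge lengths. If v separates u from w,
then P^{uw} = P^{uv} (P^{vv})⁻¹ P^{vw}, so τ is multiplicative along paths
(`IsGeneralMarkovModel.tau_mul_tau`). Since |det P^{uv}| is at most det P^{uu} and det P^{vv},
always |τ| ≤ 1 (`abs_tau_le_one`). From there on only the metric matters, through medians,
separation, and the fact that an edge is a pair with nothing in between. A latent vertex has three
neighbours, so every vertex is a median of three regular ones, and the distances between regular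
vertices determine the tree (`exists_isometry`).

Correctness is the invariant `Inv`. The nodes in use are identified injectively with vertices by θ;
each bag describes a part of the tree that is attached to the rest at its representative; two parts
share at most a common representative; every edge of T is already in the skeleton or lies inside one
part. `basic` cuts a part into the fibres of the projection onto the path from ρ to α (`Inv.basic`),
`explode` separates the branches at the representative (`Inv.explode_step`), and for a small bag any
full skeleton is isometric to the part (`Inv.of_isFullSkeleton`). With an empty queue only edges of
the skeleton remain (`Inv.recovers`).

Termination uses the number of nodes that do not represent their bag. They are all regular, and a
successful pass loses at least the sampled ones (`Inv.bagRank_lt`). A successful sample always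
exists: besides its representative, an exploded bag consists of the nodes that some vertex v
separates from ρ(B). Such sets form a laminar family, so Δ points hit all the large ones
(`exists_hitting_set`, `Inv.exists_good_sample`). Hence success has probability at least |W|^{-Δ},
the expected rank falls by at least this much while the queue is nonempty (`GoodState.drift`), and
the probabilities of a nonempty queue are summable. -/

/-- `y` lies between `x` and `z`. -/
def Btw {V : Type*} (d : V → V → ℝ) (x y z : V) : Prop := d x y + d y z = d x z

/-- A metric with medians in which every point between `x` and `z` separates any `y` from `x` or
from `z`. -/
structure IsTreeMetric {V : Type*} (d : V → V → ℝ) : Prop where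
  self : ∀ x, d x x = 0
  pos : ∀ x y, x ≠ y → 0 < d x y
  symm : ∀ x y, d x y = d y x
  median : ∀ x y z, ∃ m, Btw d x m y ∧ Btw d y m z ∧ Btw d x m z
  branch : ∀ x m z, Btw d x m z → ∀ y, Btw d x m y ∨ Btw d y m z

/-- Every point is a median of three points in `W`. -/
def MedianLabelled {V : Type*} (d : V → V → ℝ) (W : Set V) : Prop :=
  ∀ v, ∃ i ∈ W, ∃ j ∈ W, ∃ k ∈ W, Btw d i v j ∧ Btw d j v k ∧ Btw d i v k

/-- Adjacency in `G` means that no point lies strictly between. -/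
def AdjOfMetric {V : Type*} (G : SimpleGraph V) (d : V → V → ℝ) : Prop :=
  ∀ x y, G.Adj x y ↔ x ≠ y ∧ ∀ z, Btw d x z y → z = x ∨ z = y

section Metric

variable {V : Type*} {d : V → V → ℝ}

theorem IsTreeMetric.nonneg (h : IsTreeMetric d) (x y : V) : 0 ≤ d x y := by
  rcases eq_or_ne x y with rfl | hxy
  · exact (h.self x).ge
  · exact (h.pos x y hxy).le

theorem IsTreeMetric.eq_of_le_zero (h : IsTreeMetric d) {x y : V} (hxy : d x y ≤ 0) : x = y := by
  by_contra hne
  exact absurd (h.pos x y hne) (not_lt.2 hxy)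

/-- Not an axiom: passing through y instead of the median m costs the detour 2 d(m, y) ≥ 0. -/
theorem IsTreeMetric.triangle (h : IsTreeMetric d) (x y z : V) : d x z ≤ d x y + d y z := by
  obtain ⟨m, h1, h2, h3⟩ := h.median x y z
  unfold Btw at *
  have := h.nonneg m y
  have := h.symm y m
  linarith

theorem IsTreeMetric.btw_comm (h : IsTreeMetric d) {x y z : V} (hb : Btw d x y z) :
    Btw d z y x := by
  unfold Btw at *
  rw [h.symm z y, h.symm y x, h.symm z x]
  linarith

theorem IsTreeMetric.btw_left (h : IsTreeMetric d) (x y : V) : Btw d x x y := by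
  unfold Btw
  rw [h.self]
  ring

theorem IsTreeMetric.btw_right (h : IsTreeMetric d) (x y : V) : Btw d x y y := by
  unfold Btw
  rw [h.self]
  ring

theorem IsTreeMetric.btw_self (h : IsTreeMetric d) {x y : V} (hb : Btw d x y x) : y = x := by
  unfold Btw at hb
  apply h.eq_of_le_zero
  have := h.self x
  have := h.symm x y
  linarith

theorem IsTreeMetric.btw_antisymm (h : IsTreeMetric d) {x y z : V} (h1 : Btw d x y z)
    (h2 : Btw d x z y) : y = z := by
  unfold Btw at *
  apply h.eq_of_le_zero
  have := h.symm y z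
  linarith

/-- If `y` lies between `x` and `z`, and `z` between `x` and `w`, then `y, z` are met in that order
on the way from `x` to `w`. -/
theorem IsTreeMetric.btw_trans (h : IsTreeMetric d) {x y z w : V} (h1 : Btw d x y z)
    (h2 : Btw d x z w) : Btw d x y w ∧ Btw d y z w := by
  unfold Btw at *
  have := h.triangle x y w
  have := h.triangle y z w
  constructor <;> linarith

/-- If `z` lies between `x` and `w`, and `y` between `z` and `w`, then `z, y` are met in that order
on the way from `x` to `w`. -/
theorem IsTreeMetric.btw_trans' (h : IsTreeMetric d) {x y z w : V} (h1 : Btw d z y w)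
    (h2 : Btw d x z w) : Btw d x y w ∧ Btw d x z y := by
  unfold Btw at *
  have := h.triangle x y w
  have := h.triangle x z y
  constructor <;> linarith

/-- The points between x and w are linearly ordered; this is what makes the separated sets laminar
later on. -/
theorem IsTreeMetric.btw_total (h : IsTreeMetric d) {x y z w : V} (h1 : Btw d x y w)
    (h2 : Btw d x z w) : Btw d x y z ∨ Btw d x z y := by
  rcases h.branch _ _ _ h1 z with h3 | h3
  · exact Or.inl h3
  · exact Or.inr (h.btw_trans' h3 h2).2

/-- The distance to a median in terms of the distances to the three points. -/
theorem IsTreeMetric.dist_median (h : IsTreeMetric d) {i j k m : V} (h1 : Btw d i m j)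
    (h2 : Btw d j m k) (h3 : Btw d i m k) (l : V) :
    d m l = max (d i l - (d i j + d i k - d j k) / 2)
      (max (d j l - (d i j + d j k - d i k) / 2) (d k l - (d i k + d j k - d i j) / 2)) := by
  have e1 : d i m = (d i j + d i k - d j k) / 2 := by
    unfold Btw at *
    have := h.symm j m
    linarith
  have e2 : d j m = (d i j + d j k - d i k) / 2 := by
    unfold Btw at *
    have := h.symm j m
    linarith
  have e3 : d k m = (d i k + d j k - d i j) / 2 := by
    unfold Btw at *
    have := h.symm j m
    have := h.symm k m
    linarith
  rw [← e1, ← e2, ← e3]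
  have t1 := h.triangle i m l
  have t2 := h.triangle j m l
  have t3 := h.triangle k m l
  apply le_antisymm
  · rcases h.branch _ _ _ h1 l with hb | hb
    · apply le_max_of_le_left
      unfold Btw at hb
      linarith
    · apply le_max_of_le_right
      apply le_max_of_le_left
      have hb := h.btw_comm hb
      unfold Btw at hb
      linarith
  · apply max_le
    · linarith
    · apply max_le <;> linarith

/-- A median w lies between two labelled points and separates v from one of them. Distances can thus
be read off as differences of distances to a label. -/
theorem IsTreeMetric.exists_label_beyond (h : IsTreeMetric d) {W : Set V}
    (hW : MedianLabelled d W) (v w : V) : ∃ l ∈ W, Btw d v w l := by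
  obtain ⟨i, hi, j, hj, k, hk, h1, h2, h3⟩ := hW w
  rcases h.branch _ _ _ h1 v with hb | hb
  · exact ⟨i, hi, h.btw_comm hb⟩
  · exact ⟨j, hj, hb⟩

/-- Two tree metrics in which every point is a median of labelled points are isometric if the
distances between labelled points agree. -/
theorem exists_isometry {X Y ι : Type*} {dX : X → X → ℝ} {dY : Y → Y → ℝ}
    (hX : IsTreeMetric dX) (hY : IsTreeMetric dY) (a : ι → X) (b : ι → Y)
    (ha : MedianLabelled dX (Set.range a)) (hb : MedianLabelled dY (Set.range b))
    (hab : ∀ i j, dX (a i) (a j) = dY (b i) (b j)) :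
    ∃ e : X ≃ Y, (∀ i, e (a i) = b i) ∧ ∀ v w, dY (e v) (e w) = dX v w := by
  -- Write v as a median of labelled points and take the median of their counterparts; `dist_median`
  -- expresses the distances to all labels by distances between labels only.
  have key : ∀ v, ∃ y, ∀ l, dY y (b l) = dX v (a l) := by
    intro v
    obtain ⟨_, ⟨i, rfl⟩, _, ⟨j, rfl⟩, _, ⟨k, rfl⟩, h1, h2, h3⟩ := ha v
    obtain ⟨m, g1, g2, g3⟩ := hY.median (b i) (b j) (b k)
    refine ⟨m, fun l => ?_⟩
    rw [hX.dist_median h1 h2 h3, hY.dist_median g1 g2 g3]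
    simp only [hab]
  have key' : ∀ y, ∃ v, ∀ l, dY y (b l) = dX v (a l) := by
    intro y
    obtain ⟨_, ⟨i, rfl⟩, _, ⟨j, rfl⟩, _, ⟨k, rfl⟩, h1, h2, h3⟩ := hb y
    obtain ⟨m, g1, g2, g3⟩ := hX.median (a i) (a j) (a k)
    refine ⟨m, fun l => ?_⟩
    rw [hX.dist_median g1 g2 g3, hY.dist_median h1 h2 h3]
    simp only [hab]
  -- The distances to the labels determine all others: with a label l beyond z, d(y, z) = d(y, l) -
  -- d(z, l).
  have iso : ∀ v w y z, (∀ l, dY y (b l) = dX v (a l)) → (∀ l, dY z (b l) = dX w (a l)) →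
      dY y z = dX v w := by
    intro v w y z hy hz
    apply le_antisymm
    · obtain ⟨_, ⟨l, rfl⟩, hl⟩ := hY.exists_label_beyond hb y z
      unfold Btw at hl
      rw [hy, hz] at hl
      have := hX.triangle v w (a l)
      linarith
    · obtain ⟨_, ⟨l, rfl⟩, hl⟩ := hX.exists_label_beyond ha v w
      unfold Btw at hl
      rw [← hy, ← hz] at hl
      have := hY.triangle y z (b l)
      linarith
  choose e he using key
  have hiso : ∀ v w, dY (e v) (e w) = dX v w := fun v w => iso v w _ _ (he v) (he w)
  have hinj : Function.Injective e := by
    intro v w hvw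
    apply hX.eq_of_le_zero
    rw [← hiso, hvw, hY.self]
  have hsurj : Function.Surjective e := by
    intro y
    obtain ⟨v, hv⟩ := key' y
    refine ⟨v, hY.eq_of_le_zero ?_⟩
    rw [iso v v (e v) y (he v) hv, hX.self]
  refine ⟨Equiv.ofBijective e ⟨hinj, hsurj⟩, fun i => ?_, hiso⟩
  apply hY.eq_of_le_zero
  have := he (a i) i
  rw [hX.self] at this
  exact this.le

end Metric

/-! ### The path metric of a tree -/

section Tree

variable {V : Type*} {G : SimpleGraph V}

/-- `d` is the sum of the edge lengths along paths. -/
def IsPathSum (G : SimpleGraph V) (len : Sym2 V → ℝ) (d : V → V → ℝ) : Prop :=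
  ∀ x y, ∀ p : G.Walk x y, p.IsPath → d x y = (p.edges.map len).sum

theorem exists_isPathSum (hG : G.IsTree) (len : Sym2 V → ℝ) : ∃ d, IsPathSum G len d := by
  refine ⟨fun x y => (((hG.existsUnique_path x y).choose).edges.map len).sum, fun x y p hp => ?_⟩
  rw [(hG.existsUnique_path x y).choose_spec.2 p hp]

/-- `m` lies on the path from `x` to `y`. -/
def OnPath (G : SimpleGraph V) (x m y : V) : Prop := ∃ p : G.Walk x y, p.IsPath ∧ m ∈ p.support

theorem OnPath.mem (hG : G.IsTree) {x m y : V} (h : OnPath G x m y) {p : G.Walk x y}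
    (hp : p.IsPath) : m ∈ p.support := by
  obtain ⟨q, hq, hm⟩ := h
  rwa [(hG.existsUnique_path x y).unique hp hq]

theorem OnPath.symm {x m y : V} (h : OnPath G x m y) : OnPath G y m x := by
  obtain ⟨p, hp, hm⟩ := h
  exact ⟨p.reverse, hp.reverse, by simpa using hm⟩

/-- The path from x to z is what remains of the walk x → y → z when its loops are removed. -/
theorem OnPath.branch (hG : G.IsTree) {x m z : V} (h : OnPath G x m z) (y : V) :
    OnPath G x m y ∨ OnPath G y m z := by
  classical
  obtain ⟨p, hp, -⟩ := hG.existsUnique_path x y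
  obtain ⟨q, hq, -⟩ := hG.existsUnique_path y z
  have := h.mem hG (p.append q).bypass_isPath
  have := (p.append q).support_bypass_subset_support this
  rw [SimpleGraph.Walk.mem_support_append_iff] at this
  exact this.imp (fun h => ⟨p, hp, h⟩) (fun h => ⟨q, hq, h⟩)

theorem OnPath.left (hG : G.IsTree) (x y : V) : OnPath G x x y := by
  obtain ⟨p, hp, -⟩ := hG.existsUnique_path x y
  exact ⟨p, hp, by simp⟩

theorem OnPath.eq_or_eq_of_adj (hG : G.IsTree) {x m y : V} (h : OnPath G x m y)
    (hxy : G.Adj x y) : m = x ∨ m = y := by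
  have := h.mem hG (SimpleGraph.Path.singleton hxy).2
  simpa [SimpleGraph.Path.singleton] using this

theorem OnPath.of_adj (hG : G.IsTree) {x m m' : V} (h : G.Adj m m') (h' : ¬ OnPath G m m' x) :
    OnPath G m' m x := by
  obtain ⟨p, hp, -⟩ := hG.existsUnique_path m x
  have : m' ∉ p.support := fun hm => h' ⟨p, hp, hm⟩
  exact ⟨.cons h.symm p, hp.cons this, by simp⟩

theorem OnPath.trans (hG : G.IsTree) {x y z w : V} (h1 : OnPath G x y z) (h2 : OnPath G x z w) :
    OnPath G x y w := by
  obtain ⟨p, hp, hz⟩ := h2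
  obtain ⟨q, r, hq, hr, rfl⟩ := hp.mem_support_iff_exists_append.1 hz
  exact ⟨_, hp, by
    rw [SimpleGraph.Walk.mem_support_append_iff]
    exact Or.inl (h1.mem hG hq)⟩

/-- Induction along a walk from m to x. When m moves across an edge, the old median still works
unless m now lies on the path from x to y, and then m is its own median. -/
theorem OnPath.median (hG : G.IsTree) (x y m : V) :
    ∃ n, OnPath G x n y ∧ OnPath G m n x ∧ OnPath G m n y := by
  obtain ⟨q⟩ := hG.connected.preconnected m x
  induction q with
  | nil => exact ⟨_, OnPath.left hG _ _, OnPath.left hG _ _, OnPath.left hG _ _⟩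
  | @cons m m' x h q ih =>
    obtain ⟨n, h1, h2, h3⟩ := ih
    by_cases hm : OnPath G x m y
    · exact ⟨m, hm, OnPath.left hG _ _, OnPath.left hG _ _⟩
    have hnm : n ≠ m := fun e => hm (e ▸ h1)
    rcases eq_or_ne n m' with rfl | hnm'
    · refine ⟨n, h1, ?_, ?_⟩
      · by_contra hc
        exact hm ((OnPath.of_adj hG h hc).symm.trans hG h1)
      · by_contra hc
        exact hm ((OnPath.of_adj hG h hc).symm.trans hG h1.symm).symm
    · refine ⟨n, h1, ?_, ?_⟩
      · rcases h2.branch hG m with hb | hb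
        · rcases hb.eq_or_eq_of_adj hG h.symm with e | e <;> contradiction
        · exact hb
      · rcases h3.branch hG m with hb | hb
        · rcases hb.eq_or_eq_of_adj hG h.symm with e | e <;> contradiction
        · exact hb

variable {len : Sym2 V → ℝ} {d : V → V → ℝ}

theorem IsPathSum.btw_of_onPath (hd : IsPathSum G len d) {x m y : V} (h : OnPath G x m y) :
    Btw d x m y := by
  obtain ⟨p, hp, hm⟩ := h
  obtain ⟨q, r, hq, hr, rfl⟩ := hp.mem_support_iff_exists_append.1 hm
  rw [Btw, hd _ _ _ hp, hd _ _ _ hq, hd _ _ _ hr]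
  simp

theorem IsPathSum.pos (hG : G.IsTree) (hlen : ∀ e ∈ G.edgeSet, 0 < len e)
    (hd : IsPathSum G len d) {x y : V} (hxy : x ≠ y) : 0 < d x y := by
  obtain ⟨p, hp, -⟩ := hG.existsUnique_path x y
  rw [hd _ _ _ hp]
  apply List.sum_pos
  · intro a ha
    obtain ⟨e, he, rfl⟩ := List.mem_map.1 ha
    exact hlen e (p.edges_subset_edgeSet he)
  · cases p with
    | nil => exact absurd rfl hxy
    | cons h q => simp

theorem IsPathSum.symm (hG : G.IsTree) (hd : IsPathSum G len d) (x y : V) : d x y = d y x := by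
  obtain ⟨p, hp, -⟩ := hG.existsUnique_path x y
  rw [hd _ _ _ hp, hd _ _ _ hp.reverse]
  simp [List.sum_reverse]

/-- Conversely, let n be the median of x, y, m in the tree. The way through m exceeds d(x, y) by 2
d(m, n), which is positive unless m = n. -/
theorem IsPathSum.onPath_iff (hG : G.IsTree) (hlen : ∀ e ∈ G.edgeSet, 0 < len e)
    (hd : IsPathSum G len d) {x m y : V} : OnPath G x m y ↔ Btw d x m y := by
  refine ⟨hd.btw_of_onPath, fun h => ?_⟩
  obtain ⟨n, h1, h2, h3⟩ := OnPath.median hG x y m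
  rcases eq_or_ne m n with rfl | hne
  · exact h1
  have := IsPathSum.pos hG hlen hd hne
  have h1' := hd.btw_of_onPath h1
  have h2 := hd.btw_of_onPath h2
  have h3 := hd.btw_of_onPath h3
  unfold Btw at *
  have := hd.symm hG x m
  have := hd.symm hG x n
  linarith

theorem IsPathSum.isTreeMetric (hG : G.IsTree) (hlen : ∀ e ∈ G.edgeSet, 0 < len e)
    (hd : IsPathSum G len d) : IsTreeMetric d where
  self x := by simpa using hd x x .nil .nil
  pos x y := hd.pos hG hlen
  symm := hd.symm hG
  median x y z := by
    obtain ⟨n, h1, h2, h3⟩ := OnPath.median hG x y z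
    exact ⟨n, hd.btw_of_onPath h1, hd.btw_of_onPath h3.symm, hd.btw_of_onPath h2.symm⟩
  branch x m z h y := by
    rw [← hd.onPath_iff hG hlen] at h ⊢
    rw [← hd.onPath_iff hG hlen]
    exact h.branch hG y

theorem IsPathSum.adjOfMetric (hG : G.IsTree) (hlen : ∀ e ∈ G.edgeSet, 0 < len e)
    (hd : IsPathSum G len d) : AdjOfMetric G d := by
  intro x y
  constructor
  · intro h
    exact ⟨h.ne, fun z hz => ((hd.onPath_iff hG hlen).2 hz).eq_or_eq_of_adj hG h⟩
  · rintro ⟨hne, h⟩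
    obtain ⟨p, hp, -⟩ := hG.existsUnique_path x y
    cases p with
    | nil => exact absurd rfl hne
    | @cons _ x' _ hx q =>
      rcases h x' (hd.btw_of_onPath ⟨_, hp, by simp⟩) with e | e
      · exact absurd e hx.ne'
      · exact e ▸ hx

/-- The median of n, l, n' lies on both edges, so it is an endpoint of each, and l is the only
common one. -/
theorem AdjOfMetric.btw_of_ne (hd : IsTreeMetric d) (hadj : AdjOfMetric G d) {l n n' : V}
    (h : G.Adj l n) (h' : G.Adj l n') (hne : n ≠ n') : Btw d n l n' := by
  obtain ⟨m, h1, h2, h3⟩ := hd.median n l n'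
  rcases ((hadj _ _).1 h).2 m (hd.btw_comm h1) with rfl | rfl
  · exact h3
  · rcases ((hadj _ _).1 h').2 m h2 with rfl | rfl
    · exact h3
    · exact absurd rfl hne

theorem medianLabelled_of_isSemiLabelledTree [Finite V] {W : Set V} (hd : IsTreeMetric d)
    (hadj : AdjOfMetric G d)
    (hdeg : ∀ v, (G.neighborSet v).ncard ≤ 2 → v ∈ W) : MedianLabelled d W := by
  have deg : ∀ v, v ∉ W → ∃ a b c, G.Adj v a ∧ G.Adj v b ∧ G.Adj v c ∧ a ≠ b ∧ a ≠ c ∧ b ≠ c := by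
    intro v hv
    have : 2 < (G.neighborSet v).ncard := not_le.1 fun h => hv (hdeg v h)
    obtain ⟨a, b, c, ha, hb, hc, h⟩ := (Set.two_lt_ncard_iff (Set.toFinite _)).1 this
    exact ⟨a, b, c, ha, hb, hc, h⟩
  -- Take a farthest point l beyond w. If it were latent it would have two neighbours, and l
  -- separates v from one of them, which is then farther away.
  have beyond : ∀ v w, ∃ l ∈ W, Btw d v w l := by
    intro v w
    obtain ⟨l, hl, hmax⟩ := Set.exists_max_image {l | Btw d v w l} (d v) (Set.toFinite _)
      ⟨w, hd.btw_right v w⟩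
    refine ⟨l, ?_, hl⟩
    by_contra hlW
    obtain ⟨a, b, -, ha, hb, -, hab, -, -⟩ := deg l hlW
    have hn : ∃ n, G.Adj l n ∧ Btw d v l n := by
      rcases hd.branch _ _ _ (hadj.btw_of_ne hd ha hb hab) v with h | h
      · exact ⟨a, ha, hd.btw_comm h⟩
      · exact ⟨b, hb, h⟩
    obtain ⟨n, hn, hb⟩ := hn
    have h1 := hmax n (hd.btw_trans hl hb).1
    have h2 := hd.pos l n hn.ne
    unfold Btw at hb
    linarith
  intro v
  by_cases hv : v ∈ W
  · exact ⟨v, hv, v, hv, v, hv, hd.btw_left _ _, hd.btw_left _ _, hd.btw_left _ _⟩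
  obtain ⟨a, b, c, ha, hb, hc, hab, hac, hbc⟩ := deg v hv
  -- Labels found beyond different neighbours of v are separated by v; three neighbours therefore
  -- give v as a median.
  have aux : ∀ a b i j, G.Adj v a → G.Adj v b → a ≠ b → Btw d v a i → Btw d v b j →
      Btw d i v j := by
    intro a b i j ha hb hab hi hj
    have excl : ∀ a i, G.Adj v a → Btw d v a i → ¬ Btw d a v i := by
      intro a i ha h1 h2
      have := hd.pos v a ha.ne
      have := hd.symm v a
      unfold Btw at *
      linarith
    rcases hd.branch _ _ _ (hadj.btw_of_ne hd ha hb hab) i with h | h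
    · exact absurd h (excl a i ha hi)
    rcases hd.branch _ _ _ h j with h | h
    · exact h
    · exact absurd (hd.btw_comm h) (excl b j hb hj)
  obtain ⟨i, hi, hi'⟩ := beyond v a
  obtain ⟨j, hj, hj'⟩ := beyond v b
  obtain ⟨k, hk, hk'⟩ := beyond v c
  exact ⟨i, hi, j, hj, k, hk, aux a b i j ha hb hab hi' hj', aux b c j k hb hc hbc hj' hk',
    aux a c i k ha hc hac hi' hk'⟩

end Tree

/-! ### The metric of a general Markov model -/

/-- Expanding the product of the row sums gives one nonnegative term for every function n → n; the
determinant retains, up to sign, only the terms of the permutations. -/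
theorem abs_det_le_prod_sum {n : Type*} [Fintype n] [DecidableEq n] (M : Matrix n n ℝ)
    (hM : ∀ i j, 0 ≤ M i j) : |M.det| ≤ ∏ i, ∑ j, M i j := by
  rw [← Matrix.det_transpose, Matrix.det_apply,
    Finset.prod_univ_sum (fun _ => Finset.univ) (fun i j => M i j)]
  simp only [Matrix.transpose_apply]
  refine (Finset.abs_sum_le_sum_abs _ _).trans ?_
  have h1 : ∀ σ : Equiv.Perm n, |Equiv.Perm.sign σ • ∏ i, M i (σ i)|
      = ∏ i, M i (σ i) := by
    intro σ
    have h0 : 0 ≤ ∏ i, M i (σ i) := Finset.prod_nonneg fun i _ => hM _ _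
    rcases Int.units_eq_one_or (Equiv.Perm.sign σ) with h | h <;>
      simp [h, abs_of_nonneg h0]
  simp only [h1]
  rw [← Finset.sum_image (g := fun σ : Equiv.Perm n => (σ : n → n))
    (f := fun p => ∏ i, M i (p i)) (fun σ _ τ _ h => DFunLike.coe_injective h)]
  apply Finset.sum_le_sum_of_subset_of_nonneg
  · intro p _
    simp
  · intro p _ _
    exact Finset.prod_nonneg fun i _ => hM _ _

/-! ### Conditional independence by exchanging configurations -/

section Exchange

variable {V : Type*} {r : ℕ}

/-- Exchange the coordinates outside `S` of two configurations. -/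
def exchange (S : Set V) [DecidablePred (· ∈ S)] (y : (V → Fin r) × (V → Fin r)) :
    (V → Fin r) × (V → Fin r) :=
  (fun x => if x ∈ S then y.1 x else y.2 x, fun x => if x ∈ S then y.2 x else y.1 x)

theorem exchange_involutive (S : Set V) [DecidablePred (· ∈ S)] :
    Function.Involutive (exchange (r := r) S) := by
  rintro ⟨y, y'⟩
  unfold exchange
  ext x <;> by_cases h : x ∈ S <;> simp [h]

end Exchange

section Markov

variable {V : Type*} [Fintype V] [DecidableEq V] {r : ℕ} {f : (V → Fin r) → ℝ}

/-- The marginal distribution of `Y_v`. -/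
noncomputable def marginal (f : (V → Fin r) → ℝ) (v : V) (a : Fin r) : ℝ :=
  ∑ y, if y v = a then f y else 0

theorem jointMatrix_self (f : (V → Fin r) → ℝ) (v : V) :
    jointMatrix f v v = Matrix.diagonal (marginal f v) := by
  ext a b
  rw [Matrix.diagonal_apply]
  unfold jointMatrix marginal
  split_ifs with h
  · subst h
    simp
  · apply Finset.sum_eq_zero
    intro y _
    rw [if_neg]
    rintro ⟨rfl, rfl⟩
    exact h rfl

theorem det_jointMatrix_self (f : (V → Fin r) → ℝ) (v : V) :
    (jointMatrix f v v).det = ∏ a, marginal f v a := by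
  rw [jointMatrix_self, Matrix.det_diagonal]

theorem jointMatrix_transpose (f : (V → Fin r) → ℝ) (u v : V) :
    (jointMatrix f u v).transpose = jointMatrix f v u := by
  ext a b
  simp only [Matrix.transpose_apply, jointMatrix, and_comm]

theorem tau_comm (f : (V → Fin r) → ℝ) (u v : V) : tau f u v = tau f v u := by
  unfold tau
  rw [← jointMatrix_transpose f u v, Matrix.det_transpose, mul_comm]

theorem sum_jointMatrix (f : (V → Fin r) → ℝ) (u v : V) (a : Fin r) :
    ∑ b, jointMatrix f u v a b = marginal f u a := by
  unfold jointMatrix marginal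
  rw [Finset.sum_comm]
  apply Finset.sum_congr rfl
  intro y _
  by_cases h : y u = a <;> simp [h]

theorem abs_det_jointMatrix_le (hf : ∀ y, 0 ≤ f y) (u v : V) :
    |(jointMatrix f u v).det| ≤ (jointMatrix f u u).det := by
  rw [det_jointMatrix_self]
  simp only [← sum_jointMatrix f u v]
  apply abs_det_le_prod_sum
  intro a b
  apply Finset.sum_nonneg
  intro y _
  split_ifs
  exacts [hf y, le_rfl]

theorem abs_det_jointMatrix_le' (hf : ∀ y, 0 ≤ f y) (u v : V) :
    |(jointMatrix f u v).det| ≤ (jointMatrix f v v).det := by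
  rw [← jointMatrix_transpose, Matrix.det_transpose]
  exact abs_det_jointMatrix_le hf v u

theorem abs_tau_le_one (hf : ∀ y, 0 ≤ f y) (u v : V) : |tau f u v| ≤ 1 := by
  unfold tau
  rw [abs_div, abs_of_nonneg (Real.sqrt_nonneg _)]
  apply div_le_one_of_le₀ _ (Real.sqrt_nonneg _)
  apply Real.le_sqrt_of_sq_le
  rw [sq]
  exact mul_le_mul (abs_det_jointMatrix_le hf u v) (abs_det_jointMatrix_le' hf u v)
    (abs_nonneg _) ((abs_nonneg _).trans (abs_det_jointMatrix_le hf u v))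

variable {T : SimpleGraph V} [DecidableRel T.Adj]

/-- The two configurations agree at v, and an edge that avoids v does not cross the border of S. So
the two factors belonging to an edge are either kept or swapped, and their product does not change.
-/
theorem IsGeneralMarkovModel.exchange_mul (hf : IsGeneralMarkovModel T f) (S : Set V)
    [DecidablePred (· ∈ S)] (v : V)
    (hS : ∀ x x', T.Adj x x' → x ≠ v → x' ≠ v → (x ∈ S ↔ x' ∈ S))
    (y : (V → Fin r) × (V → Fin r)) (hy : y.1 v = y.2 v) :
    f (exchange S y).1 * f (exchange S y).2 = f y.1 * f y.2 := by
  obtain ⟨vp, ep, -, -, hep, hfac⟩ := hf.factorizes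
  simp only [hfac]
  rw [mul_mul_mul_comm, mul_mul_mul_comm (∏ x, vp x (y.1 x))]
  simp only [← Finset.prod_mul_distrib]
  congr 1
  · apply Finset.prod_congr rfl
    intro x _
    unfold exchange
    by_cases h : x ∈ S
    · simp [h]
    · simp [h, mul_comm]
  · apply Finset.prod_congr rfl
    intro e he
    rw [SimpleGraph.mem_edgeFinset] at he
    induction e with
    | _ x x' =>
      rw [SimpleGraph.mem_edgeSet] at he
      have same : (∀ z ∈ s(x, x'), z = v ∨ z ∈ S) ∨ (∀ z ∈ s(x, x'), z = v ∨ z ∉ S) := by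
        simp only [Sym2.mem_iff, forall_eq_or_imp, forall_eq]
        have := hS x x' he
        tauto
      rcases same with h | h
      · congr 1 <;> apply hep <;> intro z hz <;> rcases h z hz with rfl | h' <;>
          simp [exchange, *]
      · rw [mul_comm]
        congr 1 <;> apply hep <;> intro z hz <;> rcases h z hz with rfl | h' <;>
          simp [exchange, *]

/-- The distribution of `(Y_u, Y_v, Y_w)`. -/
noncomputable def tripleLaw (f : (V → Fin r) → ℝ) (u v w : V) (a b c : Fin r) : ℝ :=
  ∑ y, if y u = a ∧ y v = b ∧ y w = c then f y else 0

theorem sum_tripleLaw (f : (V → Fin r) → ℝ) (u v w : V) (a c : Fin r) :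
    ∑ b, tripleLaw f u v w a b c = jointMatrix f u w a c := by
  unfold jointMatrix tripleLaw
  rw [Finset.sum_comm]
  apply Finset.sum_congr rfl
  intro y _
  by_cases h : y u = a <;> by_cases h' : y w = c <;> simp [h, h']

/-- `Y_u` and `Y_w` are independent given `Y_v` if `v` separates `u` and `w`. -/
theorem IsGeneralMarkovModel.tripleLaw_mul (hf : IsGeneralMarkovModel T f) (hT : T.IsTree)
    {u v w : V} (huv : u ≠ v) (h : OnPath T u v w) (a b c : Fin r) :
    tripleLaw f u v w a b c * marginal f v b = jointMatrix f u v a b * jointMatrix f v w b c := by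
  classical
  -- The side of u: all vertices that v does not separate from u.
  let S : Set V := {x | ¬ OnPath T u v x}
  have hu : u ∈ S := by
    rintro ⟨p, hp, hm⟩
    rw [(SimpleGraph.Walk.isPath_iff_nil.1 hp).eq_nil] at hm
    simp at hm
    exact huv hm.symm
  have hw : w ∉ S := fun h' => h' h
  have hS : ∀ x x', T.Adj x x' → x ≠ v → x' ≠ v → (x ∈ S ↔ x' ∈ S) := by
    intro x x' hx h1 h2
    have aux : ∀ x x', T.Adj x x' → x ≠ v → x' ≠ v → OnPath T u v x → OnPath T u v x' := by
      intro x x' hx h1 h2 h3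
      rcases h3.branch hT x' with h4 | h4
      · exact h4
      · rcases h4.eq_or_eq_of_adj hT hx.symm with e | e
        · exact absurd e.symm h2
        · exact absurd e.symm h1
    exact not_congr ⟨aux x x' hx h1 h2, aux x' x hx.symm h2 h1⟩
  unfold tripleLaw marginal jointMatrix
  rw [Fintype.sum_mul_sum, Fintype.sum_mul_sum, ← Fintype.sum_prod_type',
    ← Fintype.sum_prod_type']
  -- The exchange maps the pairs that prescribe (Y_u, Y_v, Y_w) in one copy and Y_v in the other
  -- onto the pairs that prescribe (Y_u, Y_v) in one and (Y_v, Y_w) in the other.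
  apply Fintype.sum_equiv (exchange_involutive (r := r) S).toPerm
  rintro ⟨y, y'⟩
  simp only [Function.Involutive.coe_toPerm]
  by_cases hy : y v = b ∧ y' v = b
  · obtain ⟨h1, h2⟩ := hy
    have := hf.exchange_mul S v hS (y, y') (h1.trans h2.symm)
    have e1 : (exchange S (y, y')).1 v = b := by
      unfold exchange; by_cases h : v ∈ S <;> simp [h, h1, h2]
    have e2 : (exchange S (y, y')).2 v = b := by
      unfold exchange; by_cases h : v ∈ S <;> simp [h, h1, h2]
    have e3 : (exchange S (y, y')).1 u = y u := by unfold exchange; simp [hu]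
    have e4 : (exchange S (y, y')).2 w = y w := by unfold exchange; simp [hw]
    simp only [e1, e2, e3, e4, h1, h2]
    by_cases k1 : y u = a <;> by_cases k2 : y w = c <;> simp [k1, k2, this]
  · have hz : ¬ ((exchange S (y, y')).1 v = b ∧ (exchange S (y, y')).2 v = b) := by
      unfold exchange
      by_cases h : v ∈ S
      · simpa [h] using hy
      · simpa [h, and_comm] using hy
    have l1 : ((if y u = a ∧ y v = b ∧ y w = c then f y else 0) * if y' v = b then f y' else 0)
        = 0 := by
      by_cases h1 : y v = b
      · simp [show ¬ y' v = b from fun h2 => hy ⟨h1, h2⟩]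
      · simp [h1]
    rw [l1, eq_comm]
    by_cases h1 : (exchange S (y, y')).1 v = b
    · simp [show ¬ (exchange S (y, y')).2 v = b from fun h2 => hz ⟨h1, h2⟩]
    · simp [h1]

theorem IsGeneralMarkovModel.det_mul_det (hf : IsGeneralMarkovModel T f) (hT : T.IsTree)
    {u v w : V} (huv : u ≠ v) (h : OnPath T u v w) (hv : (jointMatrix f v v).det ≠ 0) :
    (jointMatrix f u w).det * (jointMatrix f v v).det
      = (jointMatrix f u v).det * (jointMatrix f v w).det := by
  have hm : ∀ b, marginal f v b ≠ 0 := by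
    rw [det_jointMatrix_self] at hv
    exact fun b => (Finset.prod_ne_zero_iff.1 hv) b (Finset.mem_univ b)
  -- Conditional independence as a matrix identity, with P^{vv} diagonal and invertible.
  have key : jointMatrix f u w = jointMatrix f u v *
      (Matrix.diagonal (fun b => (marginal f v b)⁻¹) * jointMatrix f v w) := by
    ext a c
    rw [Matrix.mul_apply, ← sum_tripleLaw f u v w]
    apply Finset.sum_congr rfl
    intro b _
    rw [Matrix.diagonal_mul]
    have := hf.tripleLaw_mul hT huv h a b c
    have := hm b
    field_simp
    linarith
  have hinv : (Matrix.diagonal (fun b => (marginal f v b)⁻¹)).det * (jointMatrix f v v).det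
      = 1 := by
    rw [det_jointMatrix_self, Matrix.det_diagonal, ← Finset.prod_mul_distrib]
    exact Finset.prod_eq_one fun b _ => inv_mul_cancel₀ (hm b)
  rw [key, Matrix.det_mul, Matrix.det_mul]
  linear_combination (jointMatrix f u v).det * (jointMatrix f v w).det * hinv

theorem IsGeneralMarkovModel.tau_mul_tau (hf : IsGeneralMarkovModel T f) (hT : T.IsTree)
    {u v w : V} (huv : u ≠ v) (h : OnPath T u v w) (hu : 0 < (jointMatrix f u u).det)
    (hv : 0 < (jointMatrix f v v).det) : tau f u w = tau f u v * tau f v w := by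
  have := hf.det_mul_det hT huv h hv.ne'
  unfold tau
  rw [Real.sqrt_mul hu.le, Real.sqrt_mul hu.le, Real.sqrt_mul hv.le, div_mul_div_comm, ← this]
  have h1 := Real.mul_self_sqrt hv.le
  have h2 := Real.sqrt_pos.2 hv
  rw [show √(jointMatrix f u u).det * √(jointMatrix f v v).det *
    (√(jointMatrix f v v).det * √(jointMatrix f w w).det) =
    √(jointMatrix f u u).det * √(jointMatrix f w w).det * (jointMatrix f v v).det by
      linear_combination √(jointMatrix f u u).det * √(jointMatrix f w w).det * h1]
  rw [mul_div_mul_right _ _ hv.ne']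

theorem tau_self (f : (V → Fin r) → ℝ) (v : V) : Real.log |tau f v v| = 0 := by
  unfold tau
  rw [Real.sqrt_mul_self_eq_abs, abs_div, abs_abs]
  -- A vanishing determinant is harmless, because 0 / 0 = 0 and log 0 = 0. This covers the tree with
  -- one vertex, where no edge guarantees positive marginals.
  rcases eq_or_ne (jointMatrix f v v).det 0 with h | h
  · simp [h]
  · rw [div_self (abs_ne_zero.2 h), Real.log_one]

/-- The distances `-log |τ|` of a non-degenerate general Markov model are path sums. -/
theorem IsGeneralMarkovModel.exists_isPathSum (hf : IsGeneralMarkovModel T f) (hT : T.IsTree)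
    (hdet : ∀ u v, T.Adj u v → (jointMatrix f u v).det ≠ 0)
    (hlen : ∀ u v, T.Adj u v → |tau f u v| ≠ 1) :
    ∃ len : Sym2 V → ℝ, (∀ e ∈ T.edgeSet, 0 < len e) ∧
      IsPathSum T len (fun u v => -Real.log |tau f u v|) := by
  have hpos : ∀ u v, T.Adj u v → 0 < (jointMatrix f u u).det := fun u v h =>
    (abs_pos.2 (hdet u v h)).trans_le (abs_det_jointMatrix_le hf.nonneg u v)
  have hne : ∀ u v, T.Adj u v → tau f u v ≠ 0 := by
    intro u v h
    have h1 := hpos u v h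
    have h2 := hpos v u h.symm
    exact div_ne_zero (hdet u v h) (Real.sqrt_pos.2 (mul_pos h1 h2)).ne'
  refine ⟨Sym2.lift ⟨fun u v => -Real.log |tau f u v|, fun u v => by simp only [tau_comm f u v]⟩,
    ?_, ?_⟩
  · intro e he
    induction e with
    | _ u v =>
      rw [SimpleGraph.mem_edgeSet] at he
      simp only [Sym2.lift_mk, Left.neg_pos_iff]
      exact Real.log_neg (abs_pos.2 (hne u v he))
        (lt_of_le_of_ne (abs_tau_le_one hf.nonneg u v) (hlen u v he))
  · have key : ∀ u w (p : T.Walk u w), p.IsPath → (∃ n, T.Adj u n) → tau f u w ≠ 0 ∧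
        -Real.log |tau f u w| = (p.edges.map (Sym2.lift ⟨fun u v => -Real.log |tau f u v|,
          fun u v => by simp only [tau_comm f u v]⟩)).sum := by
      intro u w p hp
      induction p with
      | nil =>
        rintro ⟨n, hn⟩
        have h1 := hpos _ n hn
        refine ⟨div_ne_zero h1.ne' (Real.sqrt_pos.2 (mul_pos h1 h1)).ne', ?_⟩
        rw [tau_self]
        simp
      | @cons u v w h q ih =>
        intro _
        obtain ⟨h1, h2⟩ := ih hp.of_cons ⟨u, h.symm⟩
        have h3 := hf.tau_mul_tau hT h.ne ⟨_, hp, by simp⟩ (hpos u v h) (hpos v u h.symm)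
        refine ⟨h3 ▸ mul_ne_zero (hne u v h) h1, ?_⟩
        rw [SimpleGraph.Walk.edges_cons, List.map_cons, List.sum_cons, ← h2, h3, abs_mul,
          Real.log_mul (abs_ne_zero.2 (hne u v h)) (abs_ne_zero.2 h1), Sym2.lift_mk]
        ring
    intro u w p hp
    cases p with
    | nil =>
      simp only [tau_self]
      simp
    | @cons _ v _ h q => exact (key u w _ hp ⟨v, h⟩).2

end Markov

/-! ### Named nodes and pieces of the tree -/

section Pieces

variable {V L : Type*} {d : V → V → ℝ}

/-- The nodes in `N` have been identified with vertices by `θ`; the regular nodes are identified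
by their labels. -/
structure IsNaming (lab : L → V) (N : Set (Node L)) (θ : Node L → V) (m : Memory L) : Prop where
  inl_mem : ∀ i, Sum.inl i ∈ N
  inl_eq : ∀ i, θ (Sum.inl i) = lab i
  inj : Set.InjOn θ N
  fresh_lt : ∀ k, Sum.inr k ∈ N → k < m.fresh
  dist_new : ∀ k, m.fresh ≤ k → m.dist (Sum.inr k) (Sum.inr k) = 0

/-- The bag `B` describes the part `C` of the tree, which is attached to the rest of the tree at the
representative. -/
structure IsPiece (d : V → V → ℝ) (N : Set (Node L)) (θ : Node L → V) (m : Memory L) (B : Bag L)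
    (C : Set V) : Prop where
  rep_mem : B.rep ∈ B.nodes
  closed : ∀ x ∈ C, ∀ y ∉ C, Btw d x (θ B.rep) y
  subset : ∀ x ∈ B.nodes, x ∈ N
  mem_iff : ∀ x ∈ N, x ∈ B.nodes ↔ θ x ∈ C
  regular : ∀ x ∈ B.nodes, x = B.rep ∨ ∃ i, x = Sum.inl i
  dist_eq : ∀ x ∈ B.nodes, ∀ y ∈ B.nodes, m.dist x y = d (θ x) (θ y)

/-- New nodes have been named, all of them in `A`. -/
structure Extends (N : Set (Node L)) (θ : Node L → V) (m : Memory L) (N' : Set (Node L))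
    (θ' : Node L → V) (m' : Memory L) (A : Set V) : Prop where
  subset : ∀ x ∈ N, x ∈ N'
  eq : ∀ x ∈ N, θ' x = θ x
  dist_eq : ∀ x ∈ N, ∀ y ∈ N, m'.dist x y = m.dist x y
  new_mem : ∀ x ∈ N', x ∉ N → θ' x ∈ A

variable {lab : L → V} {N N' N'' : Set (Node L)} {θ θ' θ'' : Node L → V} {m m' m'' : Memory L}
  {B : Bag L} {C A A' : Set V}

theorem Extends.refl (N : Set (Node L)) (θ : Node L → V) (m : Memory L) (A : Set V) :
    Extends N θ m N θ m A :=
  ⟨fun _ h => h, fun _ _ => rfl, fun _ _ _ _ => rfl, fun _ h h' => absurd h h'⟩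

theorem Extends.mono (h : Extends N θ m N' θ' m' A) (hA : A ⊆ A') :
    Extends N θ m N' θ' m' A' :=
  ⟨h.subset, h.eq, h.dist_eq, fun x hx hx' => hA (h.new_mem x hx hx')⟩

theorem Extends.trans (h : Extends N θ m N' θ' m' A) (h' : Extends N' θ' m' N'' θ'' m'' A) :
    Extends N θ m N'' θ'' m'' A where
  subset x hx := h'.subset x (h.subset x hx)
  eq x hx := (h'.eq x (h.subset x hx)).trans (h.eq x hx)
  dist_eq x hx y hy := (h'.dist_eq x (h.subset x hx) y (h.subset y hy)).trans
    (h.dist_eq x hx y hy)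
  new_mem x hx hxN := by
    by_cases hx' : x ∈ N'
    · rw [h'.eq x hx']
      exact h.new_mem x hx' hxN
    · exact h'.new_mem x hx hx'

/-- A bag must contain every named node of its part, so vertices named later have to lie outside C.
-/
theorem IsPiece.extend (hp : IsPiece d N θ m B C) (h : Extends N θ m N' θ' m' A)
    (hA : ∀ v ∈ A, v ∉ C) : IsPiece d N' θ' m' B C where
  rep_mem := hp.rep_mem
  closed x hx y hy := by
    rw [h.eq _ (hp.subset _ hp.rep_mem)]
    exact hp.closed x hx y hy
  subset x hx := h.subset x (hp.subset x hx)
  mem_iff x hx := by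
    by_cases hxN : x ∈ N
    · rw [h.eq x hxN]
      exact hp.mem_iff x hxN
    · exact ⟨fun h' => absurd (hp.subset x h') hxN, fun h' => absurd h' (hA _ (h.new_mem x hx hxN))⟩
  regular := hp.regular
  dist_eq x hx y hy := by
    rw [h.dist_eq x (hp.subset x hx) y (hp.subset y hy), h.eq x (hp.subset x hx),
      h.eq y (hp.subset y hy)]
    exact hp.dist_eq x hx y hy

theorem IsPiece.root_mem (hp : IsPiece d N θ m B C) : θ B.rep ∈ C :=
  (hp.mem_iff _ (hp.subset _ hp.rep_mem)).1 hp.rep_mem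

theorem IsPiece.theta_mem (hp : IsPiece d N θ m B C) {x : Node L} (hx : x ∈ B.nodes) : θ x ∈ C :=
  (hp.mem_iff x (hp.subset x hx)).1 hx

/-- If z were outside C, the root would separate it from both x and y; as z lies between them, it
would be the root itself. -/
theorem IsPiece.convex (hd : IsTreeMetric d) (hp : IsPiece d N θ m B C) {x y z : V} (hx : x ∈ C)
    (hy : y ∈ C) (h : Btw d x z y) : z ∈ C := by
  by_contra hz
  have h1 := hp.closed x hx z hz
  have h2 := hp.closed y hy z hz
  have h3 : θ B.rep = z := by
    apply hd.eq_of_le_zero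
    unfold Btw at *
    have := hd.triangle x (θ B.rep) y
    have := hd.symm y (θ B.rep)
    have := hd.symm y z
    linarith
  exact hz (h3 ▸ hp.root_mem)

/-- Every vertex of a piece is a median of nodes of the bag. -/
theorem IsPiece.median (hd : IsTreeMetric d) (hM : MedianLabelled d (Set.range lab))
    (hn : IsNaming lab N θ m) (hp : IsPiece d N θ m B C) {v : V} (hv : v ∈ C) :
    ∃ i ∈ B.nodes, ∃ j ∈ B.nodes, ∃ k ∈ B.nodes,
      Btw d (θ i) v (θ j) ∧ Btw d (θ j) v (θ k) ∧ Btw d (θ i) v (θ k) := by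
  rcases eq_or_ne v (θ B.rep) with rfl | hvr
  · exact ⟨_, hp.rep_mem, _, hp.rep_mem, _, hp.rep_mem, hd.btw_left _ _, hd.btw_left _ _,
      hd.btw_left _ _⟩
  -- A label outside C is replaced by the representative. Not both ends of a path through v can be
  -- replaced, since v would then be the root.
  have node : ∀ i : L, ∃ x ∈ B.nodes, (θ x = lab i ∧ lab i ∈ C) ∨
      (θ x = θ B.rep ∧ lab i ∉ C) := by
    intro i
    by_cases hi : lab i ∈ C
    · refine ⟨Sum.inl i, (hp.mem_iff _ (hn.inl_mem i)).2 ?_, Or.inl ⟨hn.inl_eq i, hi⟩⟩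
      rwa [hn.inl_eq]
    · exact ⟨_, hp.rep_mem, Or.inr ⟨rfl, hi⟩⟩
  have aux : ∀ i j x y, (x = i ∧ i ∈ C) ∨ (x = θ B.rep ∧ i ∉ C) →
      (y = j ∧ j ∈ C) ∨ (y = θ B.rep ∧ j ∉ C) → Btw d i v j → Btw d x v y := by
    rintro i j x y (⟨rfl, hi⟩ | ⟨rfl, hi⟩) (⟨rfl, hj⟩ | ⟨rfl, hj⟩) h
    · exact h
    · exact (hd.btw_trans' (hp.closed v hv j hj) h).2
    · exact hd.btw_comm (hd.btw_trans' (hp.closed v hv i hi) (hd.btw_comm h)).2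
    · have h1 := (hd.btw_trans' (hp.closed v hv j hj) h).2
      exact absurd (hd.btw_antisymm h1 (hd.btw_comm (hp.closed v hv i hi))) hvr
  obtain ⟨_, ⟨i, rfl⟩, _, ⟨j, rfl⟩, _, ⟨k, rfl⟩, h1, h2, h3⟩ := hM v
  obtain ⟨x, hx, hx'⟩ := node i
  obtain ⟨y, hy, hy'⟩ := node j
  obtain ⟨z, hz, hz'⟩ := node k
  exact ⟨x, hx, y, hy, z, hz, aux _ _ _ _ hx' hy' h1, aux _ _ _ _ hy' hz' h2,
    aux _ _ _ _ hx' hz' h3⟩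

theorem IsPiece.exists_node_beyond (hd : IsTreeMetric d) (hM : MedianLabelled d (Set.range lab))
    (hn : IsNaming lab N θ m) (hp : IsPiece d N θ m B C) {w : V} (hw : w ∈ C) (v : V) :
    ∃ x ∈ B.nodes, Btw d v w (θ x) := by
  obtain ⟨i, hi, j, hj, -, -, h, -, -⟩ := hp.median hd hM hn hw
  rcases hd.branch _ _ _ h v with hb | hb
  · exact ⟨i, hi, hd.btw_comm hb⟩
  · exact ⟨j, hj, hb⟩

/-! ### The procedure `basic` -/

/-- The part of `C` on which `d(·, a) - d(·, r)` has the value `c`. -/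
def level (d : V → V → ℝ) (C : Set V) (r a : V) (c : ℝ) : Set V := {v | v ∈ C ∧ d v a - d v r = c}

/-- From r to a the function d(·, a) - d(·, r) decreases with slope -2, so its value determines the
point. -/
theorem IsTreeMetric.eq_of_level_eq (hd : IsTreeMetric d) {r a x y : V} (hx : Btw d r x a)
    (hy : Btw d r y a) (h : d x a - d x r = d y a - d y r) : x = y := by
  have h1 := hd.symm x r
  have h2 := hd.symm y r
  apply hd.eq_of_le_zero
  rcases hd.btw_total hx hy with h' | h' <;> unfold Btw at *
  · linarith
  · have := hd.symm x y
    linarith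

/-- All points of a level are attached to the path from `r` to `a` at the same point. -/
theorem IsTreeMetric.exists_projection (hd : IsTreeMetric d) {r a v₀ : V} {c : ℝ}
    (hv₀ : d v₀ a - d v₀ r = c) : ∃ x, Btw d r x a ∧ d x a - d x r = c ∧
      ∀ v, d v a - d v r = c ↔ Btw d v x r ∧ Btw d v x a := by
  have key : ∀ v, ∃ x, Btw d r x a ∧ Btw d v x r ∧ Btw d v x a := fun v => by
    obtain ⟨x, h1, h2, h3⟩ := hd.median r a v
    exact ⟨x, h1, hd.btw_comm h3, hd.btw_comm h2⟩
  have lev : ∀ v x, Btw d v x r → Btw d v x a → d v a - d v r = d x a - d x r := by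
    intro v x h1 h2
    unfold Btw at *
    linarith
  obtain ⟨x, h1, h2, h3⟩ := key v₀
  have hx : d x a - d x r = c := by rw [← lev v₀ x h2 h3, hv₀]
  refine ⟨x, h1, hx, fun v => ⟨fun hv => ?_, fun h => ?_⟩⟩
  · obtain ⟨y, g1, g2, g3⟩ := key v
    have : y = x := hd.eq_of_level_eq g1 h1 (by rw [← lev v y g2 g3, hv, hx])
    exact this ▸ ⟨g2, g3⟩
  · rw [lev v x h.1 h.2, hx]

/-- The common projection x of a level takes over the role of the root. -/
theorem level_closed (hd : IsTreeMetric d) {r a x : V} {c : ℝ}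
    (hC : ∀ v ∈ C, ∀ y ∉ C, Btw d v r y)
    (hproj : ∀ v, d v a - d v r = c ↔ Btw d v x r ∧ Btw d v x a) :
    ∀ v ∈ level d C r a c, ∀ y ∉ level d C r a c, Btw d v x y := by
  rintro v ⟨hvC, hv⟩ y hy
  obtain ⟨h1, h2⟩ := (hproj v).1 hv
  by_cases hyC : y ∈ C
  · rcases hd.branch _ _ _ h1 y with h3 | h3
    · exact h3
    rcases hd.branch _ _ _ h2 y with h4 | h4
    · exact h4
    exact absurd ⟨hyC, (hproj y).2 ⟨h3, h4⟩⟩ hy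
  · exact (hd.btw_trans h1 (hC v hvC y hyC)).1

theorem argmin_spec {K : Finset (Node L)} (hK : K.Nonempty) (g : Node L → ℝ) :
    argmin K g ∈ K ∧ ∀ v ∈ K, g (argmin K g) ≤ g v := by
  have h : ∃ u ∈ K, ∀ v ∈ K, g u ≤ g v := K.exists_min_image g hK
  unfold argmin
  rw [dif_pos h]
  exact h.choose_spec

/-- What `basic` guarantees for the bag of one level. -/
structure LevelBag (d : V → V → ℝ) (N : Set (Node L)) (θ : Node L → V) (m : Memory L) (B : Bag L)
    (C : Set V) (r a : V) (α : Node L) (c : ℝ) (B' : Bag L) : Prop where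
  isPiece : IsPiece d N θ m B' (level d C r a c)
  btw : Btw d r (θ B'.rep) a
  nonrep : ∀ x ∈ B'.nodes, x ≠ B'.rep → x ∈ B.nodes ∧ x ≠ B.rep
  rep_eq : B.rep ∈ B'.nodes → B'.rep = B.rep
  eq_rep : α ∈ B'.nodes → B'.rep = α

theorem LevelBag.extend {r a : V} {α : Node L} {c : ℝ} {B' : Bag L}
    (h : LevelBag d N θ m B C r a α c B') (he : Extends N θ m N' θ' m' A)
    (hA : ∀ v ∈ A, v ∉ level d C r a c) : LevelBag d N' θ' m' B C r a α c B' where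
  isPiece := h.isPiece.extend he hA
  btw := by
    rw [he.eq _ (h.isPiece.subset _ h.isPiece.rep_mem)]
    exact h.btw
  nonrep := h.nonrep
  rep_eq := h.rep_eq
  eq_rep := h.eq_rep

section Basic

variable [DecidableEq L]

/-- The root of the level is its projection x₀ onto the path from ρ to α, and the test in `basicBag`
decides whether x₀ already has a name. The classes come from the memory m at the start of `basic`,
while m' also contains what the classes treated before have added; those additions lie in A, away
from this level. -/
theorem basicBag_spec (hd : IsTreeMetric d) (hp : IsPiece d N θ m B C)
    (hn' : IsNaming lab N' θ' m') (he : Extends N θ m N' θ' m' A) {α : Node L}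
    (hα : α ∈ B.nodes) {c : ℝ}
    (hA : ∀ v ∈ A, v ∉ level d C (θ B.rep) (θ α) c)
    (hK : (B.nodes.filter (fun v => m.dist v α - m.dist v B.rep = c)).Nonempty) :
    ∃ N'' θ'',
      let out := basicBag B.rep α m' (B.nodes.filter (fun v => m.dist v α - m.dist v B.rep = c))
      IsNaming lab N'' θ'' out.2 ∧
      Extends N' θ' m' N'' θ'' out.2 (level d C (θ B.rep) (θ α) c \ {θ B.rep}) ∧
      LevelBag d N'' θ'' out.2 B C (θ B.rep) (θ α) α c out.1 := by
  set K := B.nodes.filter (fun v => m.dist v α - m.dist v B.rep = c) with hKdef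
  set r := θ B.rep with hr
  set a := θ α with ha
  have hρ := hp.rep_mem
  have hsub : ∀ x ∈ B.nodes, x ∈ N' := fun x hx => he.subset x (hp.subset x hx)
  have heq : ∀ x ∈ B.nodes, θ' x = θ x := fun x hx => he.eq x (hp.subset x hx)
  have hdist : ∀ x ∈ B.nodes, ∀ y ∈ B.nodes, m'.dist x y = d (θ x) (θ y) := fun x hx y hy =>
    (he.dist_eq x (hp.subset x hx) y (hp.subset y hy)).trans (hp.dist_eq x hx y hy)
  have hKB : ∀ x ∈ K, x ∈ B.nodes := fun x hx => (Finset.mem_filter.1 hx).1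
  have hKlev : ∀ x ∈ B.nodes, (x ∈ K ↔ θ x ∈ level d C r a c) := by
    intro x hx
    rw [hKdef, Finset.mem_filter, hp.dist_eq x hx α hα, hp.dist_eq x hx B.rep hρ]
    exact ⟨fun h => ⟨hp.theta_mem hx, h.2⟩, fun h => ⟨hx, h.2⟩⟩
  have hNlev : ∀ x ∈ N', θ' x ∈ level d C r a c ↔ x ∈ K := by
    intro x hx
    by_cases hxN : x ∈ N
    · rw [he.eq x hxN]
      constructor
      · intro h
        exact (hKlev x ((hp.mem_iff x hxN).2 h.1)).2 h
      · intro h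
        exact (hKlev x (hKB x h)).1 h
    · exact ⟨fun h => absurd h (hA _ (he.new_mem x hx hxN)),
        fun h => absurd (hp.subset x (hKB x h)) hxN⟩
  obtain ⟨v₀, hv₀⟩ := hK
  obtain ⟨x₀, hx₀, hx₀c, hproj⟩ := hd.exists_projection ((hKlev v₀ (hKB v₀ hv₀)).1 hv₀).2
  have hx₀C : x₀ ∈ C := hp.convex hd hp.root_mem (hp.theta_mem hα) hx₀
  have hx₀lev : x₀ ∈ level d C r a c := ⟨hx₀C, hx₀c⟩
  have hclosed := level_closed hd hp.closed hproj
  obtain ⟨huK, humin⟩ := argmin_spec ⟨v₀, hv₀⟩ (fun v => m'.dist v α)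
  set u := argmin K (fun v => m'.dist v α) with hu
  have huB := hKB u huK
  have hrx : B.rep ∈ K → x₀ = r := fun h =>
    hd.btw_self ((hproj r).1 ((hKlev _ hρ).1 h).2).1
  have hax : α ∈ K → x₀ = a := fun h => hd.btw_self ((hproj a).1 ((hKlev _ hα).1 h).2).2
  have hcond : (m'.dist B.rep u + m'.dist u α = m'.dist B.rep α) ↔ θ u = x₀ := by
    rw [hdist _ hρ _ huB, hdist _ huB _ hα, hdist _ hρ _ hα]
    constructor
    · intro h
      exact hd.eq_of_level_eq h hx₀ (((hKlev u huB).1 huK).2.trans hx₀c.symm)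
    · intro h
      rw [h]
      exact hx₀
  unfold basicBag
  simp only
  rw [← hu]
  by_cases h : θ u = x₀
  · rw [if_pos (hcond.2 h)]
    have hinj : ∀ x ∈ B.nodes, x₀ = θ x → u = x := fun x hx hxx =>
      hn'.inj (hsub u huB) (hsub x hx) (by rw [heq u huB, heq x hx, h, hxx])
    refine ⟨N', θ', hn', Extends.refl _ _ _ _, ?_, ?_, ?_, ?_, ?_⟩
    · refine ⟨huK, ?_, fun x hx => hsub x (hKB x hx), fun x hx => (hNlev x hx).symm, ?_, ?_⟩
      · rw [heq u huB, h]
        exact hclosed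
      · intro x hx
        rcases hp.regular x (hKB x hx) with rfl | hi
        · exact Or.inl (hinj _ hρ (hrx hx)).symm
        · exact Or.inr hi
      · intro x hx y hy
        rw [hdist x (hKB x hx) y (hKB y hy), heq x (hKB x hx), heq y (hKB y hy)]
    · simp only
      rw [heq u huB, h]
      exact hx₀
    · intro x hx hxu
      refine ⟨hKB x hx, ?_⟩
      rintro rfl
      exact hxu (hinj _ hρ (hrx hx)).symm
    · exact fun hx => hinj _ hρ (hrx hx)
    · exact fun hx => hinj _ hα (hax hx)
  · rw [if_neg (fun hc => h (hcond.1 hc))]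
    -- A node at x₀ would belong to the class. Since x₀ lies between every point of the class and α,
    -- the node closest to α would then be at x₀ too.
    have hnew : ∀ z ∈ N', θ' z ≠ x₀ := by
      intro z hz hzx
      have hzK : z ∈ K := (hNlev z hz).1 (hzx ▸ hx₀lev)
      have hzB := hKB z hzK
      rw [heq z hzB] at hzx
      apply h
      have h1 := humin z hzK
      rw [hdist u huB α hα, hdist z hzB α hα, hzx] at h1
      have h2 := ((hproj (θ u)).1 ((hKlev u huB).1 huK).2).2
      unfold Btw at h2
      exact hd.eq_of_le_zero (by linarith)
    have hwN : (Sum.inr m'.fresh : Node L) ∉ N' := fun h => (hn'.fresh_lt _ h).false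
    set w : Node L := Sum.inr m'.fresh with hw
    have hwK : w ∉ K := fun h => hwN (hsub w (hKB w h))
    have hne : ∀ x ∈ N', x ≠ w := fun x hx hxw => hwN (hxw ▸ hx)
    have hrK : B.rep ∉ K := fun hk => hnew _ (hsub _ hρ) (by rw [heq _ hρ, hrx hk])
    have hαK : α ∉ K := fun hk => hnew _ (hsub _ hα) (by rw [heq _ hα, hax hk])
    have hρw : B.rep ≠ w := hne _ (hsub _ hρ)
    have hαw : α ≠ w := hne _ (hsub _ hα)
    have hx₀r : x₀ ≠ r := fun e => hnew _ (hsub _ hρ) (by rw [heq _ hρ, e])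
    have hold : ∀ x ∈ N', Function.update θ' w x₀ x = θ' x := fun x hx =>
      Function.update_of_ne (hne x hx) _ _
    -- The distance from y to its projection onto the path is a Gromov product.
    have hlen : ∀ y ∈ K, (m'.dist y α + m'.dist y B.rep - m'.dist α B.rep) / 2 = d x₀ (θ y) := by
      intro y hy
      have hyB := hKB y hy
      rw [hdist y hyB α hα, hdist y hyB _ hρ, hdist α hα _ hρ]
      obtain ⟨h1, h2⟩ := (hproj (θ y)).1 ((hKlev y hyB).1 hy).2
      have h3 := hx₀
      unfold Btw at h1 h2 h3
      have := hd.symm a r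
      have := hd.symm x₀ r
      have := hd.symm x₀ (θ y)
      linarith
    refine ⟨insert w N', Function.update θ' w x₀, ⟨?_, ?_, ?_, ?_, ?_⟩, ⟨?_, hold, ?_, ?_⟩,
      ⟨?_, ?_, ?_, ?_, ?_, ?_⟩, ?_, ?_, ?_, ?_⟩
    · exact fun i => Or.inr (hn'.inl_mem i)
    · intro i
      rw [hold _ (hn'.inl_mem i), hn'.inl_eq]
    · rintro x (rfl | hx) y (rfl | hy) hxy
      · rfl
      · rw [hold y hy, Function.update_self] at hxy
        exact absurd hxy.symm (hnew y hy)
      · rw [hold x hx, Function.update_self] at hxy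
        exact absurd hxy (hnew x hx)
      · rw [hold x hx, hold y hy] at hxy
        exact hn'.inj hx hy hxy
    · rintro k (hk | hk)
      · rw [hw, Sum.inr.injEq] at hk
        simp [hk]
      · exact (hn'.fresh_lt k hk).trans (Nat.lt_succ_self _)
    · intro k hk
      have hk' : (Sum.inr k : Node L) ≠ w := by
        rw [hw, Ne, Sum.inr.injEq]
        simp only at hk
        omega
      simp only [extendDist, hk', false_and, if_false]
      exact hn'.dist_new k (by simp only at hk; omega)
    · exact fun x hx => Or.inr hx
    · intro x hx y hy
      simp only [extendDist, hne x hx, hne y hy, false_and, if_false]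
    · rintro x (rfl | hx) hx'
      · rw [Function.update_self]
        exact ⟨hx₀lev, hx₀r⟩
      · exact absurd hx hx'
    · exact Finset.mem_insert_self _ _
    · simp only [Function.update_self]
      exact hclosed
    · intro x hx
      rcases Finset.mem_insert.1 hx with rfl | hx
      · exact Or.inl rfl
      · exact Or.inr (hsub x (hKB x hx))
    · rintro x (rfl | hx)
      · simp [hx₀lev]
      · rw [hold x hx, hNlev x hx]
        simp [hne x hx]
    · intro x hx
      rcases Finset.mem_insert.1 hx with rfl | hx
      · exact Or.inl rfl
      · rcases hp.regular x (hKB x hx) with rfl | hi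
        · exact absurd hx hrK
        · exact Or.inr hi
    · intro x hx y hy
      rcases Finset.mem_insert.1 hx with rfl | hx
      · rcases Finset.mem_insert.1 hy with rfl | hy
        · simp only [extendDist, hwK, and_false, if_false, Function.update_self, hd.self]
          -- The extension does not write the distance from w to itself, as w is not in the class;
          -- the entry is still the default 0 of an unused number.
          exact hn'.dist_new _ le_rfl
        · have hyN := hsub y (hKB y hy)
          rw [hold y hyN, heq y (hKB y hy), Function.update_self]
          simp only [extendDist, hy, and_self, if_true]
          exact hlen y hy
      · have hxN := hsub x (hKB x hx)
        rcases Finset.mem_insert.1 hy with rfl | hy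
        · rw [hold x hxN, heq x (hKB x hx), Function.update_self]
          simp only [extendDist, hx, hne x hxN, hwK, if_false, and_self, if_true]
          rw [hlen x hx, hd.symm]
        · have hyN := hsub y (hKB y hy)
          simp only [extendDist, hne x hxN, hne y hyN, false_and, if_false]
          rw [hold x hxN, hold y hyN, heq x (hKB x hx), heq y (hKB y hy)]
          exact hdist x (hKB x hx) y (hKB y hy)
    · simp only [Function.update_self]
      exact hx₀
    · intro x hx hxw
      have hx : x ∈ K := (Finset.mem_insert.1 hx).resolve_left hxw
      exact ⟨hKB x hx, fun e => hrK (e ▸ hx)⟩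
    · intro hx
      rcases Finset.mem_insert.1 hx with hx | hx
      · exact absurd hx hρw
      · exact absurd hx hrK
    · intro hx
      rcases Finset.mem_insert.1 hx with hx | hx
      · exact absurd hx hαw
      · exact absurd hx hαK

end Basic

end Pieces

/-! ### The invariant and its preservation by `basic` -/

section Invariant

variable {V L : Type*} [DecidableEq L] {d : V → V → ℝ} {lab : L → V}
  {N N' N'' : Set (Node L)} {θ θ' θ'' : Node L → V} {m m' m'' : Memory L}
  {B : Bag L} {C A A' : Set V}

/-- In the induction A collects the levels already treated. As the values increase strictly, they
are disjoint from those to come, so earlier pieces survive later extensions. -/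
theorem basicBags_spec (hd : IsTreeMetric d) (hp : IsPiece d N θ m B C) {α : Node L}
    (hα : α ∈ B.nodes) (cs : List ℝ) (hcs : cs.Pairwise (· < ·))
    (hK : ∀ c ∈ cs, (B.nodes.filter (fun v => m.dist v α - m.dist v B.rep = c)).Nonempty)
    (hn' : IsNaming lab N' θ' m') (he : Extends N θ m N' θ' m' A)
    (hA : ∀ c ∈ cs, ∀ v ∈ A, v ∉ level d C (θ B.rep) (θ α) c) :
    ∃ N'' θ'', ∃ Q : List (ℝ × Bag L),
      let out := basicBags B.rep α m'
        (cs.map fun c => B.nodes.filter (fun v => m.dist v α - m.dist v B.rep = c))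
      IsNaming lab N'' θ'' out.2 ∧
      Extends N' θ' m' N'' θ'' out.2
        {v | v ≠ θ B.rep ∧ ∃ c ∈ cs, v ∈ level d C (θ B.rep) (θ α) c} ∧
      Q.map Prod.fst = cs ∧ Q.map Prod.snd = out.1 ∧
      ∀ q ∈ Q, LevelBag d N'' θ'' out.2 B C (θ B.rep) (θ α) α q.1 q.2 := by
  induction cs generalizing N' θ' m' A with
  | nil => exact ⟨N', θ', [], hn', Extends.refl _ _ _ _, rfl, rfl, by simp⟩
  | cons c cs ih =>
    rw [List.pairwise_cons] at hcs
    obtain ⟨N₁, θ₁, h1, h2, h3⟩ := basicBag_spec hd hp hn' he hα (hA c (by simp))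
      (hK c (by simp))
    have he₁ : Extends N θ m N₁ θ₁ _ (A ∪ level d C (θ B.rep) (θ α) c) :=
      (he.mono Set.subset_union_left).trans
        (h2.mono (Set.sdiff_subset.trans Set.subset_union_right))
    have hdisj : ∀ c' ∈ cs, ∀ v ∈ level d C (θ B.rep) (θ α) c,
        v ∉ level d C (θ B.rep) (θ α) c' :=
      fun c' hc' v hv hv' => (hcs.1 c' hc').ne (hv.2.symm.trans hv'.2)
    obtain ⟨N₂, θ₂, Q, g1, g2, g3, g4, g5⟩ := ih hcs.2 (fun c' hc' => hK c' (by simp [hc'])) h1 he₁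
      (by
        rintro c' hc' v (hv | hv)
        · exact hA c' (by simp [hc']) v hv
        · exact hdisj c' hc' v hv)
    refine ⟨N₂, θ₂, (c, (basicBag B.rep α m'
        (B.nodes.filter (fun v => m.dist v α - m.dist v B.rep = c))).1) :: Q, g1,
      (h2.mono ?_).trans (g2.mono ?_), by simp only [List.map_cons, g3], ?_, ?_⟩
    · rintro v ⟨hv, hvr⟩
      exact ⟨hvr, c, by simp, hv⟩
    · rintro v ⟨hvr, c', hc', hv⟩
      exact ⟨hvr, c', by simp [hc'], hv⟩
    · simp only [List.map_cons, g4]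
      rfl
    · intro q hq
      rcases List.mem_cons.1 hq with rfl | hq
      · refine h3.extend g2 ?_
        rintro v ⟨-, c', hc', hv⟩ hv'
        exact hdisj c' hc' v hv' hv
      · exact g5 q hq

/-- Being consecutive is rephrased as having no key strictly in between, the form that matches
adjacency in a tree metric. -/
theorem mem_pathEdges_map {X : Type*} (f : X → Node L) (key : X → ℝ) (l : List X)
    (hl : l.Pairwise (fun x y => key x < key y)) (e : Sym2 (Node L)) :
    e ∈ pathEdges (l.map f) ↔ ∃ x ∈ l, ∃ y ∈ l, key x < key y ∧
      (∀ z ∈ l, key z ≤ key x ∨ key y ≤ key z) ∧ e = s(f x, f y) := by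
  induction l with
  | nil => simp [pathEdges]
  | cons a l ih =>
    cases l with
    | nil => simp [pathEdges]
    | cons b l =>
      rw [List.pairwise_cons] at hl
      have hb := (List.pairwise_cons.1 hl.2).1
      have hab := hl.1 b (by simp)
      simp only [List.map_cons, pathEdges, Finset.mem_insert] at ih ⊢
      rw [ih hl.2]
      constructor
      · rintro (rfl | ⟨x, hx, y, hy, hxy, hz, rfl⟩)
        · refine ⟨a, by simp, b, by simp, hab, ?_, rfl⟩
          intro z hz
          rcases List.mem_cons.1 hz with rfl | hz
          · exact Or.inl le_rfl
          · rcases List.mem_cons.1 hz with rfl | hz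
            · exact Or.inr le_rfl
            · exact Or.inr (hb z hz).le
        · refine ⟨x, List.mem_cons_of_mem _ hx, y, List.mem_cons_of_mem _ hy, hxy, ?_, rfl⟩
          intro z hz'
          rcases List.mem_cons.1 hz' with rfl | hz'
          · exact Or.inl (hl.1 x hx).le
          · exact hz z hz'
      · rintro ⟨x, hx, y, hy, hxy, hz, rfl⟩
        rcases List.mem_cons.1 hy with rfl | hy₁
        · rcases List.mem_cons.1 hx with rfl | hx₁
          · exact absurd hxy (lt_irrefl _)
          · exact absurd hxy (hl.1 x hx₁).not_gt
        rcases List.mem_cons.1 hx with rfl | hx₁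
        · left
          rcases List.mem_cons.1 hy₁ with rfl | hy₂
          · rfl
          · rcases hz b (by simp) with h | h
            · exact absurd hab h.not_gt
            · exact absurd (hb y hy₂) h.not_gt
        · exact Or.inr ⟨x, hx₁, y, hy₁, hxy, fun z hz' => hz z (List.mem_cons_of_mem _ hz'), rfl⟩

/-- The invariant of the algorithm: the bags describe pieces of the tree that have at most their
roots in common, and the skeleton consists of the remaining edges of the tree. -/
structure Inv (T : SimpleGraph V) (d : V → V → ℝ) (lab : L → V) (N : Set (Node L))
    (θ : Node L → V) (P : List (Bag L × Set V)) (S : Finset (Sym2 (Node L))) (m : Memory L) :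
    Prop where
  naming : IsNaming lab N θ m
  pieces : ∀ p ∈ P, IsPiece d N θ m p.1 p.2
  disjoint : P.Pairwise (fun p q => ∀ v ∈ p.2, v ∈ q.2 → v = θ p.1.rep ∧ v = θ q.1.rep)
  mem : ∀ e ∈ S, ∀ x ∈ e, x ∈ N
  adj : ∀ x y, s(x, y) ∈ S → T.Adj (θ x) (θ y)
  cover : ∀ a b, T.Adj a b → (∃ x y, s(x, y) ∈ S ∧ θ x = a ∧ θ y = b) ∨
    ∃ p ∈ P, a ∈ p.2 ∧ b ∈ p.2

variable {T : SimpleGraph V} {P P' : List (Bag L × Set V)} {S S' : Finset (Sym2 (Node L))}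

omit [DecidableEq L] in
theorem Inv.perm (h : Inv T d lab N θ P S m) (hP : P.Perm P') : Inv T d lab N θ P' S m where
  naming := h.naming
  pieces p hp := h.pieces p (hP.mem_iff.2 hp)
  disjoint := by
    refine (hP.pairwise_iff ?_).1 h.disjoint
    intro p q hpq v hv hv'
    exact (hpq v hv' hv).symm
  mem := h.mem
  adj := h.adj
  cover a b hab := (h.cover a b hab).imp_right fun ⟨p, hp, h⟩ => ⟨p, hP.mem_iff.1 hp, h⟩

/-- Replace one piece by smaller pieces and edges. -/
theorem Inv.replace {p : Bag L × Set V} (h : Inv T d lab N θ (p :: P) S m)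
    (hn : IsNaming lab N' θ' m') (he : Extends N θ m N' θ' m' (p.2 \ {θ p.1.rep}))
    (hpieces : ∀ p' ∈ P', IsPiece d N' θ' m' p'.1 p'.2)
    (hdisj : P'.Pairwise (fun p q => ∀ v ∈ p.2, v ∈ q.2 → v = θ' p.1.rep ∧ v = θ' q.1.rep))
    (hsub : ∀ p' ∈ P', p'.2 ⊆ p.2)
    (hroot : ∀ p' ∈ P', θ p.1.rep ∈ p'.2 → p'.1.rep = p.1.rep)
    (hmem : ∀ e ∈ S', ∀ x ∈ e, x ∈ N')
    (hadj : ∀ x y, s(x, y) ∈ S' → T.Adj (θ' x) (θ' y))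
    (hcover : ∀ a ∈ p.2, ∀ b ∈ p.2, T.Adj a b → (∃ x y, s(x, y) ∈ S' ∧ θ' x = a ∧ θ' y = b) ∨
      ∃ p' ∈ P', a ∈ p'.2 ∧ b ∈ p'.2) :
    Inv T d lab N' θ' (P' ++ P) (S ∪ S') m' where
  naming := hn
  pieces q hq := by
    rcases List.mem_append.1 hq with hq | hq
    · exact hpieces q hq
    · refine (h.pieces q (List.mem_cons_of_mem _ hq)).extend he ?_
      rintro v ⟨hv, hvr⟩ hv'
      exact hvr ((List.pairwise_cons.1 h.disjoint).1 q hq v hv hv').1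
  disjoint := by
    have hq := List.pairwise_cons.1 h.disjoint
    have hrep : ∀ q ∈ p :: P, θ' q.1.rep = θ q.1.rep := fun q hq =>
      he.eq _ ((h.pieces q hq).subset _ (h.pieces q hq).rep_mem)
    rw [List.pairwise_append]
    refine ⟨hdisj, ?_, ?_⟩
    · refine hq.2.imp_of_mem ?_
      intro q q' hq1 hq2 hqq
      rw [hrep q (List.mem_cons_of_mem _ hq1), hrep q' (List.mem_cons_of_mem _ hq2)]
      exact hqq
    · intro p' hp' q hqP v hv hv'
      obtain ⟨h1, h2⟩ := hq.1 q hqP v (hsub p' hp' hv) hv'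
      rw [hrep q (List.mem_cons_of_mem _ hqP), hroot p' hp' (h1 ▸ hv), hrep p (by simp)]
      exact ⟨h1, h2⟩
  mem e hee x hx := by
    rcases Finset.mem_union.1 hee with h' | h'
    · exact he.subset x (h.mem e h' x hx)
    · exact hmem e h' x hx
  adj x y hxy := by
    rcases Finset.mem_union.1 hxy with h' | h'
    · rw [he.eq x (h.mem _ h' x (Sym2.mem_mk_left x y)),
        he.eq y (h.mem _ h' y (Sym2.mem_mk_right x y))]
      exact h.adj x y h'
    · exact hadj x y h'
  cover a b hab := by
    rcases h.cover a b hab with ⟨x, y, hxy, hx, hy⟩ | ⟨q, hq, hqa, hqb⟩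
    · refine Or.inl ⟨x, y, Finset.mem_union_left _ hxy, ?_, ?_⟩
      · rw [he.eq x (h.mem _ hxy x (Sym2.mem_mk_left x y)), hx]
      · rw [he.eq y (h.mem _ hxy y (Sym2.mem_mk_right x y)), hy]
    · rcases List.mem_cons.1 hq with rfl | hq
      · rcases hcover a hqa b hqb hab with ⟨x, y, hxy, hx, hy⟩ | ⟨p', hp', ha, hb⟩
        · exact Or.inl ⟨x, y, Finset.mem_union_right _ hxy, hx, hy⟩
        · exact Or.inr ⟨p', List.mem_append_left _ hp', ha, hb⟩
      · exact Or.inr ⟨q, List.mem_append_right _ hq, hqa, hqb⟩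

omit [DecidableEq L] in
/-- Every level of a piece contains a node of the bag. -/
theorem IsPiece.exists_node_level (hd : IsTreeMetric d) (hM : MedianLabelled d (Set.range lab))
    (hn : IsNaming lab N θ m) (hp : IsPiece d N θ m B C) {r a v : V} (hr : r ∈ C) (ha : a ∈ C) :
    ∃ x ∈ B.nodes, d (θ x) a - d (θ x) r = d v a - d v r := by
  obtain ⟨x₀, hx₀, -, hproj⟩ := hd.exists_projection (r := r) (a := a) (v₀ := v) rfl
  obtain ⟨i, hi, j, hj, k, hk, h1, h2, h3⟩ := hp.median hd hM hn (hp.convex hd hr ha hx₀)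
  have aux : ∀ i j y, Btw d i x₀ j → Btw d i x₀ y ∨ Btw d j x₀ y := fun i j y h =>
    (hd.branch _ _ _ h y).imp_right hd.btw_comm
  have := aux _ _ r h1
  have := aux _ _ r h2
  have := aux _ _ r h3
  have := aux _ _ a h1
  have := aux _ _ a h2
  have := aux _ _ a h3
  have : (Btw d (θ i) x₀ r ∧ Btw d (θ i) x₀ a) ∨ (Btw d (θ j) x₀ r ∧ Btw d (θ j) x₀ a) ∨
      (Btw d (θ k) x₀ r ∧ Btw d (θ k) x₀ a) := by tauto
  rcases this with h | h | h
  exacts [⟨i, hi, (hproj _).2 h⟩, ⟨j, hj, (hproj _).2 h⟩, ⟨k, hk, (hproj _).2 h⟩]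

-- The level decreases on the way from r to a, so the point of the higher level is met first.
omit [DecidableEq L] in
theorem IsTreeMetric.btw_of_level_le (hd : IsTreeMetric d) {r a x y : V} (hx : Btw d r x a)
    (hy : Btw d r y a) (h : d x a - d x r ≤ d y a - d y r) : Btw d r y x := by
  rcases hd.btw_total hx hy with h' | h'
  · have : x = y := by
      apply hd.eq_of_level_eq hx hy
      have := hd.symm x r
      have := hd.symm y r
      have := hd.nonneg x y
      unfold Btw at *
      linarith
    exact this ▸ hd.btw_right _ _
  · exact h'

/-- The representatives are the projections of the levels, and every level of the part contains a
node of the bag, so none is missing from the list. The new edges are therefore those of the path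
from ρ to α, and any other edge inside the part stays within one level. -/
theorem Inv.basic (hd : IsTreeMetric d) (hadj : AdjOfMetric T d)
    (hM : MedianLabelled d (Set.range lab)) (h : Inv T d lab N θ ((B, C) :: P) S m) {α : Node L}
    (hα : α ∈ B.nodes) :
    ∃ N' θ' P', P'.map Prod.fst = (basic m B α).bags ∧
      Extends N θ m N' θ' (LatentTree.basic m B α).mem Set.univ ∧
      Inv T d lab N' θ' (P' ++ P) (S ∪ (LatentTree.basic m B α).skeleton)
        (LatentTree.basic m B α).mem ∧
      (∀ B' ∈ (LatentTree.basic m B α).bags, ∀ x ∈ B'.nodes, x ≠ B'.rep →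
        x ∈ B.nodes ∧ x ≠ B.rep) ∧
      ∀ B' ∈ (LatentTree.basic m B α).bags, α ∈ B'.nodes → B'.rep = α := by
  have hp : IsPiece d N θ m B C := h.pieces (B, C) (by simp)
  set r := θ B.rep with hr
  set a := θ α with ha
  have hrC : r ∈ C := hp.root_mem
  have haC : a ∈ C := hp.theta_mem hα
  set im := B.nodes.image (fun v => m.dist v α - m.dist v B.rep) with him
  have hcs : (im.sort (· ≤ ·)).Pairwise (· < ·) := (im.sortedLT_sort).pairwise
  have hmem : ∀ x ∈ B.nodes, d (θ x) a - d (θ x) r ∈ im.sort (· ≤ ·) := by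
    intro x hx
    rw [Finset.mem_sort, him, Finset.mem_image]
    exact ⟨x, hx, by rw [hp.dist_eq x hx α hα, hp.dist_eq x hx _ hp.rep_mem]⟩
  have hK : ∀ c ∈ im.sort (· ≤ ·),
      (B.nodes.filter (fun v => m.dist v α - m.dist v B.rep = c)).Nonempty := by
    intro c hc
    rw [Finset.mem_sort, him, Finset.mem_image] at hc
    obtain ⟨x, hx, hxc⟩ := hc
    exact ⟨x, Finset.mem_filter.2 ⟨hx, hxc⟩⟩
  obtain ⟨N', θ', Q, g1, g2, g3, g4, g5⟩ := basicBags_spec hd hp hα _ hcs hK h.naming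
    (Extends.refl N θ m ∅) (by simp)
  have hbags : (LatentTree.basic m B α).bags = Q.map Prod.snd := g4.symm
  have hskel : (LatentTree.basic m B α).skeleton = pathEdges (Q.map fun q => q.2.rep) := by
    have : (LatentTree.basic m B α).skeleton
        = pathEdges ((LatentTree.basic m B α).bags.map Bag.rep) := rfl
    rw [this, hbags, List.map_map]
    rfl
  have hQ : Q.Pairwise (fun q q' => q.1 < q'.1) := by
    rw [← List.pairwise_map (f := Prod.fst) (R := (· < ·)), g3]
    exact hcs
  have hlevel : ∀ v ∈ C, ∃ q ∈ Q, q.1 = d v a - d v r := by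
    intro v hv
    obtain ⟨x, hx, hxv⟩ := hp.exists_node_level hd hM h.naming (v := v) hrC haC
    have := hmem x hx
    rw [← g3, List.mem_map] at this
    obtain ⟨q, hq, hqx⟩ := this
    exact ⟨q, hq, hqx.trans hxv⟩
  have hrep : ∀ q ∈ Q, θ' q.2.rep ∈ level d C r a q.1 := fun q hq => (g5 q hq).isPiece.root_mem
  have hrepN : ∀ q ∈ Q, q.2.rep ∈ N' := fun q hq =>
    (g5 q hq).isPiece.subset _ (g5 q hq).isPiece.rep_mem
  have hrepeq : ∀ q ∈ Q, ∀ x, Btw d r x a → q.1 = d x a - d x r → θ' q.2.rep = x := by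
    intro q hq x hx hqx
    apply hd.eq_of_level_eq (g5 q hq).btw hx
    rw [(hrep q hq).2, hqx]
  refine ⟨N', θ', Q.map fun q => (q.2, level d C r a q.1), ?_, g2.mono (Set.subset_univ _), ?_,
    ?_, ?_⟩
  · rw [List.map_map, hbags]
    rfl
  · apply h.replace g1 (g2.mono ?_)
    · intro p' hp'
      obtain ⟨q, hq, rfl⟩ := List.mem_map.1 hp'
      exact (g5 q hq).isPiece
    · rw [List.pairwise_map]
      refine hQ.imp ?_
      intro q q' hqq v hv hv'
      exact absurd (hv.2.symm.trans hv'.2) hqq.ne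
    · intro p' hp'
      obtain ⟨q, hq, rfl⟩ := List.mem_map.1 hp'
      exact fun v hv => hv.1
    · intro p' hp' hrp
      obtain ⟨q, hq, rfl⟩ := List.mem_map.1 hp'
      apply (g5 q hq).rep_eq
      have hρ := hp.subset _ hp.rep_mem
      rw [(g5 q hq).isPiece.mem_iff _ (g2.subset _ hρ), g2.eq _ hρ]
      exact hrp
    · intro e he x hx
      rw [hskel, mem_pathEdges_map _ Prod.fst _ hQ] at he
      obtain ⟨q, hq, q', hq', -, -, rfl⟩ := he
      rcases Sym2.mem_iff.1 hx with rfl | rfl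
      exacts [hrepN q hq, hrepN q' hq']
    -- A point z between two consecutive representatives lies on the path from r to a. Its level is
    -- one of the list, hence not strictly between the two, and z is one of the ends.
    · have key : ∀ q ∈ Q, ∀ q' ∈ Q, q.1 < q'.1 → (∀ z ∈ Q, z.1 ≤ q.1 ∨ q'.1 ≤ z.1) →
          T.Adj (θ' q.2.rep) (θ' q'.2.rep) := by
        intro q hq q' hq' hlt hbet
        have b1 := (g5 q hq).btw
        have b2 := (g5 q' hq').btw
        have l1 := (hrep q hq).2
        have l2 := (hrep q' hq').2
        rw [hadj]
        refine ⟨fun e => hlt.ne (by rw [← l1, ← l2, e]), fun z hz => ?_⟩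
        have b3 := hd.btw_of_level_le b1 b2 (by rw [l1, l2]; exact hlt.le)
        have b4 := hd.btw_trans' (hd.btw_comm hz) b3
        have b5 := (hd.btw_trans b4.1 b1).1
        obtain ⟨q'', hq'', hqz⟩ := hlevel z (hp.convex hd hrC haC b5)
        rcases hbet q'' hq'' with h' | h'
        · left
          apply hd.btw_antisymm b4.1
          exact hd.btw_of_level_le b5 b1 (by rw [l1, ← hqz]; exact h')
        · right
          symm
          apply hd.btw_antisymm b4.2
          exact hd.btw_of_level_le b2 b5 (by rw [l2, ← hqz]; exact h')
      intro x y hxy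
      rw [hskel, mem_pathEdges_map _ Prod.fst _ hQ] at hxy
      obtain ⟨q, hq, q', hq', hlt, hbet, he⟩ := hxy
      rcases Sym2.eq_iff.1 he with ⟨rfl, rfl⟩ | ⟨rfl, rfl⟩
      · exact key q hq q' hq' hlt hbet
      · exact (key q hq q' hq' hlt hbet).symm
    · intro x hx y hy hxy
      -- The projection of x separates x from y, so it is an end of the edge; it is not y, whose
      -- level differs.
      have onpath : ∀ x ∈ C, ∀ y ∈ C, T.Adj x y → d x a - d x r ≠ d y a - d y r →
          Btw d r x a := by
        intro x hx y hy hxy hne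
        obtain ⟨x₀, hx₀, hx₀c, hproj⟩ := hd.exists_projection (r := r) (a := a) (v₀ := x) rfl
        have := level_closed hd hp.closed hproj x ⟨hx, rfl⟩ y (fun h => hne h.2.symm)
        rcases ((hadj x y).1 hxy).2 _ this with rfl | rfl
        · exact hx₀
        · exact absurd hx₀c.symm hne
      have key : ∀ x ∈ C, ∀ y ∈ C, T.Adj x y → d x a - d x r < d y a - d y r →
          ∃ q ∈ Q, ∃ q' ∈ Q, s(q.2.rep, q'.2.rep) ∈ (LatentTree.basic m B α).skeleton ∧
            θ' q.2.rep = x ∧ θ' q'.2.rep = y := by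
        intro x hx y hy hxy hlt
        have b1 := onpath x hx y hy hxy hlt.ne
        have b2 := onpath y hy x hx hxy.symm hlt.ne'
        obtain ⟨q, hq, hqx⟩ := hlevel x hx
        obtain ⟨q', hq', hqy⟩ := hlevel y hy
        refine ⟨q, hq, q', hq', ?_, hrepeq q hq x b1 hqx, hrepeq q' hq' y b2 hqy⟩
        rw [hskel, mem_pathEdges_map _ Prod.fst _ hQ]
        refine ⟨q, hq, q', hq', by rw [hqx, hqy]; exact hlt, ?_, rfl⟩
        intro z hz
        by_contra! hc
        have b3 := (g5 z hz).btw
        have l3 := (hrep z hz).2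
        have c1 := hd.btw_of_level_le b1 b3 (by rw [l3, ← hqx]; exact hc.1.le)
        have c2 := hd.btw_of_level_le b3 b2 (by rw [l3, ← hqy]; exact hc.2.le)
        rcases ((hadj x y).1 hxy).2 _ (hd.btw_comm (hd.btw_trans c2 c1).2) with e | e
        · rw [e, ← hqx] at l3
          exact hc.1.ne l3
        · rw [e, ← hqy] at l3
          exact hc.2.ne' l3
      rcases lt_trichotomy (d x a - d x r) (d y a - d y r) with hlt | heq | hlt
      · obtain ⟨q, -, q', -, h1, h2, h3⟩ := key x hx y hy hxy hlt
        exact Or.inl ⟨_, _, h1, h2, h3⟩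
      · obtain ⟨q, hq, hqx⟩ := hlevel x hx
        exact Or.inr ⟨_, List.mem_map.2 ⟨q, hq, rfl⟩, ⟨hx, hqx.symm⟩, ⟨hy, (hqx.trans heq).symm⟩⟩
      · obtain ⟨q, -, q', -, h1, h2, h3⟩ := key y hy x hx hxy.symm hlt
        exact Or.inl ⟨_, _, Sym2.eq_swap ▸ h1, h3, h2⟩
    · rintro v ⟨hvr, c, -, hv⟩
      exact ⟨hv.1, hvr⟩
  · intro B' hB'
    rw [hbags, List.mem_map] at hB'
    obtain ⟨q, hq, rfl⟩ := hB'
    exact (g5 q hq).nonrep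
  · intro B' hB'
    rw [hbags, List.mem_map] at hB'
    obtain ⟨q, hq, rfl⟩ := hB'
    exact (g5 q hq).eq_rep

end Invariant

section Passes

variable {V L : Type*} [DecidableEq L] {d : V → V → ℝ} {lab : L → V}
  {N N' : Set (Node L)} {θ θ' : Node L → V} {m m' : Memory L}
  {B : Bag L} {C C' : Set V} {T : SimpleGraph V} {P P' : List (Bag L × Set V)}
  {S S' : Finset (Sym2 (Node L))}

/-! ### The procedure `explode` -/

omit [DecidableEq L] in
theorem IsPiece.restrict (hp : IsPiece d N θ m B C) (hC : C' ⊆ C) (hr : θ B.rep ∈ C')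
    (hclosed : ∀ x ∈ C', ∀ y ∈ C, y ∉ C' → Btw d x (θ B.rep) y) {K : Finset (Node L)}
    (hK : ∀ x, x ∈ K ↔ x ∈ B.nodes ∧ θ x ∈ C') : IsPiece d N θ m ⟨K, B.rep⟩ C' where
  rep_mem := (hK _).2 ⟨hp.rep_mem, hr⟩
  closed x hx y hy := by
    by_cases hyC : y ∈ C
    · exact hclosed x hx y hyC hy
    · exact hp.closed x (hC hx) y hyC
  subset x hx := hp.subset x ((hK x).1 hx).1
  mem_iff x hx := by
    rw [hK, hp.mem_iff x hx]
    exact ⟨fun h => h.2, fun h => ⟨hC h, h⟩⟩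
  regular x hx := hp.regular x ((hK x).1 hx).1
  dist_eq x hx y hy := hp.dist_eq x ((hK x).1 hx).1 y ((hK y).1 hy).1

omit [DecidableEq L] in
theorem IsPiece.dist_lt_iff (hd : IsTreeMetric d) (hp : IsPiece d N θ m B C) {u v : Node L}
    (hu : u ∈ B.nodes) (hv : v ∈ B.nodes) :
    m.dist u v < m.dist u B.rep + m.dist v B.rep ↔ ¬ Btw d (θ u) (θ B.rep) (θ v) := by
  rw [hp.dist_eq u hu v hv, hp.dist_eq u hu _ hp.rep_mem, hp.dist_eq v hv _ hp.rep_mem]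
  have h1 := hd.triangle (θ u) (θ B.rep) (θ v)
  have h2 := hd.symm (θ v) (θ B.rep)
  unfold Btw
  rw [h2]
  constructor
  · intro h h'
    linarith
  · intro h
    exact lt_of_le_of_ne h1 (Ne.symm h)

/-- The part is divided into the branch of u at the root and the remaining branches, with the root
in both. An edge that leaves C₁ must start at the root and so lies in C₂. -/
theorem Inv.explode_step (hd : IsTreeMetric d) (hadj : AdjOfMetric T d) {ρ u : Node L}
    {R : Finset (Node L)} (h : Inv T d lab N θ ((⟨insert ρ R, ρ⟩, C) :: P) S m) (hρ : ρ ∉ R)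
    (hu : u ∈ R) :
    let K := R.filter (fun v => m.dist u v < m.dist u ρ + m.dist v ρ)
    u ∈ K ∧ ∃ C₁ C₂,
      Inv T d lab N θ ((⟨insert ρ K, ρ⟩, C₁) :: (⟨insert ρ (R \ K), ρ⟩, C₂) :: P) S m := by
  intro K
  have hp : IsPiece d N θ m ⟨insert ρ R, ρ⟩ C := h.pieces _ List.mem_cons_self
  have hne : ∀ x ∈ R, θ x ≠ θ ρ := by
    intro x hx hxρ
    have := h.naming.inj (hp.subset x (by simp [hx])) (hp.subset ρ (by simp)) hxρ
    exact hρ (this ▸ hx)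
  have hK : ∀ x ∈ R, x ∈ K ↔ ¬ Btw d (θ u) (θ ρ) (θ x) := by
    intro x hx
    rw [Finset.mem_filter]
    have := hp.dist_lt_iff hd (u := u) (v := x) (by simp [hu]) (by simp [hx])
    simp only at this
    rw [this]
    simp [hx]
  refine ⟨(hK u hu).2 fun h' => hne u hu (hd.btw_self h').symm, ?_⟩
  let C₁ : Set V := {v | v ∈ C ∧ (v = θ ρ ∨ ¬ Btw d (θ u) (θ ρ) v)}
  let C₂ : Set V := {v | v ∈ C ∧ (v = θ ρ ∨ Btw d (θ u) (θ ρ) v)}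
  have hrC : θ ρ ∈ C := hp.root_mem
  have p1 : IsPiece d N θ m ⟨insert ρ K, ρ⟩ C₁ := by
    refine hp.restrict (C' := C₁) (fun v hv => hv.1) ⟨hrC, Or.inl rfl⟩ ?_ ?_
    · rintro x ⟨-, hx⟩ y hy hy'
      have hb : Btw d (θ u) (θ ρ) y := by
        by_contra hc
        exact hy' ⟨hy, Or.inr hc⟩
      rcases hx with rfl | hx
      · exact hd.btw_left _ _
      · exact (hd.branch _ _ _ hb x).resolve_left hx
    · intro x
      simp only [Finset.mem_insert]
      constructor
      · rintro (rfl | hx)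
        · exact ⟨Or.inl rfl, hrC, Or.inl rfl⟩
        · have hxR := (Finset.mem_filter.1 hx).1
          exact ⟨Or.inr hxR, hp.theta_mem (Finset.mem_insert_of_mem hxR), Or.inr ((hK x hxR).1 hx)⟩
      · rintro ⟨rfl | hx, -, hx'⟩
        · exact Or.inl rfl
        · exact Or.inr ((hK x hx).2 (hx'.resolve_left (hne x hx)))
  have p2 : IsPiece d N θ m ⟨insert ρ (R \ K), ρ⟩ C₂ := by
    refine hp.restrict (C' := C₂) (fun v hv => hv.1) ⟨hrC, Or.inl rfl⟩ ?_ ?_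
    · rintro x ⟨-, hx⟩ y hy hy'
      have hb : ¬ Btw d (θ u) (θ ρ) y := fun hc => hy' ⟨hy, Or.inr hc⟩
      rcases hx with rfl | hx
      · exact hd.btw_left _ _
      · exact hd.btw_comm ((hd.branch _ _ _ hx y).resolve_left hb)
    · intro x
      simp only [Finset.mem_insert, Finset.mem_sdiff]
      constructor
      · rintro (rfl | ⟨hx, hxK⟩)
        · exact ⟨Or.inl rfl, hrC, Or.inl rfl⟩
        · exact ⟨Or.inr hx, hp.theta_mem (Finset.mem_insert_of_mem hx),
            Or.inr (not_not.1 fun hc => hxK ((hK x hx).2 hc))⟩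
      · rintro ⟨rfl | hx, -, hx'⟩
        · exact Or.inl rfl
        · exact Or.inr ⟨hx, fun hc => (hK x hx).1 hc (hx'.resolve_left (hne x hx))⟩
  refine ⟨C₁, C₂, ?_⟩
  have := h.replace (P' := [(⟨insert ρ K, ρ⟩, C₁), (⟨insert ρ (R \ K), ρ⟩, C₂)]) (S' := ∅)
    h.naming (Extends.refl _ _ _ _)
    (by simpa using ⟨p1, p2⟩) ?_ ?_ (by simp) (by simp) (by simp) ?_
  · simpa using this
  · simp only [List.pairwise_cons, List.mem_singleton, forall_eq, List.not_mem_nil,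
      IsEmpty.forall_iff, implies_true, List.Pairwise.nil, and_true, and_self]
    rintro v ⟨-, hv⟩ ⟨-, hv'⟩
    tauto
  · simp only [List.mem_cons, List.not_mem_nil, or_false, forall_eq_or_imp, forall_eq]
    exact ⟨fun v hv => hv.1, fun v hv => hv.1⟩
  · intro a ha b hb hab
    right
    have key : ∀ a ∈ C, ∀ b ∈ C, T.Adj a b → a ∈ C₁ → b ∉ C₁ → a ∈ C₂ ∧ b ∈ C₂ := by
      intro a ha b hb hab ha' hb'
      have h1 := p1.closed a ha' b hb'
      rcases ((hadj a b).1 hab).2 _ h1 with e | e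
      · refine ⟨⟨ha, Or.inl e.symm⟩, hb, ?_⟩
        by_contra hc
        exact hb' ⟨hb, Or.inr fun h' => hc (Or.inr h')⟩
      · exact absurd ⟨hb, Or.inl e.symm⟩ hb'
    by_cases ha₁ : a ∈ C₁ <;> by_cases hb₁ : b ∈ C₁
    · exact ⟨_, List.mem_cons_self, ha₁, hb₁⟩
    · exact ⟨_, List.mem_cons_of_mem _ (List.mem_singleton_self _), key a ha b hb hab ha₁ hb₁⟩
    · exact ⟨_, List.mem_cons_of_mem _ (List.mem_singleton_self _),
        (key b hb a ha hab.symm hb₁ ha₁).symm⟩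
    · refine ⟨_, List.mem_cons_of_mem _ (List.mem_singleton_self _), ⟨ha, ?_⟩, ⟨hb, ?_⟩⟩
      · by_contra hc
        exact ha₁ ⟨ha, Or.inr fun h' => hc (Or.inr h')⟩
      · by_contra hc
        exact hb₁ ⟨hb, Or.inr fun h' => hc (Or.inr h')⟩

/-- All vertices of the part are medians of nodes of the bag, hence equal to the root; no edge is
lost. -/
theorem Inv.drop_singleton (hd : IsTreeMetric d) (hM : MedianLabelled d (Set.range lab))
    {ρ : Node L} (h : Inv T d lab N θ ((⟨insert ρ ∅, ρ⟩, C) :: P) S m) :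
    Inv T d lab N θ P S m := by
  have hp : IsPiece d N θ m ⟨insert ρ ∅, ρ⟩ C := h.pieces _ List.mem_cons_self
  have hC : ∀ v ∈ C, v = θ ρ := by
    intro v hv
    obtain ⟨i, hi, j, hj, -, -, hb, -⟩ := hp.median hd hM h.naming hv
    simp only [insert_empty_eq, Finset.mem_singleton] at hi hj
    subst hi hj
    exact hd.btw_self hb
  have := h.replace (P' := []) (S' := ∅) h.naming (Extends.refl _ _ _ _) (by simp) (by simp)
    (by simp) (by simp) (by simp) (by simp) (by
      intro a ha b hb hab
      exact absurd ((hC a ha).trans (hC b hb).symm) hab.ne)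
  simpa using this

/-- What is known about the bags that `explode` returns. -/
def IsExploded (dist : Node L → Node L → ℝ) (B : Bag L) : Prop :=
  ∃ u ∈ B.nodes, u ≠ B.rep ∧ ∀ x ∈ B.nodes, x ≠ B.rep →
    dist u x < dist u B.rep + dist x B.rep

theorem Inv.explodeLoop (hd : IsTreeMetric d) (hadj : AdjOfMetric T d)
    (hM : MedianLabelled d (Set.range lab)) {ρ : Node L} (k : ℕ) {R : Finset (Node L)}
    (h : Inv T d lab N θ ((⟨insert ρ R, ρ⟩, C) :: P) S m) (hρ : ρ ∉ R) (hk : R.card ≤ k) :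
    ∃ P', P'.map Prod.fst = explodeLoop m.dist ρ k R ∧ Inv T d lab N θ (P' ++ P) S m ∧
      ∀ B' ∈ LatentTree.explodeLoop m.dist ρ k R, IsExploded m.dist B' ∧
        ∀ x ∈ B'.nodes, x ≠ B'.rep → x ∈ R := by
  induction k generalizing R C P with
  | zero =>
    have : R = ∅ := Finset.card_eq_zero.1 (Nat.le_zero.1 hk)
    subst this
    exact ⟨[], rfl, h.drop_singleton hd hM, by simp [LatentTree.explodeLoop]⟩
  | succ k ih =>
    unfold LatentTree.explodeLoop
    by_cases hR : R.Nonempty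
    · rw [dif_pos hR]
      simp only
      have huR := hR.choose_spec
      set u := hR.choose
      obtain ⟨huK, C₁, C₂, h'⟩ := h.explode_step hd hadj hρ huR
      -- The two filters differ only in their decidability instances.
      have hKeq : (@Finset.filter _ (fun v => m.dist u v < m.dist u ρ + m.dist v ρ)
        (fun _ => Classical.propDecidable _) R) =
          R.filter (fun v => m.dist u v < m.dist u ρ + m.dist v ρ) := by
        ext x
        simp only [Finset.mem_filter]
      rw [hKeq]
      set K := R.filter (fun v => m.dist u v < m.dist u ρ + m.dist v ρ)
      have hKR : K ⊆ R := Finset.filter_subset _ _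
      -- The chosen u belongs to its own branch, so each round consumes a node and the bound k
      -- suffices.
      have hcard : (R \ K).card < R.card :=
        Finset.card_lt_card (Finset.sdiff_ssubset hKR ⟨u, huK⟩)
      obtain ⟨P', e1, e2, e3⟩ := ih (h'.perm (List.Perm.swap _ _ _))
        (fun hc => hρ (Finset.mem_sdiff.1 hc).1) (by omega)
      refine ⟨(⟨insert ρ K, ρ⟩, C₁) :: P', ?_, e2.perm List.perm_middle, ?_⟩
      · simp only [List.map_cons, e1]
      · intro B' hB'
        rcases List.mem_cons.1 hB' with rfl | hB'
        · refine ⟨⟨u, Finset.mem_insert_of_mem huK, fun e => hρ ((show u = ρ from e) ▸ huR), ?_⟩,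
            ?_⟩
          · intro x hx hxρ
            exact (Finset.mem_filter.1 ((Finset.mem_insert.1 hx).resolve_left hxρ)).2
          · intro x hx hxρ
            exact hKR ((Finset.mem_insert.1 hx).resolve_left hxρ)
        · exact ⟨(e3 B' hB').1, fun x hx hxr =>
            (Finset.mem_sdiff.1 ((e3 B' hB').2 x hx hxr)).1⟩
    · rw [dif_neg hR]
      rw [Finset.not_nonempty_iff_eq_empty] at hR
      subst hR
      exact ⟨[], rfl, h.drop_singleton hd hM, by simp⟩

theorem Inv.explode (hd : IsTreeMetric d) (hadj : AdjOfMetric T d)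
    (hM : MedianLabelled d (Set.range lab)) (h : Inv T d lab N θ ((B, C) :: P) S m) :
    ∃ P', P'.map Prod.fst = explode m.dist B ∧ Inv T d lab N θ (P' ++ P) S m ∧
      ∀ B' ∈ LatentTree.explode m.dist B, IsExploded m.dist B' ∧
        ∀ x ∈ B'.nodes, x ≠ B'.rep → x ∈ B.nodes ∧ x ≠ B.rep := by
  have hp : IsPiece d N θ m B C := h.pieces (B, C) List.mem_cons_self
  have hB : B = ⟨insert B.rep (B.nodes.erase B.rep), B.rep⟩ := by
    rw [Finset.insert_erase hp.rep_mem]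
  have h' : Inv T d lab N θ ((⟨insert B.rep (B.nodes.erase B.rep), B.rep⟩, C) :: P) S m := by
    rwa [← hB]
  obtain ⟨P', e1, e2, e3⟩ := h'.explodeLoop hd hadj hM B.nodes.card (by simp)
    (Finset.card_le_card (Finset.erase_subset _ _))
  refine ⟨P', e1, e2, fun B' hB' => ⟨(e3 B' hB').1, fun x hx hxr => ?_⟩⟩
  have := (e3 B' hB').2 x hx hxr
  exact ⟨Finset.mem_of_mem_erase this, Finset.ne_of_mem_erase this⟩

/-- `x` belongs to one of the bags and does not represent it. -/
def IsNonrep (l : List (Bag L)) (x : Node L) : Prop := ∃ B ∈ l, x ∈ B.nodes ∧ x ≠ B.rep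

theorem Inv.flatMap_explode (hd : IsTreeMetric d) (hadj : AdjOfMetric T d)
    (hM : MedianLabelled d (Set.range lab)) (h : Inv T d lab N θ (P' ++ P) S m) :
    ∃ P'', P''.map Prod.fst = (P'.map Prod.fst).flatMap (LatentTree.explode m.dist) ∧
      Inv T d lab N θ (P'' ++ P) S m ∧
      ∀ B ∈ (P'.map Prod.fst).flatMap (LatentTree.explode m.dist), IsExploded m.dist B ∧
        ∀ x ∈ B.nodes, x ≠ B.rep → IsNonrep (P'.map Prod.fst) x := by
  induction P' generalizing P with
  | nil => exact ⟨[], rfl, h, by simp⟩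
  | cons p P' ih =>
    obtain ⟨P₁, e1, e2, e3⟩ := Inv.explode (B := p.1) (C := p.2) hd hadj hM h
    obtain ⟨P₂, f1, f2, f3⟩ := ih (P := P₁ ++ P) (e2.perm (by
      change (P₁ ++ (P' ++ P)).Perm (P' ++ (P₁ ++ P))
      rw [← List.append_assoc, ← List.append_assoc]
      exact List.perm_append_comm.append_right P))
    refine ⟨P₁ ++ P₂, ?_, f2.perm ?_, ?_⟩
    · simp only [List.map_append, List.map_cons, List.flatMap_cons, e1, f1]
    · rw [← List.append_assoc]
      exact List.perm_append_comm.append_right P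
    · intro B hB
      simp only [List.map_cons, List.flatMap_cons, List.mem_append] at hB
      rcases hB with hB | hB
      · exact ⟨(e3 B hB).1, fun x hx hxr => ⟨p.1, by simp, (e3 B hB).2 x hx hxr⟩⟩
      · refine ⟨(f3 B hB).1, fun x hx hxr => ?_⟩
        obtain ⟨B', hB', hx'⟩ := (f3 B hB).2 x hx hxr
        exact ⟨B', List.mem_cons_of_mem _ hB', hx'⟩

/-! ### The procedure `bigsplit` -/

/-- Afterwards u is nowhere a non-representative. Parts meet only in their roots, so at most one bag
contains u as a non-representative, and `basic` makes u the representative of its own level. -/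
theorem Inv.splitAt (hd : IsTreeMetric d) (hadj : AdjOfMetric T d)
    (hM : MedianLabelled d (Set.range lab)) {σ : Split L} {P₀ : List (Bag L × Set V)}
    (hP₀ : P₀.map Prod.fst = σ.bags) (h : Inv T d lab N θ (P₀ ++ P) (S ∪ σ.skeleton) σ.mem)
    (u : Node L) :
    ∃ N' θ' P', P'.map Prod.fst = (splitAt σ u).bags ∧
      Extends N θ σ.mem N' θ' (LatentTree.splitAt σ u).mem Set.univ ∧
      Inv T d lab N' θ' (P' ++ P) (S ∪ (LatentTree.splitAt σ u).skeleton)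
        (LatentTree.splitAt σ u).mem ∧
      ∀ x, IsNonrep (LatentTree.splitAt σ u).bags x → IsNonrep σ.bags x ∧ x ≠ u := by
  rcases hfind : σ.bags.find? (fun B => decide (u ∈ B.nodes)) with _ | B
  · have hσ : LatentTree.splitAt σ u = σ := by
      unfold LatentTree.splitAt
      rw [hfind]
    rw [hσ]
    refine ⟨N, θ, P₀, hP₀, Extends.refl _ _ _ _, h, fun x hx => ⟨hx, ?_⟩⟩
    rintro rfl
    obtain ⟨B, hB, hxB, -⟩ := hx
    have := List.find?_eq_none.1 hfind B hB
    simp [hxB] at this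
  · obtain ⟨huB, l₁, l₂, hl, hl₁⟩ := List.find?_eq_some_iff_append.1 hfind
    simp only [decide_eq_true_eq] at huB
    rw [hl] at hP₀
    obtain ⟨Q₁, Q', rfl, hQ₁, hQ'⟩ := List.map_eq_append_iff.1 hP₀
    obtain ⟨⟨B', C⟩, Q₂, rfl, hB', hQ₂⟩ := List.map_eq_cons_iff.1 hQ'
    simp only at hB'
    subst hB'
    have hperm : (Q₁ ++ (B', C) :: Q₂ ++ P).Perm ((B', C) :: (Q₁ ++ Q₂ ++ P)) := by
      rw [List.append_assoc, List.append_assoc]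
      exact List.perm_middle
    have h1 := h.perm hperm
    have hother : ∀ B ∈ l₁ ++ l₂, u ∈ B.nodes → u = B.rep := by
      intro B hB huB₁
      rw [← hQ₁, ← hQ₂, ← List.map_append, List.mem_map] at hB
      obtain ⟨q, hq, rfl⟩ := hB
      have hq' : q ∈ Q₁ ++ Q₂ ++ P := List.mem_append_left _ hq
      have p1 : IsPiece d N θ σ.mem B' C := h1.pieces (B', C) List.mem_cons_self
      have p2 := h1.pieces q (List.mem_cons_of_mem _ hq')
      have := (List.pairwise_cons.1 h1.disjoint).1 q hq' (θ u) (p1.theta_mem huB)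
        (p2.theta_mem huB₁)
      exact h1.naming.inj (p2.subset _ huB₁) (p2.subset _ p2.rep_mem) this.2
    by_cases hrep : u = B'.rep
    · have hσ : LatentTree.splitAt σ u = σ := by
        unfold LatentTree.splitAt
        rw [hfind]
        simp only [if_pos hrep]
      rw [hσ]
      refine ⟨N, θ, _, hP₀.trans hl.symm, Extends.refl _ _ _ _, h, fun x hx => ⟨hx, ?_⟩⟩
      rintro rfl
      obtain ⟨B, hB, hxB, hxr⟩ := hx
      rw [hl] at hB
      rcases List.mem_append.1 hB with hB | hB
      · exact hxr (hother B (List.mem_append_left _ hB) hxB)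
      · rcases List.mem_cons.1 hB with rfl | hB
        · exact hxr hrep
        · exact hxr (hother B (List.mem_append_right _ hB) hxB)
    · have herase : σ.bags.eraseP (fun B => decide (u ∈ B.nodes)) = l₁ ++ l₂ := by
        rw [hl, List.eraseP_append_right, List.eraseP_cons_of_pos]
        · simpa using huB
        · intro b hb
          simpa using hl₁ b hb
      have hσ : LatentTree.splitAt σ u =
          { bags := l₁ ++ l₂ ++ (LatentTree.basic σ.mem B' u).bags
            skeleton := σ.skeleton ∪ (LatentTree.basic σ.mem B' u).skeleton
            mem := (LatentTree.basic σ.mem B' u).mem } := by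
        rw [← herase]
        unfold LatentTree.splitAt
        rw [hfind]
        simp only [if_neg hrep]
      obtain ⟨N', θ', P', e1, e2, e3, e4, e5⟩ := h1.basic hd hadj hM huB
      rw [hσ]
      refine ⟨N', θ', Q₁ ++ Q₂ ++ P', ?_, e2, ?_, ?_⟩
      · simp only [List.map_append, hQ₁, hQ₂, e1]
      · rw [Finset.union_assoc] at e3
        refine e3.perm ?_
        rw [← List.append_assoc]
        exact List.perm_append_comm.append_right P
      · rintro x ⟨B, hB, hxB, hxr⟩
        rw [hl]
        rcases List.mem_append.1 hB with hB₁ | hB₁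
        · refine ⟨⟨B, ?_, hxB, hxr⟩, ?_⟩
          · rcases List.mem_append.1 hB₁ with hB₂ | hB₂ <;> simp [hB₂]
          · rintro rfl
            exact hxr (hother B hB₁ hxB)
        · refine ⟨⟨B', by simp, e4 B hB₁ x hxB hxr⟩, ?_⟩
          rintro rfl
          exact hxr (e5 B hB₁ hxB).symm

theorem Inv.foldl_splitAt (hd : IsTreeMetric d) (hadj : AdjOfMetric T d)
    (hM : MedianLabelled d (Set.range lab)) (us : List (Node L)) {σ : Split L}
    {P₀ : List (Bag L × Set V)} (hP₀ : P₀.map Prod.fst = σ.bags)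
    (h : Inv T d lab N θ (P₀ ++ P) (S ∪ σ.skeleton) σ.mem) :
    ∃ N' θ' P', P'.map Prod.fst = (us.foldl LatentTree.splitAt σ).bags ∧
      Extends N θ σ.mem N' θ' (us.foldl LatentTree.splitAt σ).mem Set.univ ∧
      Inv T d lab N' θ' (P' ++ P) (S ∪ (us.foldl LatentTree.splitAt σ).skeleton)
        (us.foldl LatentTree.splitAt σ).mem ∧
      ∀ x, IsNonrep (us.foldl LatentTree.splitAt σ).bags x → IsNonrep σ.bags x ∧ x ∉ us := by
  induction us generalizing N θ σ P₀ with
  | nil => exact ⟨N, θ, P₀, hP₀, Extends.refl _ _ _ _, h, fun x hx => ⟨hx, by simp⟩⟩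
  | cons u us ih =>
    obtain ⟨N₁, θ₁, P₁, e1, e2, e3, e4⟩ := h.splitAt hd hadj hM hP₀ u
    obtain ⟨N₂, θ₂, P₂, f1, f2, f3, f4⟩ := ih e1 e3
    refine ⟨N₂, θ₂, P₂, f1, e2.trans f2, f3, fun x hx => ?_⟩
    obtain ⟨g1, g2⟩ := f4 x hx
    obtain ⟨g3, g4⟩ := e4 x g1
    exact ⟨g3, by simp [g2, g4]⟩

theorem Inv.bigsplitPass (hd : IsTreeMetric d) (hadj : AdjOfMetric T d)
    (hM : MedianLabelled d (Set.range lab)) (h : Inv T d lab N θ ((B, C) :: P) S m)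
    (us : List (Node L)) :
    ∃ N' θ' P', P'.map Prod.fst = (bigsplitPass m B us).bags ∧
      Extends N θ m N' θ' (LatentTree.bigsplitPass m B us).mem Set.univ ∧
      Inv T d lab N' θ' (P' ++ P) (S ∪ (LatentTree.bigsplitPass m B us).skeleton)
        (LatentTree.bigsplitPass m B us).mem ∧
      ∀ B' ∈ (LatentTree.bigsplitPass m B us).bags,
        IsExploded (LatentTree.bigsplitPass m B us).mem.dist B' ∧
        ∀ x ∈ B'.nodes, x ≠ B'.rep → x ∈ B.nodes ∧ x ≠ B.rep ∧ x ∉ us := by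
  obtain ⟨N₁, θ₁, P₁, e1, e2, e3, e4⟩ := Inv.foldl_splitAt (P₀ := [(B, C)]) (P := P) (S := S)
    (N := N) (θ := θ) (lab := lab) (σ := { bags := [B], skeleton := ∅, mem := m }) hd hadj hM us
    rfl (by simpa using h)
  obtain ⟨P₂, f1, f2, f3⟩ := e3.flatMap_explode hd hadj hM
  rw [e1] at f1 f3
  refine ⟨N₁, θ₁, P₂, f1, e2, f2, fun B' hB' => ⟨(f3 B' hB').1, fun x hx hxr => ?_⟩⟩
  obtain ⟨⟨B'', hB'', h1, h2⟩, h3⟩ := e4 x ((f3 B' hB').2 x hx hxr)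
  rw [List.mem_singleton] at hB''
  subst hB''
  exact ⟨h1, h2, h3⟩

end Passes

/-! ### The full skeleton of a small bag -/

section Finish

variable {V L : Type*} [DecidableEq L] {d : V → V → ℝ} {lab : L → V}
  {N N' : Set (Node L)} {θ θ' : Node L → V} {m m' : Memory L}
  {B : Bag L} {C : Set V} {T : SimpleGraph V} {P : List (Bag L × Set V)}
  {S S' : Finset (Sym2 (Node L))}

theorem lt_latentBound {e : Sym2 (Node L)} (he : e ∈ S) {k : ℕ} (hk : Sum.inr k ∈ e) :
    k < latentBound S := by
  have h1 : e.toFinset.sup (Sum.elim (fun _ => 0) (fun k => k + 1)) ≤ latentBound S :=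
    Finset.le_sup (f := fun e : Sym2 (Node L) =>
      e.toFinset.sup (Sum.elim (fun _ => 0) (fun k => k + 1))) he
  have h2 : k + 1 ≤ e.toFinset.sup (Sum.elim (fun _ : L => 0) (fun k => k + 1)) :=
    Finset.le_sup (f := Sum.elim (fun _ : L => 0) (fun k => k + 1)) (Sym2.mem_toFinset.2 hk)
  omega

omit [DecidableEq L] in
theorem finite_skeletonVerts (B : Finset (Node L)) (S : Finset (Sym2 (Node L))) :
    (skeletonVerts B S).Finite := by
  have : skeletonVerts B S = (B : Set (Node L)) ∪ ⋃ e ∈ S, {x | x ∈ e} := by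
    ext x
    simp [skeletonVerts]
  rw [this]
  refine B.finite_toSet.union (S.finite_toSet.biUnion fun e _ => ?_)
  induction e with
  | _ a b =>
    have : {x | x ∈ s(a, b)} = {a, b} := by
      ext x
      simp
    rw [this]
    exact Set.toFinite _

omit [DecidableEq L] in
theorem skeletonGraph_adj {K : Finset (Node L)} {x y : skeletonVerts K S} :
    (skeletonGraph K S).Adj x y ↔ s(x.1, y.1) ∈ S ∧ x.1 ≠ y.1 := by
  simp [skeletonGraph]

omit [DecidableEq L] in
/-- A neighbour of a vertex of a piece other than the root belongs to the piece. -/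
theorem IsPiece.adj_mem (hadj : AdjOfMetric T d) (hp : IsPiece d N θ m B C) {a b : V} (ha : a ∈ C)
    (har : a ≠ θ B.rep) (hab : T.Adj a b) : b ∈ C := by
  by_contra hb
  rcases ((hadj a b).1 hab).2 _ (hp.closed a ha b hb) with e | e
  · exact har e.symm
  · exact hb (e ▸ hp.root_mem)

/-- Copy the subtree on C: vertices of bag nodes keep their names, the others get unused numbers. An
unnamed vertex is latent and not the root, so all its neighbours lie in C and its degree stays above
two. -/
theorem exists_isFullSkeleton [Finite V] (hT : IsSemiLabelledTree T (Set.range lab))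
    {len : Sym2 V → ℝ} (hlen : ∀ e ∈ T.edgeSet, 0 < len e) (hsum : IsPathSum T len d)
    (hn : IsNaming lab N θ m) (hp : IsPiece d N θ m B C) : ∃ S, IsFullSkeleton m B.nodes S := by
  have hd := hsum.isTreeMetric hT.isTree hlen
  have hadj := hsum.adjOfMetric hT.isTree hlen
  obtain ⟨n, ⟨code⟩⟩ := Finite.exists_equiv_fin V
  have hψ : ∀ v, ∃ x : Node L, (x ∈ B.nodes ∧ θ x = v) ∨
      ((∀ b ∈ B.nodes, θ b ≠ v) ∧ x = Sum.inr (m.fresh + code v)) := by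
    intro v
    by_cases hv : ∃ b ∈ B.nodes, θ b = v
    · obtain ⟨b, hb⟩ := hv
      exact ⟨b, Or.inl hb⟩
    · push Not at hv
      exact ⟨_, Or.inr ⟨hv, rfl⟩⟩
  choose ψ hψ using hψ
  have hfresh : ∀ k, (Sum.inr (m.fresh + k) : Node L) ∉ B.nodes := by
    intro k hk
    have := hn.fresh_lt _ (hp.subset _ hk)
    omega
  have hψinj : Function.Injective ψ := by
    intro v w hvw
    rcases hψ v with ⟨h1, h2⟩ | ⟨h1, h2⟩ <;> rcases hψ w with ⟨h3, h4⟩ | ⟨h3, h4⟩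
    · rw [← h2, ← h4, hvw]
    · rw [hvw, h4] at h1
      exact absurd h1 (hfresh _)
    · rw [← hvw, h2] at h3
      exact absurd h3 (hfresh _)
    · rw [h2, h4, Sum.inr.injEq] at hvw
      apply code.injective
      apply Fin.ext
      omega
  have hψθ : ∀ b ∈ B.nodes, ψ (θ b) = b := by
    intro b hb
    rcases hψ (θ b) with ⟨h1, h2⟩ | ⟨h1, -⟩
    · exact hn.inj (hp.subset _ h1) (hp.subset _ hb) h2
    · exact absurd rfl (h1 b hb)
  let E : Set (Sym2 (Node L)) := Sym2.map ψ '' {e | e ∈ T.edgeSet ∧ ∀ v ∈ e, v ∈ C}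
  have hE : E.Finite := (Set.toFinite _).image _
  have hES : ∀ a b, s(ψ a, ψ b) ∈ hE.toFinset ↔ T.Adj a b ∧ a ∈ C ∧ b ∈ C := by
    intro a b
    rw [Set.Finite.mem_toFinset, ← Sym2.map_mk, Set.InjOn.mem_image_iff
      (Sym2.map.injective hψinj).injOn (Set.subset_univ _) (Set.mem_univ _)]
    change s(a, b) ∈ T.edgeSet ∧ (∀ v ∈ s(a, b), v ∈ C) ↔ _
    simp
  set F := hE.toFinset with hF
  have hEC : ∀ e ∈ F, ∃ a b, e = s(ψ a, ψ b) := by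
    intro e he
    rw [hF, Set.Finite.mem_toFinset] at he
    obtain ⟨e', -, rfl⟩ := he
    induction e' with
    | _ a b => exact ⟨a, b, Sym2.map_mk ..⟩
  have hdeg : ∀ v ∈ C, v ∉ Set.range lab → v ≠ θ B.rep →
      2 < (T.neighborSet v).ncard := fun v _ hv _ =>
    not_le.1 fun h => hv (hT.mem_of_degree_le_two v h)
  have hlatent : ∀ v ∈ C, ψ v ∉ B.nodes → v ∉ Set.range lab ∧ v ≠ θ B.rep := by
    intro v hv hvB
    have : ∀ b ∈ B.nodes, v ≠ θ b := by
      rintro b hb rfl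
      exact hvB ((hψθ b hb).symm ▸ hb)
    refine ⟨?_, this _ hp.rep_mem⟩
    rintro ⟨i, rfl⟩
    refine this (Sum.inl i) ((hp.mem_iff _ (hn.inl_mem i)).2 ?_) (hn.inl_eq i).symm
    rwa [hn.inl_eq]
  have hverts : ∀ x, x ∈ skeletonVerts B.nodes F ↔ ∃ v ∈ C, ψ v = x := by
    intro x
    constructor
    · rintro (hx | ⟨e, he, hx⟩)
      · exact ⟨θ x, hp.theta_mem hx, hψθ x hx⟩
      · obtain ⟨a, b, rfl⟩ := hEC e he
        obtain ⟨-, ha, hb⟩ := (hES a b).1 he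
        rcases Sym2.mem_iff.1 hx with rfl | rfl
        exacts [⟨a, ha, rfl⟩, ⟨b, hb, rfl⟩]
    · rintro ⟨v, hv, rfl⟩
      by_cases hvB : ψ v ∈ B.nodes
      · exact Or.inl hvB
      · obtain ⟨h1, h2⟩ := hlatent v hv hvB
        have h3 := hdeg v hv h1 h2
        obtain ⟨w, hw⟩ : (T.neighborSet v).Nonempty := by
          rw [← Set.ncard_pos]
          omega
        exact Or.inr ⟨_, (hES v w).2 ⟨hw, hv, hp.adj_mem hadj hv h2 hw⟩, Sym2.mem_mk_left _ _⟩
  choose g hgC hg using fun x : skeletonVerts B.nodes F => (hverts x.1).1 x.2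
  have hginj : Function.Injective g := by
    intro x y hxy
    apply Subtype.ext
    rw [← hg x, ← hg y, hxy]
  have hgψ : ∀ v (hv : v ∈ C), g ⟨ψ v, (hverts _).2 ⟨v, hv, rfl⟩⟩ = v := fun v hv =>
    hψinj (hg _)
  have hgadj : ∀ x y, (skeletonGraph B.nodes F).Adj x y ↔ T.Adj (g x) (g y) := by
    intro x y
    rw [skeletonGraph_adj, ← hg x, ← hg y, hES]
    constructor
    · exact fun h => h.1.1
    · exact fun h => ⟨⟨h, hgC x, hgC y⟩, fun e => h.ne (hψinj e)⟩
  have hgB : ∀ x : skeletonVerts B.nodes F, x.1 ∈ B.nodes → g x = θ x.1 := by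
    intro x hx
    apply hψinj
    rw [hg, hψθ _ hx]
  let f : skeletonGraph B.nodes F →g T := ⟨g, fun {x y} h => (hgadj x y).1 h⟩
  -- Paths between vertices of the part stay in it by convexity, so the copy is connected.
  have hreach : ∀ a b (p : T.Walk a b), (∀ v ∈ p.support, v ∈ C) → ∀ x y, g x = a → g y = b →
      (skeletonGraph B.nodes F).Reachable x y := by
    intro a b p
    induction p with
    | nil =>
      intro _ x y hx hy
      rw [hginj (hx.trans hy.symm)]
    | @cons a c b h q ih =>
      intro hs x y hx hy
      have hcC : c ∈ C := hs c (by simp)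
      have hxc : (skeletonGraph B.nodes F).Adj x ⟨ψ c, (hverts _).2 ⟨c, hcC, rfl⟩⟩ := by
        rw [hgadj, hgψ c hcC, hx]
        exact h
      exact hxc.reachable.trans (ih (fun v hv => hs v (by simp [hv])) _ y (hgψ c hcC) hy)
  have hne : Nonempty (skeletonVerts B.nodes F) := ⟨⟨B.rep, Or.inl hp.rep_mem⟩⟩
  refine ⟨F, ?_, ?_, ⟨⟨⟨?_⟩, hT.isTree.isAcyclic.comap f hginj⟩, ?_⟩, ?_⟩
  · intro e he
    obtain ⟨a, b, rfl⟩ := hEC e he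
    rw [Sym2.mk_isDiag_iff]
    exact fun h => ((hES a b).1 he).1.ne (hψinj h)
  · intro x hx
    obtain ⟨v, -, rfl⟩ := (hverts x).1 hx
    rcases hψ v with ⟨h1, -⟩ | ⟨-, h2⟩
    · exact Or.inl h1
    · exact Or.inr ⟨_, Nat.le_add_right _ _, h2⟩
  · intro x y
    obtain ⟨p, hpp, -⟩ := hT.isTree.existsUnique_path (g x) (g y)
    refine hreach _ _ p (fun v hv => ?_) x y rfl rfl
    exact hp.convex hd (hgC x) (hgC y) (hsum.btw_of_onPath ⟨p, hpp, hv⟩)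
  · intro x hx
    by_contra hxB
    obtain ⟨h1, h2⟩ := hlatent (g x) (hgC x) (by rw [hg]; exact hxB)
    have h3 := hdeg (g x) (hgC x) h1 h2
    have h4 : T.neighborSet (g x) = g '' (skeletonGraph B.nodes F).neighborSet x := by
      ext w
      constructor
      · intro hw
        have hwC := hp.adj_mem hadj (hgC x) h2 hw
        refine ⟨_, ?_, hgψ w hwC⟩
        rw [SimpleGraph.mem_neighborSet, hgadj, hgψ w hwC]
        exact hw
      · rintro ⟨y, hy, rfl⟩
        exact (hgadj x y).1 hy
    rw [h4, Set.ncard_image_of_injective _ hginj] at h3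
    omega
  · refine ⟨fun e => len (Sym2.map g e), ?_, ?_⟩
    · intro e he
      induction e with
      | _ x y => exact hlen _ ((hgadj x y).1 he)
    · intro x hx y hy p hpp
      have h1 := hsum _ _ (p.map f) (hpp.map hginj)
      rw [SimpleGraph.Walk.edges_map, List.map_map] at h1
      simp only
      rw [hp.dist_eq _ hx _ hy, ← hgB x hx, ← hgB y hy]
      exact h1

/-- No choice of skeleton matters. Both it and the part are tree metrics in which every vertex is a
median of bag nodes, with the same distances between these, so they are isometric; an isometry
preserves adjacency. -/
theorem Inv.of_isFullSkeleton (hd : IsTreeMetric d) (hadj : AdjOfMetric T d)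
    (hM : MedianLabelled d (Set.range lab)) (h : Inv T d lab N θ ((B, C) :: P) S m)
    (hS' : IsFullSkeleton m B.nodes S') :
    ∃ N' θ', Inv T d lab N' θ' P (S ∪ S')
      { dist := m.dist, fresh := max m.fresh (latentBound S') } := by
  classical
  have hp : IsPiece d N θ m B C := h.pieces (B, C) List.mem_cons_self
  have hn := h.naming
  set X := skeletonVerts B.nodes S' with hX
  set G := skeletonGraph B.nodes S' with hG
  have hfin : Finite X := finite_skeletonVerts _ _
  have hGt : G.IsTree := hS'.isSemiLabelledTree.isTree
  obtain ⟨len, hlen, hreal⟩ := hS'.realizes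
  obtain ⟨dX, hdX⟩ := exists_isPathSum hGt len
  have htX := hdX.isTreeMetric hGt hlen
  have haX := hdX.adjOfMetric hGt hlen
  have hMX := medianLabelled_of_isSemiLabelledTree htX haX
    hS'.isSemiLabelledTree.mem_of_degree_le_two
  let dC : C → C → ℝ := fun x y => d x.1 y.1
  have htC : IsTreeMetric dC :=
    { self := fun x => hd.self _
      pos := fun x y hxy => hd.pos _ _ fun e => hxy (Subtype.ext e)
      symm := fun x y => hd.symm _ _
      median := fun x y z => by
        obtain ⟨n, h1, h2, h3⟩ := hd.median x.1 y.1 z.1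
        exact ⟨⟨n, hp.convex hd x.2 y.2 h1⟩, h1, h2, h3⟩
      branch := fun x n z hb y => hd.branch x.1 n.1 z.1 hb y.1 }
  let a : B.nodes → X := fun x => ⟨x.1, Or.inl x.2⟩
  let b : B.nodes → C := fun x => ⟨θ x.1, hp.theta_mem x.2⟩
  have hra : Set.range a = {x | x.1 ∈ B.nodes} := by
    ext x
    constructor
    · rintro ⟨y, rfl⟩
      exact y.2
    · intro hx
      exact ⟨⟨x.1, hx⟩, rfl⟩
  have hMC : MedianLabelled dC (Set.range b) := by
    intro v
    obtain ⟨i, hi, j, hj, k, hk, h1, h2, h3⟩ := hp.median hd hM hn v.2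
    exact ⟨_, ⟨⟨i, hi⟩, rfl⟩, _, ⟨⟨j, hj⟩, rfl⟩, _, ⟨⟨k, hk⟩, rfl⟩, h1, h2, h3⟩
  have hab : ∀ i j, dX (a i) (a j) = dC (b i) (b j) := by
    intro i j
    obtain ⟨p, hpp, -⟩ := hGt.existsUnique_path (a i) (a j)
    rw [hdX _ _ p hpp, ← hreal _ i.2 _ j.2 p hpp]
    exact hp.dist_eq _ i.2 _ j.2
  obtain ⟨e, he, heiso⟩ := exists_isometry htX htC a b (hra ▸ hMX) hMC hab
  have headj : ∀ x y, G.Adj x y ↔ T.Adj (e x).1 (e y).1 := by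
    intro x y
    rw [haX, hadj]
    constructor
    · rintro ⟨h1, h2⟩
      refine ⟨fun hc => h1 (e.injective (Subtype.ext hc)), fun z hz => ?_⟩
      have hzC := hp.convex hd (e x).2 (e y).2 hz
      have hz' := e.apply_symm_apply ⟨z, hzC⟩
      rcases h2 (e.symm ⟨z, hzC⟩) (by
        unfold Btw
        rw [← heiso, ← heiso, ← heiso, hz']
        exact hz) with h3 | h3
      · left
        rw [← h3, hz']
      · right
        rw [← h3, hz']
    · rintro ⟨h1, h2⟩
      refine ⟨fun hc => h1 (by rw [hc]), fun z hz => ?_⟩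
      rcases h2 (e z).1 (by
        unfold Btw at hz
        rw [← heiso, ← heiso, ← heiso] at hz
        exact hz) with h3 | h3
      · exact Or.inl (e.injective (Subtype.ext h3))
      · exact Or.inr (e.injective (Subtype.ext h3))
  have hNX : ∀ x ∈ N, x ∈ X → x ∈ B.nodes := by
    intro x hx hxX
    rcases hS'.mem_or_new x hxX with h' | ⟨k, hk, rfl⟩
    · exact h'
    · exact absurd (hn.fresh_lt k hx) (not_lt.2 hk)
  -- Only vertices without a name so far are named through the isometry; on nodes of the bag it
  -- agrees with θ anyway.
  let θ' : Node L → V := fun x => if hx : x ∈ X ∧ x ∉ N then (e ⟨x, hx.1⟩).1 else θ x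
  have hθN : ∀ x ∈ N, θ' x = θ x := fun x hx => dif_neg fun h' => h'.2 hx
  have hθX : ∀ x : X, θ' x.1 = (e x).1 := by
    intro x
    by_cases hxN : x.1 ∈ N
    · rw [hθN _ hxN]
      have := he ⟨x.1, hNX _ hxN x.2⟩
      exact (congrArg Subtype.val this).symm
    · exact dif_pos ⟨x.2, hxN⟩
  -- A previously named node at a vertex of C belongs to the bag, so two names for one vertex cannot
  -- arise.
  have hold : ∀ x ∈ N, ∀ y : X, θ' x = θ' y.1 → x = y.1 := by
    intro x hx y hxy
    have hxB : x ∈ B.nodes := by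
      rw [hp.mem_iff x hx, ← hθN x hx, hxy, hθX]
      exact (e y).2
    have := hθX ⟨x, Or.inl hxB⟩
    simp only at this
    rw [this, hθX] at hxy
    exact congrArg Subtype.val (e.injective (Subtype.ext hxy))
  have hext : Extends N θ m (N ∪ X) θ'
      { dist := m.dist, fresh := max m.fresh (latentBound S') } (C \ {θ B.rep}) := by
    refine ⟨fun x hx => Or.inl hx, hθN, fun _ _ _ _ => rfl, ?_⟩
    rintro x (hx | hx) hxN
    · exact absurd hx hxN
    · have hx' := hθX ⟨x, hx⟩
      simp only at hx'
      refine ⟨hx' ▸ (e _).2, fun hc => ?_⟩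
      have hrN := hp.subset _ hp.rep_mem
      have := hold _ hrN ⟨x, hx⟩ (by rw [hθN _ hrN]; exact hc.symm)
      exact hxN ((show B.rep = x from this) ▸ hrN)
  have hname : IsNaming lab (N ∪ X) θ'
      { dist := m.dist, fresh := max m.fresh (latentBound S') } := by
    refine ⟨fun i => Or.inl (hn.inl_mem i), fun i => ?_, ?_, ?_, ?_⟩
    · rw [hθN _ (hn.inl_mem i), hn.inl_eq]
    · rintro x (hx | hx) y (hy | hy) hxy
      · rw [hθN x hx, hθN y hy] at hxy
        exact hn.inj hx hy hxy
      · exact hold x hx ⟨y, hy⟩ hxy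
      · exact (hold y hy ⟨x, hx⟩ hxy.symm).symm
      · have h1 := hθX ⟨x, hx⟩
        have h2 := hθX ⟨y, hy⟩
        simp only at h1 h2
        rw [h1, h2] at hxy
        exact congrArg Subtype.val (e.injective (Subtype.ext hxy))
    · intro k hk
      rw [lt_max_iff]
      rcases hk with hk | hk | ⟨e, he, hk⟩
      · exact Or.inl (hn.fresh_lt k hk)
      · exact Or.inl (hn.fresh_lt k (hp.subset _ hk))
      · exact Or.inr (lt_latentBound he hk)
    · intro k hk
      exact hn.dist_new k ((le_max_left _ _).trans hk)
  have hmemX : ∀ e ∈ S', ∀ x ∈ e, x ∈ X := fun e he x hx => Or.inr ⟨e, he, hx⟩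
  refine ⟨N ∪ X, θ', h.replace (P' := []) (S' := S') hname hext (by simp) (by simp) (by simp)
    (by simp) (fun e he x hx => Or.inr (hmemX e he x hx)) ?_ ?_⟩
  · intro x y hxy
    have hx := hmemX _ hxy x (Sym2.mem_mk_left x y)
    have hy := hmemX _ hxy y (Sym2.mem_mk_right x y)
    have h1 := hθX ⟨x, hx⟩
    have h2 := hθX ⟨y, hy⟩
    simp only at h1 h2
    rw [h1, h2, ← headj, hG, skeletonGraph_adj]
    exact ⟨hxy, fun hc => hS'.not_isDiag _ hxy (Sym2.mk_isDiag_iff.2 hc)⟩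
  · intro v hv w hw hvw
    left
    have h1 := e.apply_symm_apply ⟨v, hv⟩
    have h2 := e.apply_symm_apply ⟨w, hw⟩
    have h3 : G.Adj (e.symm ⟨v, hv⟩) (e.symm ⟨w, hw⟩) := by
      rw [headj, h1, h2]
      exact hvw
    rw [hG, skeletonGraph_adj] at h3
    exact ⟨_, _, h3.1, by rw [hθX, h1], by rw [hθX, h2]⟩

theorem Inv.finish [Finite V] (hT : IsSemiLabelledTree T (Set.range lab))
    {len : Sym2 V → ℝ} (hlen : ∀ e ∈ T.edgeSet, 0 < len e) (hsum : IsPathSum T len d)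
    (h : Inv T d lab N θ ((B, C) :: P) S m) :
    ∃ N' θ', Inv T d lab N' θ' P (S ∪ fullSkeleton m B.nodes)
      { dist := m.dist, fresh := max m.fresh (latentBound (fullSkeleton m B.nodes)) } := by
  have hd := hsum.isTreeMetric hT.isTree hlen
  have hadj := hsum.adjOfMetric hT.isTree hlen
  have hex := exists_isFullSkeleton hT hlen hsum h.naming (h.pieces (B, C) List.mem_cons_self)
  apply h.of_isFullSkeleton hd hadj
    (medianLabelled_of_isSemiLabelledTree hd hadj hT.mem_of_degree_le_two)
  unfold fullSkeleton
  rw [dif_pos hex]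
  exact hex.choose_spec

end Finish

/-! ### Good samples -/

/-- One point from each minimal member suffices. Minimal members of a laminar family are disjoint
and have at least s elements each, so fewer than k + 1 of them fit into A. -/
theorem exists_hitting_set {α : Type*} [DecidableEq α] (A : Finset α) (F : Finset (Finset α))
    (hlam : ∀ X ∈ F, ∀ Y ∈ F, X ⊆ Y ∨ Y ⊆ X ∨ Disjoint X Y) (hsub : ∀ X ∈ F, X ⊆ A) {s k : ℕ}
    (hs : ∀ X ∈ F, s ≤ X.card) (hk : A.card < s * (k + 1)) :
    ∃ H ⊆ A, H.card ≤ k ∧ ∀ X ∈ F, ∃ x ∈ X, x ∈ H := by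
  have hs0 : 0 < s := Nat.pos_of_mul_pos_right (Nat.zero_lt_of_lt hk)
  have hpt : ∀ X : F, ∃ x, x ∈ X.1 := fun X => Finset.card_pos.1 (hs0.trans_le (hs X.1 X.2))
  choose f hf using hpt
  let M := F.attach.filter (fun X => ∀ Y ∈ F, Y ⊆ X.1 → Y = X.1)
  have hM : ∀ X ∈ M, ∀ Y ∈ F, Y ⊆ X.1 → Y = X.1 := fun X hX => (Finset.mem_filter.1 hX).2
  refine ⟨M.image f, ?_, Finset.card_image_le.trans ?_, ?_⟩
  · intro x hx
    obtain ⟨X, -, rfl⟩ := Finset.mem_image.1 hx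
    exact hsub X.1 X.2 (hf X)
  · have hdisj : (M : Set F).PairwiseDisjoint (fun X => X.1) := by
      intro X hX Y hY hXY
      rcases hlam X.1 X.2 Y.1 Y.2 with h | h | h
      · exact absurd (Subtype.ext (hM Y hY X.1 X.2 h)) hXY
      · exact absurd (Subtype.ext (hM X hX Y.1 Y.2 h)).symm hXY
      · exact h
    have h1 : (M.biUnion fun X => X.1).card ≤ A.card := by
      apply Finset.card_le_card
      rw [Finset.biUnion_subset]
      exact fun X _ => hsub X.1 X.2
    rw [Finset.card_biUnion hdisj] at h1
    have h2 : M.card * s ≤ ∑ X ∈ M, X.1.card := by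
      rw [← smul_eq_mul]
      exact Finset.card_nsmul_le_sum _ _ _ fun X _ => hs X.1 X.2
    have h3 : s * M.card < s * (k + 1) := by
      rw [mul_comm]
      omega
    exact Nat.lt_succ_iff.1 (Nat.lt_of_mul_lt_mul_left h3)
  · intro X hX
    obtain ⟨Y, hY, hmin⟩ := Finset.exists_min_image (F.filter (· ⊆ X)) Finset.card
      ⟨X, Finset.mem_filter.2 ⟨hX, subset_rfl⟩⟩
    rw [Finset.mem_filter] at hY
    refine ⟨f ⟨Y, hY.1⟩, hY.2 (hf _), Finset.mem_image_of_mem _ ?_⟩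
    refine Finset.mem_filter.2 ⟨Finset.mem_attach _ _, fun Z hZ hZY => ?_⟩
    exact Finset.eq_of_subset_of_card_le hZY
      (hmin Z (Finset.mem_filter.2 ⟨hZ, hZY.trans hY.2⟩))

/-- With s the floor, s ≥ 1 and n < (s + 1)√k ≤ 2s√k ≤ s(k + 1). -/
theorem lt_floor_mul {n k : ℕ} (hk : 0 < k) (hn : k < n) :
    n ≤ ⌊(n : ℝ) / √(k : ℝ)⌋₊ * (k + 1) := by
  have hk' : (1 : ℝ) ≤ k := by exact_mod_cast hk
  have hsq := Real.sq_sqrt (show (0 : ℝ) ≤ k by positivity)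
  have hpos : 0 < √(k : ℝ) := Real.sqrt_pos.2 (by linarith)
  have hle : √(k : ℝ) ≤ n := by
    have h1 : √(k : ℝ) ≤ k := Real.sqrt_le_iff.2 ⟨by linarith, by nlinarith⟩
    have h2 : (k : ℝ) ≤ n := by exact_mod_cast hn.le
    linarith
  set s := ⌊(n : ℝ) / √(k : ℝ)⌋₊ with hs
  have h1 : 1 ≤ s := Nat.le_floor (by rw [Nat.cast_one, le_div_iff₀ hpos]; linarith)
  have h2 : (n : ℝ) / √(k : ℝ) < s + 1 := Nat.lt_floor_add_one _
  rw [div_lt_iff₀ hpos] at h2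
  have h1' : (1 : ℝ) ≤ s := by exact_mod_cast h1
  have : (n : ℝ) ≤ s * (k + 1) := by nlinarith [sq_nonneg (√(k : ℝ) - 1)]
  exact_mod_cast this

section Sample

variable {V L : Type*} [DecidableEq L] {d : V → V → ℝ} {lab : L → V}
  {N N' : Set (Node L)} {θ θ' : Node L → V} {m m' : Memory L}
  {B : Bag L} {C : Set V} {T : SimpleGraph V} {P : List (Bag L × Set V)}
  {S S' : Finset (Sym2 (Node L))}

omit [DecidableEq L] in
/-- The nodes of an exploded bag other than its representative are those that some vertex `v`
separates from `ρ`. -/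
theorem IsPiece.exists_separator [Finite V] (hd : IsTreeMetric d)
    (hM : MedianLabelled d (Set.range lab)) (hn : IsNaming lab N θ m) (hp : IsPiece d N θ m B C)
    (hexp : IsExploded m.dist B) {ρ : Node L} (hρN : ρ ∈ N) (hρ : ρ ∈ B.nodes → ρ = B.rep) :
    ∃ v, (∀ x ∈ B.nodes, x ≠ B.rep → Btw d (θ ρ) v (θ x)) ∧
      ∀ x ∈ N, Btw d (θ ρ) v (θ x) → x ∈ B.nodes ∧ x ≠ B.rep := by
  obtain ⟨u, hu, hur, hexp⟩ := hexp
  set r := θ B.rep with hr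
  have hinj : ∀ x ∈ B.nodes, x ≠ B.rep → θ x ≠ r := fun x hx hxr e =>
    hxr (hn.inj (hp.subset x hx) (hp.subset _ hp.rep_mem) e)
  -- The nodes of the bag lie on a single branch at the root; so does every vertex y, because there
  -- is a node beyond it.
  have hside : ∀ y ∈ C, y ≠ r → ¬ Btw d (θ u) r y := by
    intro y hy hyr hb
    obtain ⟨x, hx, hxy⟩ := hp.exists_node_beyond hd hM hn hy r
    have hxr : x ≠ B.rep := by
      rintro rfl
      exact hyr (hd.btw_self hxy)
    have h1 := (hp.dist_lt_iff hd hu hx).1 (hexp x hx hxr)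
    rcases hd.branch _ _ _ hb (θ x) with h2 | h2
    · exact h1 h2
    · exact hyr (hd.btw_antisymm h2 (hd.btw_comm hxy)).symm
  -- The separator is the vertex of the part closest to the root: on a single branch, the median of
  -- r, v and y is not r, hence it is v.
  obtain ⟨v, ⟨hvC, hvr⟩, hmin⟩ := Set.exists_min_image {y | y ∈ C ∧ y ≠ r} (d r)
    (Set.toFinite _) ⟨θ u, hp.theta_mem hu, hinj u hu hur⟩
  have hv : ∀ y ∈ C, y ≠ r → Btw d r v y := by
    intro y hy hyr
    obtain ⟨n, h1, h2, h3⟩ := hd.median r v y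
    have hnr : n ≠ r := by
      rintro rfl
      rcases hd.branch _ _ _ h2 (θ u) with h4 | h4
      · exact hside v hvC hvr (hd.btw_comm h4)
      · exact hside y hy hyr h4
    have h5 := hmin n ⟨hp.convex hd hp.root_mem hvC h1, hnr⟩
    have h6 : n = v := by
      apply hd.eq_of_le_zero
      unfold Btw at h1
      linarith
    exact h6 ▸ h3
  have hroot : ∀ y ∈ C, Btw d (θ ρ) r y := by
    intro y hy
    by_cases hC : θ ρ ∈ C
    · rw [hρ ((hp.mem_iff ρ hρN).2 hC)]
      exact hd.btw_left _ _
    · exact hd.btw_comm (hp.closed y hy _ hC)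
  refine ⟨v, fun x hx hxr => ?_, fun x hx hb => ?_⟩
  · have hxC := hp.theta_mem hx
    exact (hd.btw_trans' (hv _ hxC (hinj x hx hxr)) (hroot _ hxC)).1
  · have hxC : θ x ∈ C := by
      by_contra hc
      have h1 := hp.closed v hvC _ hc
      have h2 := (hd.btw_trans (hroot v hvC) hb).2
      exact hvr (hd.btw_antisymm (hd.btw_comm h2) (hd.btw_comm h1))
    refine ⟨(hp.mem_iff x hx).2 hxC, ?_⟩
    rintro rfl
    exact hvr (hd.btw_antisymm hb (hroot v hvC))

omit [DecidableEq L] in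
theorem maxBagSize_le {l : List (Bag L)} {c : ℝ} (hc : 0 ≤ c)
    (h : ∀ B ∈ l, (B.nodes.card : ℝ) ≤ c) : (maxBagSize l : ℝ) ≤ c := by
  induction l with
  | nil => simpa [maxBagSize] using hc
  | cons B l ih =>
    have h1 := ih fun B' hB' => h B' (List.mem_cons_of_mem _ hB')
    have h2 := h B List.mem_cons_self
    unfold maxBagSize at h1 ⊢
    simp only [List.map_cons, List.foldr_cons, Nat.cast_max]
    exact max_le h2 h1

/-- Sample a set that meets every set `sub v` with at least s elements. A resulting bag minus its
representative lies in some `sub v` all of whose nodes are non-representatives of that bag. Sampled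
nodes are not, so this `sub v` is small. -/
theorem Inv.exists_good_sample [Finite V] (hd : IsTreeMetric d) (hadj : AdjOfMetric T d)
    (hM : MedianLabelled d (Set.range lab)) (h : Inv T d lab N θ ((B, C) :: P) S m) {Δ : ℕ}
    (hΔ : ¬ B.nodes.card ≤ Δ) (h0 : Δ = 0 → B.nodes.erase B.rep = ∅) :
    ∃ u : Fin Δ ↪ {v // v ∈ B.nodes.erase B.rep},
      (maxBagSize (LatentTree.bigsplitPass m B (List.ofFn fun i => (u i : Node L))).bags : ℝ) ≤
        (B.nodes.card : ℝ) / √(Δ : ℝ) := by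
  classical
  have hp : IsPiece d N θ m B C := h.pieces (B, C) List.mem_cons_self
  set A := B.nodes.erase B.rep with hA
  have hAcard : A.card + 1 = B.nodes.card := Finset.card_erase_add_one hp.rep_mem
  -- For Δ = 0 there are no bags left, so the bound holds although the right-hand side is a division
  -- by 0.
  rcases Nat.eq_zero_or_pos Δ with rfl | hpos
  · obtain ⟨u⟩ := nonempty_samples hΔ
    refine ⟨u, maxBagSize_le (by positivity) fun B' hB' => ?_⟩
    obtain ⟨N', θ', P', e1, e2, e3, e4⟩ := h.bigsplitPass hd hadj hM
      (List.ofFn fun i => (u i : Node L))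
    obtain ⟨⟨x, hx, hxr, -⟩, h2⟩ := e4 B' hB'
    obtain ⟨h3, h4, -⟩ := h2 x hx hxr
    have : x ∈ A := Finset.mem_erase.2 ⟨h4, h3⟩
    rw [h0 rfl] at this
    exact absurd this (Finset.notMem_empty x)
  set s := ⌊(B.nodes.card : ℝ) / √(Δ : ℝ)⌋₊ with hs
  -- Leaving out the representative makes the inequality strict.
  have hlarge : A.card < s * (Δ + 1) :=
    lt_of_lt_of_le (by omega) (lt_floor_mul hpos (not_le.1 hΔ))
  have := Fintype.ofFinite V
  let sub : V → Finset (Node L) := fun v => A.filter fun x => Btw d (θ B.rep) v (θ x)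
  obtain ⟨H, hHA, hHk, hhit⟩ := exists_hitting_set A
    ((Finset.univ.image sub).filter fun X => s ≤ X.card) (by
      intro X hX Y hY
      obtain ⟨v, -, rfl⟩ := Finset.mem_image.1 (Finset.mem_filter.1 hX).1
      obtain ⟨w, -, rfl⟩ := Finset.mem_image.1 (Finset.mem_filter.1 hY).1
      by_cases hdisj : Disjoint (sub v) (sub w)
      · exact Or.inr (Or.inr hdisj)
      obtain ⟨x, hxv, hxw⟩ := Finset.not_disjoint_iff.1 hdisj
      have key : ∀ v w, Btw d (θ B.rep) v w → sub w ⊆ sub v := by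
        intro v w hvw y hy
        obtain ⟨hyA, hy⟩ := Finset.mem_filter.1 hy
        exact Finset.mem_filter.2 ⟨hyA, (hd.btw_trans hvw hy).1⟩
      rcases hd.btw_total (Finset.mem_filter.1 hxv).2 (Finset.mem_filter.1 hxw).2 with h' | h'
      · exact Or.inr (Or.inl (key v w h'))
      · exact Or.inl (key w v h'))
    (by
      intro X hX
      obtain ⟨v, -, rfl⟩ := Finset.mem_image.1 (Finset.mem_filter.1 hX).1
      exact Finset.filter_subset _ _)
    (fun X hX => (Finset.mem_filter.1 hX).2) hlarge
  -- A sample has exactly Δ nodes, so the hitting set is filled up.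
  obtain ⟨H', hHH', hH'A, hH'⟩ := Finset.exists_subsuperset_card_eq hHA hHk
    (by omega : Δ ≤ A.card)
  let e := (H'.equivFinOfCardEq hH').symm
  let u : Fin Δ ↪ {v // v ∈ A} :=
    ⟨fun i => ⟨(e i).1, hH'A (e i).2⟩, fun i j hij =>
      e.injective (Subtype.ext (Subtype.mk.inj hij))⟩
  have hu : ∀ x ∈ H', x ∈ List.ofFn fun i => (u i : Node L) := by
    intro x hx
    rw [List.mem_ofFn]
    exact ⟨e.symm ⟨x, hx⟩, congrArg Subtype.val (e.apply_symm_apply ⟨x, hx⟩)⟩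
  refine ⟨u, maxBagSize_le (by positivity) fun B' hB' => ?_⟩
  obtain ⟨N', θ', P', e1, e2, e3, e4⟩ := h.bigsplitPass hd hadj hM
    (List.ofFn fun i => (u i : Node L))
  obtain ⟨hexp, hnonrep⟩ := e4 B' hB'
  rw [← e1, List.mem_map] at hB'
  obtain ⟨⟨B'', C'⟩, hq, hBB⟩ := hB'
  simp only at hBB
  subst hBB
  have hp' := e3.pieces _ (List.mem_append_left _ hq)
  simp only at hp'
  have hρN := hp.subset _ hp.rep_mem
  obtain ⟨v, hv1, hv2⟩ := hp'.exists_separator hd hM e3.naming hexp (e2.subset _ hρN)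
    (fun hρ => by
      by_contra hc
      exact (hnonrep _ hρ hc).2.1 rfl)
  rw [e2.eq _ hρN] at hv1 hv2
  have hsub : B''.nodes.erase B''.rep ⊆ sub v := by
    intro x hx
    obtain ⟨hxr, hx⟩ := Finset.mem_erase.1 hx
    obtain ⟨h1, h2, -⟩ := hnonrep x hx hxr
    refine Finset.mem_filter.2 ⟨Finset.mem_erase.2 ⟨h2, h1⟩, ?_⟩
    rw [← e2.eq _ (hp.subset x h1)]
    exact hv1 x hx hxr
  have hlt : (sub v).card < s := by
    by_contra hc
    obtain ⟨x, hx, hxH⟩ := hhit (sub v) (Finset.mem_filter.2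
      ⟨Finset.mem_image_of_mem _ (Finset.mem_univ _), not_lt.1 hc⟩)
    obtain ⟨hxA, hxv⟩ := Finset.mem_filter.1 hx
    have hxN := hp.subset x (Finset.mem_of_mem_erase hxA)
    obtain ⟨h1, h2⟩ := hv2 x (e2.subset x hxN) (by rw [e2.eq x hxN]; exact hxv)
    exact (hnonrep x h1 h2).2.2 (hu x (hHH' hxH))
  -- Fewer than s nodes, plus the representative.
  have hcard : B''.nodes.card ≤ s := by
    have h1 := Finset.card_le_card hsub
    have h2 := Finset.card_erase_add_one hp'.rep_mem
    omega
  calc (B''.nodes.card : ℝ) ≤ s := by exact_mod_cast hcard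
    _ ≤ _ := Nat.floor_le (by positivity)

/-! ### A rank that decreases -/

/-- The rank of a list of bags. -/
def bagRank (l : List (Bag L)) : ℕ := (l.map fun B => max 1 (B.nodes.erase B.rep).card).sum

theorem sum_card_le {A : Finset (Node L)} {l : List (Bag L)}
    (hl : l.Pairwise fun B B' => Disjoint (B.nodes.erase B.rep) (B'.nodes.erase B'.rep))
    (hA : ∀ B ∈ l, B.nodes.erase B.rep ⊆ A) :
    (l.map fun B => (B.nodes.erase B.rep).card).sum ≤ A.card := by
  induction l generalizing A with
  | nil => simp
  | cons B l ih =>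
    rw [List.pairwise_cons] at hl
    have h1 := ih hl.2 (A := A \ B.nodes.erase B.rep) (fun B' hB' =>
      Finset.subset_sdiff.2 ⟨hA B' (List.mem_cons_of_mem _ hB'), (hl.1 B' hB').symm⟩)
    have h2 := hA B List.mem_cons_self
    rw [Finset.card_sdiff_of_subset h2] at h1
    have h3 := Finset.card_le_card h2
    simp only [List.map_cons, List.sum_cons]
    omega

/-- Exploded bags have at least one non-representative, so the maximum with 1 has no effect on the
new bags and their rank counts disjoint sets of old non-representatives, without the sampled ones.
On the old bag, the maximum with 1 keeps the inequality strict when it has only its representative.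
-/
theorem Inv.bagRank_lt (hd : IsTreeMetric d) (hadj : AdjOfMetric T d)
    (hM : MedianLabelled d (Set.range lab)) (h : Inv T d lab N θ ((B, C) :: P) S m) {Δ : ℕ}
    (h0 : Δ = 0 → B.nodes.erase B.rep = ∅) (u : Fin Δ ↪ {v // v ∈ B.nodes.erase B.rep}) :
    bagRank (LatentTree.bigsplitPass m B (List.ofFn fun i => (u i : Node L))).bags <
      max 1 (B.nodes.erase B.rep).card := by
  classical
  obtain ⟨N', θ', P', e1, e2, e3, e4⟩ := h.bigsplitPass hd hadj hM
    (List.ofFn fun i => (u i : Node L))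
  set us := List.ofFn fun i => (u i : Node L) with hus
  set l := (LatentTree.bigsplitPass m B us).bags with hl
  have hrank : bagRank l = (l.map fun B => (B.nodes.erase B.rep).card).sum := by
    unfold bagRank
    congr 1
    apply List.map_congr_left
    intro B' hB'
    obtain ⟨x, hx, hxr, -⟩ := (e4 B' hB').1
    exact max_eq_right (Finset.card_pos.2 ⟨x, Finset.mem_erase.2 ⟨hxr, hx⟩⟩)
  have hpair : l.Pairwise fun B B' => Disjoint (B.nodes.erase B.rep) (B'.nodes.erase B'.rep) := by
    rw [← e1, List.pairwise_map]
    refine (List.pairwise_append.1 e3.disjoint).1.imp_of_mem ?_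
    intro p q hp hq hpq
    have hp' := e3.pieces p (List.mem_append_left _ hp)
    have hq' := e3.pieces q (List.mem_append_left _ hq)
    rw [Finset.disjoint_left]
    intro x hx hx'
    obtain ⟨hxr, hx⟩ := Finset.mem_erase.1 hx
    have := (hpq _ (hp'.theta_mem hx) (hq'.theta_mem (Finset.mem_of_mem_erase hx'))).1
    exact hxr (e3.naming.inj (hp'.subset _ hx) (hp'.subset _ hp'.rep_mem) this)
  have hsum := sum_card_le (A := (B.nodes.erase B.rep).filter (· ∉ us)) hpair (by
    intro B' hB' x hx
    obtain ⟨hxr, hx⟩ := Finset.mem_erase.1 hx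
    obtain ⟨h1, h2, h3⟩ := (e4 B' hB').2 x hx hxr
    exact Finset.mem_filter.2 ⟨Finset.mem_erase.2 ⟨h2, h1⟩, h3⟩)
  rw [← hrank] at hsum
  rcases Nat.eq_zero_or_pos Δ with hΔ | hΔ
  · have : ((B.nodes.erase B.rep).filter (· ∉ us)).card = 0 := by
      rw [h0 hΔ]
      simp
    omega
  · have : ((B.nodes.erase B.rep).filter (· ∉ us)).card < (B.nodes.erase B.rep).card := by
      apply Finset.card_lt_card
      rw [Finset.filter_ssubset]
      exact ⟨(u ⟨0, hΔ⟩).1, (u ⟨0, hΔ⟩).2, not_not.2 (by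
        rw [hus, List.mem_ofFn]
        exact ⟨_, rfl⟩)⟩
    omega

end Sample

/-! ### Markov chains with a decreasing rank -/

section Chain

variable {α β : Type*}

theorem tsum_bind_mul (p : PMF α) (k : α → PMF β) (h : β → ENNReal) :
    ∑' y, p.bind k y * h y = ∑' x, p x * ∑' y, k x y * h y := by
  simp only [PMF.bind_apply, ← ENNReal.tsum_mul_right, ← ENNReal.tsum_mul_left]
  rw [ENNReal.tsum_comm]
  simp only [mul_assoc]

theorem tsum_pure_mul (x : α) (h : α → ENNReal) : ∑' y, PMF.pure x y * h y = h x := by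
  rw [tsum_eq_single x]
  · simp
  · intro y hy
    simp [hy]

theorem tsum_map_mul (p : PMF α) (f : α → β) (h : β → ENNReal) :
    ∑' y, p.map f y * h y = ∑' x, p x * h (f x) := by
  unfold PMF.map
  rw [tsum_bind_mul]
  simp only [Function.comp_apply, tsum_pure_mul]

theorem toOuterMeasure_compl (p : PMF α) (A : Set α) :
    p.toOuterMeasure A = 1 - p.toOuterMeasure Aᶜ := by
  have h1 : p.toOuterMeasure A + p.toOuterMeasure Aᶜ = 1 := by
    rw [PMF.toOuterMeasure_apply, PMF.toOuterMeasure_apply, ← ENNReal.tsum_add, ← p.tsum_coe]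
    congr 1
    ext x
    by_cases hx : x ∈ A <;> simp [hx]
  refine ENNReal.eq_sub_of_add_eq (fun h => ?_) h1
  rw [h, add_top] at h1
  exact ENNReal.top_ne_one h1

/-- If the expected rank decreases by at least `ε` in every step outside of `A`, then the chain
reaches `A` with probability one. -/
theorem tendsto_toOuterMeasure_of_drift (p : ℕ → PMF α) (k : α → PMF α)
    (hp : ∀ t, p (t + 1) = (p t).bind k) (x₀ : α) (h0 : p 0 = PMF.pure x₀) (A : Set α)
    (rank : α → ℕ) {ε : ENNReal} (hε : ε ≠ 0) (hε' : ε ≠ ⊤)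
    (hdrift : ∀ t, ∀ x ∈ (p t).support,
      ∑' y, k x y * (rank y : ENNReal) + ε * Aᶜ.indicator 1 x ≤ rank x) :
    Tendsto (fun t => (p t).toOuterMeasure A) atTop (𝓝 1) := by
  let E : ℕ → ENNReal := fun t => ∑' x, p t x * (rank x : ENNReal)
  let q : ℕ → ENNReal := fun t => (p t).toOuterMeasure Aᶜ
  have hq : ∀ t, ε * q t = ∑' x, p t x * (ε * Aᶜ.indicator 1 x) := by
    intro t
    simp only [q, PMF.toOuterMeasure_apply, ← ENNReal.tsum_mul_left]
    congr 1
    ext x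
    by_cases hx : x ∈ A <;> simp [hx, mul_comm]
  -- The expected rank pays ε for every unit of probability outside of A; telescoping bounds the sum
  -- of these probabilities by `rank x₀ / ε`.
  have hE : ∀ t, E (t + 1) + ε * q t ≤ E t := by
    intro t
    simp only [E, hp, tsum_bind_mul]
    rw [hq, ← ENNReal.tsum_add]
    apply ENNReal.tsum_le_tsum
    intro x
    rw [← mul_add]
    by_cases hx : p t x = 0
    · simp [hx]
    · exact mul_le_mul_right (hdrift t x hx) _
  have hsum : ∀ n, E n + ∑ t ∈ Finset.range n, ε * q t ≤ E 0 := by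
    intro n
    induction n with
    | zero => simp
    | succ n ih =>
      rw [Finset.sum_range_succ, add_comm (∑ t ∈ Finset.range n, ε * q t), ← add_assoc]
      exact (add_le_add_left (hE n) _).trans ih
  have hE0 : E 0 = rank x₀ := by
    simp only [E, h0, tsum_pure_mul]
  have htsum : ∑' t, ε * q t ≤ rank x₀ := by
    rw [← hE0]
    apply ENNReal.tsum_le_of_sum_range_le
    intro n
    exact le_add_self.trans (hsum n)
  have hlim : Tendsto (fun t => ε * q t) atTop (𝓝 0) :=
    ENNReal.tendsto_atTop_zero_of_tsum_ne_top (ne_top_of_le_ne_top (ENNReal.natCast_ne_top _) htsum)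
  have hlim' : Tendsto q atTop (𝓝 0) := by
    have h1 := ENNReal.Tendsto.const_mul (a := ε⁻¹) hlim (Or.inr (ENNReal.inv_ne_top.2 hε))
    rw [mul_zero] at h1
    refine h1.congr fun t => ?_
    rw [← mul_assoc, ENNReal.inv_mul_cancel hε hε', one_mul]
  have h2 := ENNReal.Tendsto.sub (tendsto_const_nhds (x := (1 : ENNReal)) (f := atTop)) hlim'
    (Or.inl ENNReal.one_ne_top)
  rw [tsub_zero] at h2
  refine h2.congr fun t => ?_
  exact (toOuterMeasure_compl _ _).symm

end Chain

/-! ### The main algorithm -/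

section Algorithm

variable {V L : Type*} [DecidableEq L] {d : V → V → ℝ} {lab : L → V} {T : SimpleGraph V}

/-- The state satisfies the invariant for some identification of nodes with vertices. -/
def GoodState (T : SimpleGraph V) (d : V → V → ℝ) (lab : L → V) (s : State L) : Prop :=
  ∃ N θ P, P.map Prod.fst = s.queue ∧ Inv T d lab N θ P s.skeleton s.mem

theorem GoodState.attempt (hd : IsTreeMetric d) (hadj : AdjOfMetric T d)
    (hM : MedianLabelled d (Set.range lab)) {s : State L} (h : GoodState T d lab s) {B : Bag L}
    {q : List (Bag L)} (hs : s.queue = B :: q) {Δ : ℕ}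
    (h0 : Δ = 0 → B.nodes.erase B.rep = ∅) (u : Fin Δ ↪ {v // v ∈ B.nodes.erase B.rep}) :
    let s' := attempt Δ s B q (List.ofFn fun i => (u i : Node L))
    GoodState T d lab s' ∧ bagRank s'.queue ≤ bagRank s.queue ∧
      ((maxBagSize (bigsplitPass s.mem B (List.ofFn fun i => (u i : Node L))).bags : ℝ) ≤
        (B.nodes.card : ℝ) / √(Δ : ℝ) → bagRank s'.queue + 1 ≤ bagRank s.queue) := by
  intro s'
  obtain ⟨N, θ, P, hP, hI⟩ := id h
  rw [hs] at hP
  obtain ⟨⟨B', C⟩, Q, rfl, hB', hQ⟩ := List.map_eq_cons_iff.1 hP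
  simp only at hB'
  subst hB'
  have hs' : s' = if (maxBagSize (bigsplitPass s.mem B' (List.ofFn fun i => (u i : Node L))).bags
      : ℝ) ≤ (B'.nodes.card : ℝ) / √(Δ : ℝ) then _ else s := rfl
  by_cases hc : (maxBagSize (bigsplitPass s.mem B' (List.ofFn fun i => (u i : Node L))).bags : ℝ) ≤
      (B'.nodes.card : ℝ) / √(Δ : ℝ)
  · rw [if_pos hc] at hs'
    have hlt := hI.bagRank_lt hd hadj hM h0 u
    obtain ⟨N', θ', P', e1, -, e3, -⟩ := hI.bigsplitPass hd hadj hM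
      (List.ofFn fun i => (u i : Node L))
    have hrank : bagRank s'.queue + 1 ≤ bagRank s.queue := by
      rw [hs', hs]
      simp only [bagRank, List.map_append, List.sum_append, List.map_cons, List.sum_cons] at hlt ⊢
      omega
    refine ⟨⟨N', θ', Q ++ P', ?_, ?_⟩, Nat.le_of_succ_le hrank, fun _ => hrank⟩
    · rw [hs']
      simp only [List.map_append, hQ, e1]
    · rw [hs']
      exact e3.perm List.perm_append_comm
  · rw [if_neg hc] at hs'
    rw [hs']
    exact ⟨h, le_rfl, fun hc' => absurd hc' hc⟩

theorem GoodState.finish [Finite V] (hT : IsSemiLabelledTree T (Set.range lab))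
    {len : Sym2 V → ℝ} (hlen : ∀ e ∈ T.edgeSet, 0 < len e) (hsum : IsPathSum T len d)
    {s : State L} (h : GoodState T d lab s) {B : Bag L} {q : List (Bag L)}
    (hs : s.queue = B :: q) :
    GoodState T d lab (finish s B q) ∧ bagRank q + 1 ≤ bagRank s.queue := by
  obtain ⟨N, θ, P, hP, hI⟩ := h
  rw [hs] at hP
  obtain ⟨⟨B', C⟩, Q, rfl, hB', hQ⟩ := List.map_eq_cons_iff.1 hP
  simp only at hB'
  subst hB'
  obtain ⟨N', θ', hI'⟩ := hI.finish hT hlen hsum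
  refine ⟨⟨N', θ', Q, hQ, hI'⟩, ?_⟩
  rw [hs]
  simp only [bagRank, List.map_cons, List.sum_cons]
  omega

theorem GoodState.erase_eq_empty [Subsingleton V] {s : State L} (h : GoodState T d lab s)
    {B : Bag L} {q : List (Bag L)} (hs : s.queue = B :: q) : B.nodes.erase B.rep = ∅ := by
  obtain ⟨N, θ, P, hP, hI⟩ := h
  rw [hs] at hP
  obtain ⟨⟨B', C⟩, Q, rfl, hB', hQ⟩ := List.map_eq_cons_iff.1 hP
  simp only at hB'
  subst hB'
  have hp := hI.pieces _ List.mem_cons_self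
  rw [Finset.eq_empty_iff_forall_notMem]
  intro x hx
  obtain ⟨hxr, hx⟩ := Finset.mem_erase.1 hx
  exact hxr (hI.naming.inj (hp.subset x hx) (hp.subset _ hp.rep_mem) (Subsingleton.elim _ _))

theorem GoodState.step_support [Finite V] (hT : IsSemiLabelledTree T (Set.range lab))
    {len : Sym2 V → ℝ} (hlen : ∀ e ∈ T.edgeSet, 0 < len e) (hsum : IsPathSum T len d)
    {Δ : ℕ} (h0 : Δ = 0 → Subsingleton V) {s : State L} (h : GoodState T d lab s) {s' : State L}
    (hs' : s' ∈ (step Δ s).support) : GoodState T d lab s' := by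
  have hd := hsum.isTreeMetric hT.isTree hlen
  have hadj := hsum.adjOfMetric hT.isTree hlen
  have hM := medianLabelled_of_isSemiLabelledTree hd hadj hT.mem_of_degree_le_two
  rcases hq : s.queue with _ | ⟨B, q⟩
  · have : step Δ s = PMF.pure s := by
      unfold step
      rw [hq]
    rw [this, PMF.support_pure, Set.mem_singleton_iff] at hs'
    exact hs' ▸ h
  by_cases hB : B.nodes.card ≤ Δ
  · have : step Δ s = PMF.pure (LatentTree.finish s B q) := by
      unfold step
      rw [hq]
      simp only [dif_pos hB]
    rw [this, PMF.support_pure, Set.mem_singleton_iff] at hs'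
    exact hs' ▸ (h.finish hT hlen hsum hq).1
  · have := nonempty_samples hB
    have : step Δ s = (PMF.uniformOfFintype (Fin Δ ↪ {v // v ∈ B.nodes.erase B.rep})).map
        (fun u => LatentTree.attempt Δ s B q (List.ofFn (fun i => (u i : Node L)))) := by
      unfold step
      rw [hq]
      simp only [dif_neg hB]
    rw [this, PMF.support_map] at hs'
    obtain ⟨u, -, rfl⟩ := hs'
    exact (h.attempt hd hadj hM hq (fun h' => by
      have := h0 h'
      exact h.erase_eq_empty hq) u).1

/-- Non-representatives are regular, however many latent nodes have been created. The bound does not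
depend on the state, so the drift is uniform. -/
theorem GoodState.card_samples_le [Fintype L] {s : State L} (h : GoodState T d lab s)
    {B : Bag L} {q : List (Bag L)} (hs : s.queue = B :: q) (Δ : ℕ) :
    Fintype.card (Fin Δ ↪ {v // v ∈ B.nodes.erase B.rep}) ≤ Fintype.card L ^ Δ := by
  obtain ⟨N, θ, P, hP, hI⟩ := h
  rw [hs] at hP
  obtain ⟨⟨B', C⟩, Q, rfl, hB', hQ⟩ := List.map_eq_cons_iff.1 hP
  simp only at hB'
  subst hB'
  have hp := hI.pieces _ List.mem_cons_self
  rw [Fintype.card_embedding_eq, Fintype.card_fin, Fintype.card_coe]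
  refine (Nat.descFactorial_le_pow _ _).trans (Nat.pow_le_pow_left ?_ _)
  have hsub : B'.nodes.erase B'.rep ⊆ Finset.univ.image Sum.inl := by
    intro x hx
    obtain ⟨hxr, hx⟩ := Finset.mem_erase.1 hx
    obtain ⟨i, rfl⟩ := (hp.regular x hx).resolve_left hxr
    simp
  exact (Finset.card_le_card hsub).trans Finset.card_image_le

/-- Finishing a bag lowers the rank by at least 1. In a pass of `bigsplit` no sample raises it, a
failed one leaves the state alone, and at least one of the equally likely samples lowers it by 1. -/
theorem GoodState.drift [Finite V] [Fintype L] [Nonempty L]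
    (hT : IsSemiLabelledTree T (Set.range lab))
    {len : Sym2 V → ℝ} (hlen : ∀ e ∈ T.edgeSet, 0 < len e) (hsum : IsPathSum T len d)
    {Δ : ℕ} (h0 : Δ = 0 → Subsingleton V) {s : State L} (h : GoodState T d lab s) :
    ∑' s', step Δ s s' * (bagRank s'.queue : ENNReal) +
      ((Fintype.card L ^ Δ : ℕ) : ENNReal)⁻¹ * {s : State L | s.queue = []}ᶜ.indicator 1 s ≤
        bagRank s.queue := by
  have hd := hsum.isTreeMetric hT.isTree hlen
  have hadj := hsum.adjOfMetric hT.isTree hlen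
  have hM := medianLabelled_of_isSemiLabelledTree hd hadj hT.mem_of_degree_le_two
  have hK : 1 ≤ Fintype.card L ^ Δ := Nat.one_le_pow _ _ Fintype.card_pos
  rcases hq : s.queue with _ | ⟨B, q⟩
  · have : step Δ s = PMF.pure s := by
      unfold step
      rw [hq]
    rw [this, tsum_pure_mul, hq]
    simp [hq]
  rw [Set.indicator_of_mem (show s ∈ {s : State L | s.queue = []}ᶜ by simp [hq]), Pi.one_apply,
    mul_one, ← hq]
  by_cases hB : B.nodes.card ≤ Δ
  · have : step Δ s = PMF.pure (LatentTree.finish s B q) := by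
      unfold step
      rw [hq]
      simp only [dif_pos hB]
    rw [this, tsum_pure_mul]
    have h1 := (h.finish hT hlen hsum hq).2
    calc (bagRank (LatentTree.finish s B q).queue : ENNReal) +
          ((Fintype.card L ^ Δ : ℕ) : ENNReal)⁻¹
        ≤ (bagRank q : ENNReal) + 1 := by
          refine add_le_add le_rfl (ENNReal.inv_le_one.2 ?_)
          exact_mod_cast hK
      _ ≤ _ := by exact_mod_cast h1
  · have := nonempty_samples hB
    have : step Δ s = (PMF.uniformOfFintype (Fin Δ ↪ {v // v ∈ B.nodes.erase B.rep})).map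
        (fun u => LatentTree.attempt Δ s B q (List.ofFn (fun i => (u i : Node L)))) := by
      unfold step
      rw [hq]
      simp only [dif_neg hB]
    have h0' : Δ = 0 → B.nodes.erase B.rep = ∅ := fun h' => by
      have := h0 h'
      exact h.erase_eq_empty hq
    have hatt := h.attempt hd hadj hM hq h0'
    obtain ⟨u₀, hu₀⟩ : ∃ u : Fin Δ ↪ {v // v ∈ B.nodes.erase B.rep},
        (maxBagSize (bigsplitPass s.mem B (List.ofFn fun i => (u i : Node L))).bags : ℝ) ≤
        (B.nodes.card : ℝ) / √(Δ : ℝ) := by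
      obtain ⟨N, θ, P, hP, hI⟩ := id h
      rw [hq] at hP
      obtain ⟨⟨B', C⟩, Q, rfl, hB', hQ⟩ := List.map_eq_cons_iff.1 hP
      simp only at hB'
      subst hB'
      exact hI.exists_good_sample hd hadj hM hB h0'
    rw [this, tsum_map_mul, tsum_fintype]
    simp only [PMF.uniformOfFintype_apply, ← Finset.mul_sum]
    set c := Fintype.card (Fin Δ ↪ {v // v ∈ B.nodes.erase B.rep}) with hc
    have hc0 : (c : ENNReal) ≠ 0 := by
      exact_mod_cast (Fintype.card_pos (α := Fin Δ ↪ {v // v ∈ B.nodes.erase B.rep})).ne'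
    have hcK : ((Fintype.card L ^ Δ : ℕ) : ENNReal)⁻¹ ≤ (c : ENNReal)⁻¹ := by
      rw [ENNReal.inv_le_inv]
      exact_mod_cast h.card_samples_le hq Δ
    have hsum : ∑ u : Fin Δ ↪ {v // v ∈ B.nodes.erase B.rep},
        bagRank (LatentTree.attempt Δ s B q (List.ofFn fun i => (u i : Node L))).queue + 1 ≤
          c * bagRank s.queue := by
      have h1 : ∑ u : Fin Δ ↪ {v // v ∈ B.nodes.erase B.rep},
          bagRank (LatentTree.attempt Δ s B q (List.ofFn fun i => (u i : Node L))).queue <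
          ∑ u : Fin Δ ↪ {v // v ∈ B.nodes.erase B.rep}, bagRank s.queue :=
        Finset.sum_lt_sum (fun u _ => (hatt u).2.1) ⟨u₀, Finset.mem_univ _, (hatt u₀).2.2 hu₀⟩
      rw [Finset.sum_const, Finset.card_univ, smul_eq_mul] at h1
      exact h1
    calc _ ≤ (c : ENNReal)⁻¹ * ∑ u : Fin Δ ↪ {v // v ∈ B.nodes.erase B.rep},
          (bagRank (LatentTree.attempt Δ s B q (List.ofFn fun i => (u i : Node L))).queue : ENNReal)
          + (c : ENNReal)⁻¹ := add_le_add le_rfl hcK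
      _ = (c : ENNReal)⁻¹ * (∑ u : Fin Δ ↪ {v // v ∈ B.nodes.erase B.rep},
          (bagRank (LatentTree.attempt Δ s B q (List.ofFn fun i => (u i : Node L))).queue : ENNReal)
          + 1) := by rw [mul_add, mul_one]
      _ ≤ (c : ENNReal)⁻¹ * (c * bagRank s.queue) := by
        refine mul_le_mul_right ?_ _
        exact_mod_cast hsum
      _ = bagRank s.queue := by
        rw [← mul_assoc, ENNReal.inv_mul_cancel hc0 (ENNReal.natCast_ne_top c), one_mul]

theorem goodState_initialState [Fintype L] (hlab : Function.Injective lab)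
    (root : L) :
    GoodState T d lab (initialState (fun i j => d (lab i) (lab j)) root) := by
  -- No latent node is in use yet, so its image under θ is arbitrary.
  refine ⟨Set.range Sum.inl, Sum.elim lab fun _ => lab root, [(_, Set.univ)], rfl, ?_⟩
  have hmem : ∀ x : Node L, x ∈ Finset.univ.image Sum.inl ↔
      x ∈ Set.range (Sum.inl : L → Node L) := by
    intro x
    simp
  refine ⟨⟨fun i => ⟨i, rfl⟩, fun i => rfl, ?_, ?_, fun k _ => rfl⟩, ?_,
    List.pairwise_singleton _ _, by simp [initialState], by simp [initialState], ?_⟩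
  · rintro _ ⟨i, rfl⟩ _ ⟨j, rfl⟩ hij
    exact congrArg Sum.inl (hlab hij)
  · rintro k ⟨i, hi⟩
    exact absurd hi (by simp)
  · intro p hp
    rw [List.mem_singleton] at hp
    subst hp
    refine ⟨(hmem _).2 ⟨root, rfl⟩, fun x _ y hy => absurd (Set.mem_univ y) hy,
      fun x hx => (hmem x).1 hx, fun x hx => ?_, fun x hx => ?_, fun x hx y hy => ?_⟩
    · exact ⟨fun _ => Set.mem_univ _, fun _ => (hmem x).2 hx⟩
    · obtain ⟨i, rfl⟩ := (hmem x).1 hx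
      exact Or.inr ⟨i, rfl⟩
    · obtain ⟨i, rfl⟩ := (hmem x).1 hx
      obtain ⟨j, rfl⟩ := (hmem y).1 hy
      rfl
  · intro a b _
    exact Or.inr ⟨_, List.mem_singleton_self _, Set.mem_univ _, Set.mem_univ _⟩

theorem GoodState.of_mem_support_run [Finite V] [Fintype L]
    (hT : IsSemiLabelledTree T (Set.range lab)) {len : Sym2 V → ℝ}
    (hlen : ∀ e ∈ T.edgeSet, 0 < len e) (hsum : IsPathSum T len d)
    (hlab : Function.Injective lab) {Δ : ℕ} (h0 : Δ = 0 → Subsingleton V) (root : L) (t : ℕ)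
    {s : State L} (hs : s ∈ (run Δ (fun i j => d (lab i) (lab j)) root t).support) :
    GoodState T d lab s := by
  induction t generalizing s with
  | zero =>
    rw [run, PMF.support_pure, Set.mem_singleton_iff] at hs
    exact hs ▸ goodState_initialState hlab root
  | succ t ih =>
    rw [run, PMF.mem_support_bind_iff] at hs
    obtain ⟨s', hs', hs⟩ := hs
    exact (ih hs').step_support hT hlen hsum h0 hs

end Algorithm

/-! ### Reading off the tree and conclusion -/

theorem Inv.recovers {V : Type*} [Finite V] [DecidableEq V] {T : SimpleGraph V} {W : Finset V}
    (hT : IsSemiLabelledTree T (W : Set V)) {d : V → V → ℝ} {N : Set (Node W)} {θ : Node W → V}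
    {S : Finset (Sym2 (Node W))} {m : Memory W} (h : Inv T d (Subtype.val : W → V) N θ [] S m) :
    Recovers T W S := by
  have hcover : ∀ a b, T.Adj a b → ∃ x y, s(x, y) ∈ S ∧ θ x = a ∧ θ y = b := by
    intro a b hab
    -- Without bags, every edge of T has to come from the skeleton.
    simpa using h.cover a b hab
  have hname : ∀ v, ∃ x ∈ N, θ x = v := by
    intro v
    by_cases hv : v ∈ W
    · exact ⟨Sum.inl ⟨v, hv⟩, h.naming.inl_mem _, h.naming.inl_eq _⟩
    -- A latent vertex has a neighbour, so it is named as an end of an edge of the skeleton.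
    · have h1 : 2 < (T.neighborSet v).ncard := not_le.1 fun h' => hv (hT.mem_of_degree_le_two v h')
      obtain ⟨w, hw⟩ : (T.neighborSet v).Nonempty := by
        rw [← Set.ncard_pos]
        omega
      obtain ⟨x, y, hxy, hx, -⟩ := hcover v w hw
      exact ⟨x, h.mem _ hxy x (Sym2.mem_mk_left x y), hx⟩
  choose φ hφN hφ using hname
  have hφθ : ∀ x ∈ N, φ (θ x) = x := fun x hx => h.naming.inj (hφN _) hx (hφ _)
  refine ⟨φ, fun v w hvw => ?_, fun i => ?_, ?_⟩
  · rw [← hφ v, ← hφ w, hvw]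
  · have := hφθ _ (h.naming.inl_mem i)
    rwa [h.naming.inl_eq] at this
  · ext e
    constructor
    · rintro ⟨e, he, rfl⟩
      induction e with
      | _ a b =>
        obtain ⟨x, y, hxy, rfl, rfl⟩ := hcover a b he
        rw [Sym2.map_mk, hφθ x (h.mem _ hxy x (Sym2.mem_mk_left x y)),
          hφθ y (h.mem _ hxy y (Sym2.mem_mk_right x y))]
        exact hxy
    · intro he
      induction e with
      | _ x y =>
        refine ⟨s(θ x, θ y), h.adj x y he, ?_⟩
        rw [Sym2.map_mk, hφθ x (h.mem _ he x (Sym2.mem_mk_left x y)),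
          hφθ y (h.mem _ he y (Sym2.mem_mk_right x y))]

/-- With Δ = 0 nothing is sampled; this degenerate case is harmless because the only bag then has no
node besides its representative. -/
theorem subsingleton_of_maxDegree_eq_zero {V : Type*} [Fintype V] {T : SimpleGraph V}
    [DecidableRel T.Adj] (hT : T.Connected) (h : T.maxDegree = 0) : Subsingleton V := by
  refine ⟨fun x y => ?_⟩
  obtain ⟨p⟩ := hT.preconnected x y
  cases p with
  | nil => rfl
  | @cons _ z _ hxz q =>
    have h1 := T.degree_le_maxDegree x
    have h2 := (T.degree_pos_iff_exists_adj x).2 ⟨z, hxz⟩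
    omega

end LatentTree

open LatentTree

theorem mainTheorem6 {V : Type*} [Fintype V] [DecidableEq V]
    (T : SimpleGraph V) [DecidableRel T.Adj] (W : Finset V)
    (hT : IsSemiLabelledTree T (W : Set V))
    {r : ℕ} (f : (V → Fin r) → ℝ) (hf : IsGeneralMarkovModel T f)
    (hdet : ∀ u v, T.Adj u v → (jointMatrix f u v).det ≠ 0)
    (hlen : ∀ u v, T.Adj u v → |tau f u v| ≠ 1)
    (root : W) :
    (∀ (t : ℕ), ∀ s ∈ (run T.maxDegree (fun i j : W => -Real.log |tau f i j|) root t).support,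
      s.queue = [] → Recovers T W s.skeleton) ∧
    Tendsto (fun t : ℕ =>
      (run T.maxDegree (fun i j : W => -Real.log |tau f i j|) root t).toOuterMeasure
        {s | s.queue = []}) atTop (𝓝 1) := by
  obtain ⟨len, hpos, hsum⟩ := hf.exists_isPathSum hT.isTree hdet hlen
  have hT' : IsSemiLabelledTree T (Set.range (Subtype.val : W → V)) := by
    rw [Subtype.range_coe]
    exact hT
  have h0 := subsingleton_of_maxDegree_eq_zero hT.isTree.connected
  have hgood := fun t s => GoodState.of_mem_support_run (s := s) hT' hpos hsum
    Subtype.val_injective h0 root t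
  refine ⟨fun t s hs hq => ?_, ?_⟩
  · obtain ⟨N, θ, P, hP, hI⟩ := hgood t s hs
    rw [hq, List.map_eq_nil_iff] at hP
    subst hP
    exact hI.recovers hT
  · have : Nonempty W := ⟨root⟩
    have hK : 1 ≤ Fintype.card W ^ T.maxDegree := Nat.one_le_pow _ _ Fintype.card_pos
    refine tendsto_toOuterMeasure_of_drift _ (step T.maxDegree) (fun t => rfl) _ rfl _
      (fun s => bagRank s.queue) (ENNReal.inv_ne_zero.2 (ENNReal.natCast_ne_top _))
      (ENNReal.inv_ne_top.2 (by exact_mod_cast Nat.one_le_iff_ne_zero.1 hK))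
      (fun t s hs => (hgood t s hs).drift hT' hpos hsum h0)
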